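/- Let $d\ge 0$ and $\mathbb T^d=(\mathbb R/\mathbb Z)^d$ with its normalised Haar measure. For an integrable function $h$ on $(\mathbb T^d)^m$ let $\hat h(\xi)=\int h(x)e^{-2\pi i\sum_k\xi_k\cdot x_k}\,dx$, $\xi\in(\mathbb Z^d)^m$, and $\|h\|_{\hat l^\infty}=\sup_{\xi}|\hat h(\xi)|$. There is a universal constant $C_2$ with the following property. Let $K:\mathbb T^d\times\mathbb T^d\to\mathbb R^d$ be continuous with summable Fourier coefficients, $\sum_{\lambda,\eta\in\mathbb Z^d}|\hat K(\lambda,\eta)|<\infty$. Then there is a constant $C=C(K)\ge 0$ such that for every $\sigma>C$ and every probability density $\rho_0\in L^2(\mathbb T^d)$ the following holds. Let $(\rho_t)_{t\ge 0}$ be probability densities forming a weak solution of the McKean–Vlasov equation $$\partial_t\rho-\sigma\Delta\rho+\mathrm{div}\Big(\rho(x)\int_{\mathbb T^d}K(x,z)\rho(z)\,dz\Big)=0,\qquad \rho|_{t=0}=\rho_0.$$ Let $b_t(x,y)$, $t\ge 0$, be the Bogolyubov correction, that is, the weak solution on $\mathbb T^{2d}$, bounded in $L^1$ on bounded time intervals,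 of the linear equation $$\begin{aligned}\partial_t b-\sigma(\Delta_x+\Delta_y)b=&-\mathrm{div}_x\Big(\int K(x,z)\big[\rho(x)b(y,z)+\rho(z)b(x,y)\big]dz\Big)-\mathrm{div}_y\Big(\int K(y,z)\big[\rho(y)b(x,z)+\rho(z)b(x,y)\big]dz\Big)\\&+\mathrm{div}_x\Big(\int K(x,z)\rho(x)\rho(y)\rho(z)\,dz\Big)+\mathrm{div}_y\Big(\int K(y,z)\rho(x)\rho(y)\rho(z)\,dz\Big)\\&-\mathrm{div}_x\big(K(x,y)\rho(x)\rho(y)\big)-\mathrm{div}_y\big(K(y,x)\rho(x)\rho(y)\big)\end{aligned}$$ with $b_0=0$. For $N\ge 2$ let $f_N(t)$, $t\ge0$, be probability densities on $(\mathbb T^d)^N$ forming a weak solution of the Liouville equation $$\partial_t f_N+\sum_{i=1}^N\mathrm{div}_{x_i}\Big(f_N\,\frac1N\sum_{j=1}^NK(x_i,x_j)\Big)=\sigma\sum_{i=1}^N\Delta_{x_i}f_N,\qquad f_N|_{t=0}=\rho_0^{\otimes N},$$ let $f_{[j],N}$ be its marginal in the first $j$ variables, and let $g_{2,N}(x,y)=f_{[2],N}(x,y)-f_{[1],N}(x)f_{[1],N}(y)$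 be the two-particle correlation function, i.e. the case $m=2$ of $g_{[m],N}=\sum_{\pi\vdash[m]}(-1)^{|\pi|-1}(|\pi|-1)!\prod_{P\in\pi}f_{P,N}$, where $\pi$ runs over the partitions of $[m]=\{1,\dots,m\}$ and $f_{P,N}$ is $f_{[|P|],N}$ in the variables $x_P$. Then, for all $N\ge 2$ and all $t\ge 0$, $$\big\|N g_{2,N}(t)-b_t\big\|_{\hat l^\infty}\le\frac{C_2}{N}.$$ -/

import Mathlib

open MeasureTheory
open scoped ENNReal ContDiff

noncomputable section

namespace ParticleChaos

/-- `(𝕋^d)^m`: configurations of `m` particles on the flat torus `𝕋^d = (ℝ/ℤ)^d`.  Its `volume`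
is the product of the normalised Haar measures, of total mass one. -/
abbrev Config (m d : ℕ) : Type := Fin m → UnitAddTorus (Fin d)

/-- The Fourier coefficient `ĥ(ξ) = ∫ h(x) exp (-2πi ∑ₖ ξₖ · xₖ) dx`. -/
def fourierCoefficient {m d : ℕ} (h : Config m d → ℝ) (ξ : Fin m → Fin d → ℤ) : ℂ :=
  ∫ x : Config m d, (∏ k, UnitAddTorus.mFourier (-(ξ k)) (x k)) * (h x : ℂ)

/-- The norm `sup_ξ |ĥ(ξ)|`. -/
def hatSupNorm {m d : ℕ} (h : Config m d → ℝ) : ℝ≥0∞ :=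
  ⨆ ξ : Fin m → Fin d → ℤ, ‖fourierCoefficient h ξ‖ₑ

/-- The (vector valued) Fourier coefficient of an interaction kernel `K(x, y)`, the frequency
being the pair `ξ = (ξ 0, ξ 1)`. -/
def kernelCoefficient {d : ℕ}
    (K : UnitAddTorus (Fin d) → UnitAddTorus (Fin d) → EuclideanSpace ℝ (Fin d))
    (ξ : Fin 2 → Fin d → ℤ) : EuclideanSpace ℂ (Fin d) :=
  WithLp.toLp 2 fun a => fourierCoefficient (fun x : Config 2 d => K (x 0) (x 1) a) ξ

/-- A probability density with respect to `volume`. -/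
structure IsProbDensity {X : Type*} [MeasureSpace X] (h : X → ℝ) : Prop where
  integrable : Integrable h
  nonneg : ∀ᵐ x, 0 ≤ h x
  integral_eq_one : ∫ x, h x = 1

/-- Smooth functions on `(𝕋^d)^m`: those whose periodic lift is `C^∞`. -/
def IsTestFunction {m d : ℕ} (φ : Config m d → ℂ) : Prop :=
  ContDiff ℝ ∞ fun y : Fin m → Fin d → ℝ => φ fun k a => (y k a : UnitAddCircle)

/-- The partial derivative in the `a`-th coordinate of the `k`-th particle. -/
def partialDeriv {m d : ℕ} (k : Fin m) (a : Fin d) (φ : Config m d → ℂ) (x : Config m d) : ℂ :=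
  deriv (fun s : ℝ => φ (x + Pi.single k (Pi.single a (s : UnitAddCircle)))) 0

/-- The Laplacian in all variables. -/
def laplacian {m d : ℕ} (φ : Config m d → ℂ) (x : Config m d) : ℂ :=
  ∑ k, ∑ a, partialDeriv k a (partialDeriv k a φ) x

/-- The pairing of `σ Δ u - ∑ₖ div_{xₖ} Jₖ` with a test function, after integration by parts. -/
def weakRHS {m d : ℕ} (σ : ℝ) (u : Config m d → ℝ)
    (J : Fin m → Config m d → EuclideanSpace ℝ (Fin d)) (φ : Config m d → ℂ) : ℂ :=
  ∫ x, (((σ * u x : ℝ) : ℂ) * laplacian φ x + ∑ k, ∑ a, (J k x a : ℂ) * partialDeriv k a φ x)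

/-- `u` is a weak solution on `[0, ∞)` of `∂ₜ u + ∑ₖ div_{xₖ} Jₖ(t) = σ Δ u`, `u|_{t = 0} = u₀`. -/
def IsWeakSolution {m d : ℕ} (σ : ℝ) (u₀ : Config m d → ℝ) (u : ℝ → Config m d → ℝ)
    (J : ℝ → Fin m → Config m d → EuclideanSpace ℝ (Fin d)) : Prop :=
  ∀ φ : Config m d → ℂ, IsTestFunction φ → ∀ t : ℝ, 0 ≤ t →
    IntervalIntegrable (fun s => weakRHS σ (u s) (J s) φ) volume 0 t ∧
    ∫ x, (u t x : ℂ) * φ x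
      = (∫ x, (u₀ x : ℂ) * φ x) + ∫ s in (0 : ℝ)..t, weakRHS σ (u s) (J s) φ

/-- The flux of the Liouville equation: `Jₖ = f(x) (1/N) ∑ₗ K(xₖ, xₗ)` (self-interaction `l = k`
included). -/
def liouvilleFlux {d N : ℕ}
    (K : UnitAddTorus (Fin d) → UnitAddTorus (Fin d) → EuclideanSpace ℝ (Fin d))
    (f : Config N d → ℝ) (k : Fin N) (x : Config N d) : EuclideanSpace ℝ (Fin d) :=
  f x • ((N : ℝ)⁻¹ • ∑ l, K (x k) (x l))

/-- `f` is the flow of joint densities of the `N` particles: probability densities solving the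
Liouville equation with chaotic initial datum `ρ₀^{⊗N}`. -/
structure IsLiouvilleSolution {d N : ℕ}
    (K : UnitAddTorus (Fin d) → UnitAddTorus (Fin d) → EuclideanSpace ℝ (Fin d))
    (σ : ℝ) (ρ₀ : UnitAddTorus (Fin d) → ℝ) (f : ℝ → Config N d → ℝ) : Prop where
  density : ∀ t, 0 ≤ t → IsProbDensity (f t)
  equation : IsWeakSolution σ (fun x => ∏ i, ρ₀ (x i)) f fun t => liouvilleFlux K (f t)

/-- The flux of the McKean-Vlasov equation: `J = ρ(x) ∫ K(x, z) ρ(z) dz`. -/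
def mckeanVlasovFlux {d : ℕ}
    (K : UnitAddTorus (Fin d) → UnitAddTorus (Fin d) → EuclideanSpace ℝ (Fin d))
    (ρ : UnitAddTorus (Fin d) → ℝ) (k : Fin 1) (x : Config 1 d) : EuclideanSpace ℝ (Fin d) :=
  ρ (x k) • ∫ z, ρ z • K (x k) z

/-- `ρ` is a flow of probability densities solving the McKean-Vlasov equation with initial datum
`ρ₀`. -/
structure IsMcKeanVlasovSolution {d : ℕ}
    (K : UnitAddTorus (Fin d) → UnitAddTorus (Fin d) → EuclideanSpace ℝ (Fin d))
    (σ : ℝ) (ρ₀ : UnitAddTorus (Fin d) → ℝ) (ρ : ℝ → UnitAddTorus (Fin d) → ℝ) : Prop where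
  density : ∀ t, 0 ≤ t → IsProbDensity (ρ t)
  equation : IsWeakSolution σ (fun x : Config 1 d => ρ₀ (x 0)) (fun t x => ρ t (x 0))
    fun t => mckeanVlasovFlux K (ρ t)

/-- The flux of the linear equation of the Bogolyubov correction.  With `x' = x k` the `k`-th
variable and `y'` the other one, it is
`∫ K(x', z) (ρ(x') b(y', z) + ρ(z) b(x) - ρ(x') ρ(y') ρ(z)) dz + K(x', y') ρ(x') ρ(y')`. -/
def bogolyubovFlux {d : ℕ}
    (K : UnitAddTorus (Fin d) → UnitAddTorus (Fin d) → EuclideanSpace ℝ (Fin d))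
    (ρ : UnitAddTorus (Fin d) → ℝ) (b : Config 2 d → ℝ) (k : Fin 2) (x : Config 2 d) :
    EuclideanSpace ℝ (Fin d) :=
  (∫ z, (ρ (x k) * b ![x k.rev, z] + ρ z * b x - ρ (x k) * ρ (x k.rev) * ρ z) • K (x k) z)
    + (ρ (x k) * ρ (x k.rev)) • K (x k) (x k.rev)

/-- `b` is the Bogolyubov correction along `ρ`: the weak solution, locally bounded in time with
values in `L¹`, of the linear equation with flux `bogolyubovFlux` and initial datum `0`. -/
structure IsBogolyubovCorrection {d : ℕ}
    (K : UnitAddTorus (Fin d) → UnitAddTorus (Fin d) → EuclideanSpace ℝ (Fin d))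
    (σ : ℝ) (ρ : ℝ → UnitAddTorus (Fin d) → ℝ) (b : ℝ → Config 2 d → ℝ) : Prop where
  integrable : ∀ t, 0 ≤ t → Integrable (b t)
  locally_bounded : ∀ T : ℝ, ∃ M : ℝ, ∀ t, 0 ≤ t → t ≤ T → ∫ x, |b t x| ≤ M
  equation : IsWeakSolution σ (fun _ => 0) b fun t => bogolyubovFlux K (ρ t) (b t)

/-- The `j`-marginal (`j ≤ N`) of `f`: the density of the first `j` particles, the variables of the
particles `j, …, N - 1` being integrated out.  (The auxiliary variables `y i` with `i < j` do not
occur in the integrand and contribute a factor one.) -/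
def marginal {d N : ℕ} (f : Config N d → ℝ) (j : ℕ) (x : Config j d) : ℝ :=
  ∫ y : Config N d, f fun i => if h : i.val < j then x ⟨i.val, h⟩ else y i

/-- The `m`-particle correlation function
`g_m = ∑_{π ⊢ [m]} (-1)^{|π|-1} (|π|-1)! ∏_{P ∈ π} f_{|P|}(x_P)`. -/
def correlation {d N : ℕ} (f : Config N d → ℝ) (m : ℕ) (x : Config m d) : ℝ :=
  ∑ π : Finpartition (Finset.univ : Finset (Fin m)),
    (-1 : ℝ) ^ (π.parts.card - 1) * (Nat.factorial (π.parts.card - 1) : ℝ) *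
      ∏ P ∈ π.parts, marginal f P.card fun i => x (P.orderEmbOfFin rfl i)

end ParticleChaos

end

open ParticleChaos

/-! Let F(ξ) be the mode ξ of the empirical measure minus that of ρ_t (`fluctuation`). Since the
drift keeps the self-interaction, the empirical measure solves the McKean–Vlasov equation up to
noise. The generator therefore acts on F(ξ) as damping at rate r(ξ) = 4π²σ|ξ|² plus a transport
term, a series over the modes κ of K whose terms are linear and quadratic in F
(`isObservable_fluctuation`). A product of modes receives, in addition, one Itô cross term for each
pair of factors, of size at most (r(ξ) + r(ξ'))/N (`IsObservable.mul`, `norm_noiseCoeff_le`).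
Expectations of products of F thus form a hierarchy.

Large diffusivity closes this hierarchy uniformly in time. Frequencies are integers, so |ξ_a| ≤
ξ_a², and the first-order transport term is dominated mode by mode by the second-order damping
(`norm_transportCoeff_le`, `IsDiffusive.tsum_transport_le`). Hence a bound M valid for all modes
improves itself to M/2 + S, where S measures the initial data and the sources, and iteration gives
2S (`norm_le_of_damped`).

The moments are bounded in the order 2, 4, 1, 3. The second and fourth absolute moments are O(1/N)
and O(1/N²); there the quadratic part of the transport is made linear by |F| ≤ 2. The signed first
and third moments are then O(1/N) and O(1/N²), a factor √N better than Hölder would give, because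
their equations involve only the even moments, each other, and the noise. At time zero the bounds
follow from independence: only multi-indices in which no particle is isolated contribute.

The quantity N E[F(ξ)F(ξ')] is compared with b̂(ξ,ξ') + ρ̂(ξ+ξ') - ρ̂(ξ)ρ̂(ξ'). The difference,
`covarianceDefect`, vanishes at time zero and solves a damped linear system whose sources are N
times a third moment and a noise term carrying a first moment, both O(1/N) relative to the damping.
So it is O(1/N) (`IsDiffusive.norm_covarianceDefect_le`).

Finally, exchangeability turns expectations of products of empirical modes into Fourier coefficients
of marginals, up to diagonal terms of relative size 1/N. It is not assumed, but follows from the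
same damping principle with S = 0 (`IsDiffusive.isExchangeable`). Adding the errors gives the
constant 18. -/

noncomputable section

namespace ParticleChaos

/-! ### Characters of the torus and the Fourier series of the kernel -/

section

variable {m d : ℕ}

/-- The character `x ↦ exp (-2πi ∑ₖ ζₖ · xₖ)` of `(𝕋^d)^m`. -/
def character (ζ : Fin m → Fin d → ℤ) : C(Config m d, ℂ) where
  toFun x := ∏ k, UnitAddTorus.mFourier (-(ζ k)) (x k)
  continuous_toFun := by fun_prop

theorem character_apply (ζ : Fin m → Fin d → ℤ) (x : Config m d) :
    character ζ x = ∏ k, UnitAddTorus.mFourier (-(ζ k)) (x k) := rfl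

theorem character_add (ζ ζ' : Fin m → Fin d → ℤ) :
    character (ζ + ζ') = character ζ * character ζ' := by
  ext x
  simp only [character_apply, ContinuousMap.mul_apply, ← Finset.prod_mul_distrib, Pi.add_apply,
    neg_add, UnitAddTorus.mFourier_add]

theorem character_zero : character (0 : Fin m → Fin d → ℤ) = 1 := by
  ext x
  simp [character_apply, UnitAddTorus.mFourier_zero]

theorem norm_mFourier_apply {ι : Type*} [Fintype ι] (n : ι → ℤ) (x : UnitAddTorus ι) :
    ‖UnitAddTorus.mFourier n x‖ = 1 := by
  simp only [UnitAddTorus.mFourier, ContinuousMap.coe_mk, norm_prod, fourier_apply, Circle.norm_coe,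
    Finset.prod_const_one]

theorem norm_character_apply (ζ : Fin m → Fin d → ℤ) (x : Config m d) : ‖character ζ x‖ = 1 := by
  simp [character_apply, norm_mFourier_apply]

theorem norm_character_le (ζ : Fin m → Fin d → ℤ) : ‖character ζ‖ ≤ 1 :=
  (ContinuousMap.norm_le _ zero_le_one).2 fun x => (norm_character_apply ζ x).le

theorem fourierCoefficient_eq (h : Config m d → ℝ) (ξ : Fin m → Fin d → ℤ) :
    fourierCoefficient h ξ = ∫ x, character ξ x * (h x : ℂ) := rfl

theorem mFourier_single_add {a : Fin d} (n : Fin d → ℤ) (x : UnitAddTorus (Fin d)) (s : ℝ) :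
    UnitAddTorus.mFourier n (x + Pi.single a (s : UnitAddCircle))
      = Complex.exp (2 * Real.pi * Complex.I * n a * s) * UnitAddTorus.mFourier n x := by
  simp only [UnitAddTorus.mFourier, ContinuousMap.coe_mk, Pi.add_apply]
  rw [← Finset.mul_prod_erase _ _ (Finset.mem_univ a), ← Finset.mul_prod_erase _ _ (Finset.mem_univ a),
    ← mul_assoc]
  congr 1
  · rw [Pi.single_eq_same, fourier_apply, zsmul_add, AddCircle.toCircle_add, Circle.coe_mul,
      ← fourier_apply, ← fourier_apply, fourier_coe_apply, mul_comm]
    simp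
  · refine Finset.prod_congr rfl fun i hi => ?_
    rw [Pi.single_eq_of_ne (Finset.ne_of_mem_erase hi), add_zero]

theorem character_single_add (ζ : Fin m → Fin d → ℤ) (k : Fin m) (a : Fin d) (x : Config m d)
    (s : ℝ) :
    character ζ (x + Pi.single k (Pi.single a (s : UnitAddCircle)))
      = Complex.exp (-(2 * Real.pi * Complex.I * ζ k a) * s) * character ζ x := by
  simp only [character_apply]
  rw [← Finset.mul_prod_erase _ _ (Finset.mem_univ k), ← Finset.mul_prod_erase _ _ (Finset.mem_univ k),
    ← mul_assoc]
  congr 1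
  · rw [Pi.add_apply, Pi.single_eq_same, mFourier_single_add]
    simp
  · refine Finset.prod_congr rfl fun i hi => ?_
    rw [Pi.add_apply, Pi.single_eq_of_ne (Finset.ne_of_mem_erase hi), add_zero]

theorem partialDeriv_const_mul_character (c : ℂ) (ζ : Fin m → Fin d → ℤ) (k : Fin m) (a : Fin d) :
    partialDeriv k a (fun x => c * character ζ x)
      = fun x => (c * -(2 * Real.pi * Complex.I * ζ k a)) * character ζ x := by
  ext x
  simp only [partialDeriv, character_single_add]
  have h : HasDerivAt (fun s : ℝ => Complex.exp (-(2 * Real.pi * Complex.I * ζ k a) * (s : ℂ)))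
      (Complex.exp (-(2 * Real.pi * Complex.I * ζ k a) * ((0 : ℝ) : ℂ)) *
        (-(2 * Real.pi * Complex.I * ζ k a) * 1)) 0 :=
    ((Complex.ofRealCLM.hasDerivAt (x := (0 : ℝ))).const_mul
      (-(2 * Real.pi * Complex.I * ζ k a))).cexp
  have h2 := ((h.mul_const (character ζ x)).const_mul c).deriv
  rw [h2]
  simp
  ring

theorem partialDeriv_character (ζ : Fin m → Fin d → ℤ) (k : Fin m) (a : Fin d) :
    partialDeriv k a (character ζ)
      = fun x => -(2 * Real.pi * Complex.I * ζ k a) * character ζ x := by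
  have := partialDeriv_const_mul_character 1 ζ k a
  simpa using this

/-- The square of the Euclidean norm of a frequency. -/
def freqSq (ξ : Fin d → ℤ) : ℝ := ∑ a, (ξ a : ℝ) ^ 2

theorem freqSq_nonneg (ξ : Fin d → ℤ) : 0 ≤ freqSq ξ := Finset.sum_nonneg fun _ _ => sq_nonneg _

theorem laplacian_character (ζ : Fin m → Fin d → ℤ) (x : Config m d) :
    laplacian (character ζ) x = -((4 * Real.pi ^ 2 * ∑ k, freqSq (ζ k) : ℝ) : ℂ) * character ζ x := by
  simp only [laplacian, partialDeriv_character, partialDeriv_const_mul_character, freqSq,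
    ← Finset.sum_mul]
  congr 1
  push_cast
  rw [Finset.mul_sum, ← Finset.sum_neg_distrib]
  refine Finset.sum_congr rfl fun k _ => ?_
  rw [Finset.mul_sum, ← Finset.sum_neg_distrib]
  refine Finset.sum_congr rfl fun a _ => ?_
  ring_nf
  simp

theorem isTestFunction_character (ζ : Fin m → Fin d → ℤ) : IsTestFunction (character ζ) := by
  unfold IsTestFunction
  simp only [character_apply, UnitAddTorus.mFourier, ContinuousMap.coe_mk, fourier_coe_apply]
  refine contDiff_prod fun k _ => contDiff_prod fun a _ => ContDiff.cexp ?_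
  refine ContDiff.div_const (contDiff_const.mul ?_) _
  exact Complex.ofRealCLM.contDiff.comp (contDiff_apply_apply ℝ ℝ k a)

theorem volume_unitAddCircle : (volume : Measure UnitAddCircle) = AddCircle.haarAddCircle := by
  rw [AddCircle.volume_eq_smul_haarAddCircle]; simp

instance : IsProbabilityMeasure (volume : Measure UnitAddCircle) := by
  rw [volume_unitAddCircle]; infer_instance

/-- Fourier inversion for a continuous function with summable coefficients, with the coefficients
written as integrals against `volume` to match `fourierCoefficient`. -/
theorem hasSum_mFourier_of_summable {ι : Type*} [Fintype ι] {g : C(UnitAddTorus ι, ℂ)}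
    (h : Summable fun n : ι → ℤ => ∫ x, UnitAddTorus.mFourier (-n) x * g x)
    (x : UnitAddTorus ι) :
    HasSum (fun n : ι → ℤ => (∫ x, UnitAddTorus.mFourier (-n) x * g x) * UnitAddTorus.mFourier n x)
      (g x) := by
  have e : ∀ n : ι → ℤ, UnitAddTorus.mFourierCoeff g n
      = ∫ x, UnitAddTorus.mFourier (-n) x * g x := by
    intro n
    simp only [UnitAddTorus.mFourierCoeff, volume_pi, volume_unitAddCircle, smul_eq_mul]
    rfl
  have := UnitAddTorus.hasSum_mFourier_series_apply_of_summable (f := g) (by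
    rw [show UnitAddTorus.mFourierCoeff g = _ from funext e]; exact h) x
  simpa only [e, smul_eq_mul] using this


/-- Splitting the variables of a torus over a disjoint union. -/
theorem kernelSplit_measurePreserving : MeasurePreserving
    (fun z : UnitAddTorus (Fin d ⊕ Fin d) =>
      (![fun a => z (Sum.inl a), fun a => z (Sum.inr a)] : Config 2 d)) := by
  have h1 := volume_measurePreserving_sumPiEquivProdPi (fun _ : Fin d ⊕ Fin d => UnitAddCircle)
  have h2 := (volume_preserving_finTwoArrow (UnitAddTorus (Fin d))).symm
  exact h2.comp h1

/-- Inversion holds on a single torus, so the pair of tori is identified with the torus over `Fin d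
⊕ Fin d`. Continuity of K makes the expansion hold at every point and not just almost everywhere. -/
theorem hasSum_kernel {K : UnitAddTorus (Fin d) → UnitAddTorus (Fin d) → EuclideanSpace ℝ (Fin d)}
    (hK : Continuous (Function.uncurry K))
    (hs : Summable (fun ξ : Fin 2 → Fin d → ℤ => ‖kernelCoefficient K ξ‖))
    (a : Fin d) (x y : UnitAddTorus (Fin d)) :
    HasSum (fun κ : Fin 2 → Fin d → ℤ => kernelCoefficient K κ a *
      (UnitAddTorus.mFourier (κ 0) x * UnitAddTorus.mFourier (κ 1) y)) (K x y a : ℂ) := by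
  let e : (Fin 2 → Fin d → ℤ) ≃ (Fin d ⊕ Fin d → ℤ) :=
    (finTwoArrowEquiv (Fin d → ℤ)).trans (Equiv.sumArrowEquivProdArrow _ _ _).symm
  let g : C(UnitAddTorus (Fin d ⊕ Fin d), ℂ) :=
    ⟨fun z => (K (fun a => z (Sum.inl a)) (fun a => z (Sum.inr a)) a : ℂ), by
      refine Complex.continuous_ofReal.comp ?_
      have h1 : Continuous fun z : UnitAddTorus (Fin d ⊕ Fin d) =>
        Function.uncurry K ((fun a => z (Sum.inl a)), (fun a => z (Sum.inr a))) :=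
        hK.comp (by fun_prop)
      exact (EuclideanSpace.proj a : EuclideanSpace ℝ (Fin d) →L[ℝ] ℝ).continuous.comp h1⟩
  have hmF : ∀ (κ : Fin 2 → Fin d → ℤ) (z : UnitAddTorus (Fin d ⊕ Fin d)),
      UnitAddTorus.mFourier (e κ) z = UnitAddTorus.mFourier (κ 0) (fun a => z (Sum.inl a)) *
        UnitAddTorus.mFourier (κ 1) (fun a => z (Sum.inr a)) := by
    intro κ z
    simp only [UnitAddTorus.mFourier, ContinuousMap.coe_mk, Fintype.prod_sum_type]
    rfl
  have hc : ∀ κ : Fin 2 → Fin d → ℤ,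
      ∫ z, UnitAddTorus.mFourier (-(e κ)) z * g z = kernelCoefficient K κ a := by
    intro κ
    have hmeas : MeasurableEmbedding (fun z : UnitAddTorus (Fin d ⊕ Fin d) =>
      (![fun a => z (Sum.inl a), fun a => z (Sum.inr a)] : Config 2 d)) :=
      ((MeasurableEquiv.sumPiEquivProdPi (fun _ : Fin d ⊕ Fin d => UnitAddCircle)).trans
        (MeasurableEquiv.finTwoArrow).symm).measurableEmbedding
    have h1 := kernelSplit_measurePreserving.integral_comp hmeas
      (fun x : Config 2 d => character κ x * (K (x 0) (x 1) a : ℂ))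
    simp only [kernelCoefficient, fourierCoefficient_eq]
    rw [← h1]
    refine integral_congr_ae (Filter.Eventually.of_forall fun z => ?_)
    have : -(e κ) = e (-κ) := by
      funext i; cases i <;> rfl
    simp only [this, hmF, character_apply, Fin.prod_univ_two]
    rfl
  have hsum : Summable fun n : Fin d ⊕ Fin d → ℤ => ∫ z, UnitAddTorus.mFourier (-n) z * g z := by
    rw [← e.summable_iff]
    refine Summable.of_norm_bounded hs fun κ => ?_
    rw [Function.comp_apply, hc]
    exact PiLp.norm_apply_le _ a
  have h := hasSum_mFourier_of_summable hsum (Sum.elim x y)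
  rw [← e.hasSum_iff] at h
  have h3 : g (Sum.elim x y) = (K x y a : ℂ) := rfl
  rw [h3] at h
  refine h.congr_fun fun κ => ?_
  rw [Function.comp_apply, hc, hmF]
  rfl

end

/-! ### Differentiable time evolutions and the damping principle -/

section

variable {m d : ℕ}

/-- `u` is differentiable on `[0, ∞)` with derivative `v`. -/
def Evolves (u v : ℝ → ℂ) : Prop := ∀ t, 0 ≤ t → HasDerivWithinAt u (v t) (Set.Ici 0) t

theorem Evolves.continuousOn {u v : ℝ → ℂ} (h : Evolves u v) : ContinuousOn u (Set.Ici 0) :=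
  fun t ht => (h t ht).continuousWithinAt

theorem Evolves.add {u v u' v' : ℝ → ℂ} (h : Evolves u v) (h' : Evolves u' v') :
    Evolves (fun t => u t + u' t) (fun t => v t + v' t) := fun t ht => (h t ht).add (h' t ht)

theorem Evolves.sub {u v u' v' : ℝ → ℂ} (h : Evolves u v) (h' : Evolves u' v') :
    Evolves (fun t => u t - u' t) (fun t => v t - v' t) := fun t ht => (h t ht).sub (h' t ht)

theorem Evolves.mul {u v u' v' : ℝ → ℂ} (h : Evolves u v) (h' : Evolves u' v') :
    Evolves (fun t => u t * u' t) (fun t => v t * u' t + u t * v' t) :=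
  fun t ht => (h t ht).mul (h' t ht)

theorem Evolves.neg {u v : ℝ → ℂ} (h : Evolves u v) :
    Evolves (fun t => -u t) (fun t => -v t) := fun t ht => (h t ht).neg

theorem evolves_const (c : ℂ) : Evolves (fun _ => c) (fun _ => 0) :=
  fun t _ => hasDerivWithinAt_const t _ c

theorem Evolves.congr {u v u' v' : ℝ → ℂ} (h : Evolves u v) (hu : ∀ t, 0 ≤ t → u' t = u t)
    (hv : ∀ t, 0 ≤ t → v' t = v t) : Evolves u' v' := by
  intro t ht
  rw [hv t ht]
  exact (h t ht).congr (fun s hs => hu s hs) (hu t ht)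

/-- The fundamental theorem of calculus. As v is controlled only on [0, ∞), it is replaced by s ↦ v
(max 0 s), which is continuous on the whole line. -/
theorem evolves_of_eq_integral {u v : ℝ → ℂ} {c : ℂ}
    (h : ∀ t, 0 ≤ t → u t = c + ∫ s in (0 : ℝ)..t, v s) (hv : ContinuousOn v (Set.Ici 0)) :
    Evolves u v := by
  have hc : Continuous fun s : ℝ => v (max 0 s) := by
    refine continuousOn_univ.1 (hv.comp (f := fun s : ℝ => max 0 s) (by fun_prop) fun s _ => ?_)
    exact le_max_left (0 : ℝ) s
  have e : ∀ t, 0 ≤ t → u t = c + ∫ s in (0 : ℝ)..t, v (max 0 s) := by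
    intro t ht
    rw [h t ht]
    congr 1
    refine intervalIntegral.integral_congr fun s hs => ?_
    rw [Set.uIcc_of_le ht] at hs
    simp [max_eq_right hs.1]
  intro t ht
  have := ((hc.integral_hasStrictDerivAt 0 t).hasDerivAt.const_add c).hasDerivWithinAt (s := Set.Ici 0)
  rw [max_eq_right ht] at this
  exact this.congr (fun s hs => e s hs) (e t ht)

/-- First half of a bootstrap: a primitive of an integrable function is continuous. For Fourier
coefficients this makes the right-hand side of the equation continuous, after which
`evolves_of_eq_integral` gives differentiability. -/
theorem continuousOn_of_eq_integral {u v : ℝ → ℂ} {c : ℂ}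
    (hi : ∀ t, 0 ≤ t → IntervalIntegrable v volume 0 t)
    (h : ∀ t, 0 ≤ t → u t = c + ∫ s in (0 : ℝ)..t, v s) : ContinuousOn u (Set.Ici 0) := by
  intro t ht
  have h1 : ContinuousOn (fun s => c + ∫ r in (0 : ℝ)..s, v r) (Set.Icc 0 (t + 1)) := by
    have ht' : (0 : ℝ) ≤ t + 1 := by linarith [Set.mem_Ici.1 ht]
    have := intervalIntegral.continuousOn_primitive_interval' (hi (t + 1) ht') (Set.left_mem_uIcc)
    rw [Set.uIcc_of_le ht'] at this
    exact continuousOn_const.add this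
  have h2 : ContinuousWithinAt u (Set.Icc 0 (t + 1)) t :=
    (h1 t ⟨ht, by linarith⟩).congr (fun s hs => h s hs.1) (h t ht)
  refine h2.mono_of_mem_nhdsWithin ?_
  rw [mem_nhdsWithin]
  exact ⟨Set.Iio (t + 1), isOpen_Iio, by simp, fun s hs => ⟨hs.2, le_of_lt hs.1⟩⟩

/-- The integrating factor: the derivative of exp(at) u(t) has norm at most a exp(at) B, which is
the derivative of exp(at) B. The rate a may vanish, as it does for the zero mode. -/
theorem norm_le_of_damped_single {u v : ℝ → ℂ} {a B T : ℝ} (he : Evolves u v) (h0 : ‖u 0‖ ≤ B)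
    (hv : ∀ t, 0 ≤ t → t ≤ T → ‖v t + a * u t‖ ≤ a * B) {t : ℝ} (ht : 0 ≤ t) (htT : t ≤ T) :
    ‖u t‖ ≤ B := by
  have hexp : ∀ s : ℝ, HasDerivAt (fun s : ℝ => Real.exp (a * s)) (Real.exp (a * s) * a) s :=
    fun s => by simpa using ((hasDerivAt_id s).const_mul a).exp
  have hexpC : ∀ s : ℝ, HasDerivAt (fun s : ℝ => (Real.exp (a * s) : ℂ))
      ((Real.exp (a * s) * a : ℝ) : ℂ) s := fun s => (hexp s).ofReal_comp
  have hd : ∀ s, 0 ≤ s → HasDerivWithinAt (fun s : ℝ => (Real.exp (a * s) : ℂ) * u s)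
      (((Real.exp (a * s) * a : ℝ) : ℂ) * u s + (Real.exp (a * s) : ℂ) * v s) (Set.Ici 0) s :=
    fun s hs => (hexpC s).hasDerivWithinAt.mul (he s hs)
  have key := image_norm_le_of_norm_deriv_right_le_deriv_boundary (a := 0) (b := T)
    (f := fun s : ℝ => (Real.exp (a * s) : ℂ) * u s)
    (f' := fun s => ((Real.exp (a * s) * a : ℝ) : ℂ) * u s + (Real.exp (a * s) : ℂ) * v s)
    (B := fun s => Real.exp (a * s) * B) (B' := fun s => Real.exp (a * s) * a * B)
    (fun s hs => ((hd s hs.1).mono Set.Icc_subset_Ici_self).continuousWithinAt)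
    (fun s hs => (hd s hs.1).mono (Set.Ici_subset_Ici.2 hs.1))
    (by simpa using h0) (fun s => (hexp s).mul_const B)
    (fun s hs => by
      have e : ((Real.exp (a * s) * a : ℝ) : ℂ) * u s + (Real.exp (a * s) : ℂ) * v s
          = (Real.exp (a * s) : ℂ) * (v s + a * u s) := by push_cast; ring
      rw [e, norm_mul, Complex.norm_real, Real.norm_of_nonneg (Real.exp_pos _).le, mul_assoc]
      exact mul_le_mul_of_nonneg_left (hv s hs.1 hs.2.le) (Real.exp_pos _).le) ⟨ht, htT⟩
  rw [norm_mul, Complex.norm_real, Real.norm_of_nonneg (Real.exp_pos _).le] at key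
  exact le_of_mul_le_mul_left key (Real.exp_pos _)

/-- The engine of all the uniform estimates. On [0, t] the map M ↦ M/2 + S sends a bound for all
indices to another one, and its fixed point is 2S. The crude local bound `hb` only starts the
iteration, so the result depends neither on it nor on t. Both the infinite index set and the
unbounded rates are harmless, because the coupling is measured relative to each rate. -/
theorem norm_le_of_damped {ι : Type*} {u v : ι → ℝ → ℂ} {a : ι → ℝ} {S : ℝ} (hS : 0 ≤ S)
    (he : ∀ i, Evolves (u i) (v i))
    (hb : ∀ T, ∃ M, ∀ i t, 0 ≤ t → t ≤ T → ‖u i t‖ ≤ M) (h0 : ∀ i, ‖u i 0‖ ≤ S)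
    (hv : ∀ M t, 0 ≤ M → 0 ≤ t → (∀ i, ‖u i t‖ ≤ M) →
      ∀ i, ‖v i t + a i * u i t‖ ≤ a i * (M / 2 + S)) (i : ι) {t : ℝ} (ht : 0 ≤ t) :
    ‖u i t‖ ≤ 2 * S := by
  obtain ⟨M₀, hM₀⟩ := hb t
  have hstep : ∀ M, 0 ≤ M → (∀ i s, 0 ≤ s → s ≤ t → ‖u i s‖ ≤ M) →
      ∀ i s, 0 ≤ s → s ≤ t → ‖u i s‖ ≤ M / 2 + S := by
    intro M hM h i s hs hst
    refine norm_le_of_damped_single (he i) ((h0 i).trans (by linarith)) (T := t) (a := a i)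
      (fun r hr hrt => hv M r hM hr (fun j => h j r hr hrt) i) hs hst
  -- The distance to the fixed point 2S is halved at each application of `hstep`.
  have hiter : ∀ n : ℕ, ∀ i s, 0 ≤ s → s ≤ t → ‖u i s‖ ≤ |M₀| / 2 ^ n + 2 * S := by
    intro n
    induction n with
    | zero =>
      intro i s hs hst
      have := hM₀ i s hs hst
      have := le_abs_self M₀
      simp; linarith
    | succ n ih =>
      intro i s hs hst
      refine (hstep _ (by positivity) ih i s hs hst).trans (le_of_eq ?_)
      rw [pow_succ]; field_simp; ring
  have hlim : Filter.Tendsto (fun n : ℕ => |M₀| / 2 ^ n + 2 * S) Filter.atTop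
      (nhds (0 + 2 * S)) := by
    refine Filter.Tendsto.add_const _ ?_
    have := (tendsto_pow_atTop_nhds_zero_of_lt_one (r := (1 / 2 : ℝ)) (by norm_num)
      (by norm_num)).const_mul |M₀|
    simpa [div_eq_mul_inv] using this
  rw [zero_add] at hlim
  exact ge_of_tendsto' hlim fun n => hiter n i t ht le_rfl

end

/-! ### From weak solutions to differential equations for Fourier coefficients -/

section

variable {m d : ℕ}

/-- The Fourier multiplier `-2πi ξ · K̂(κ)` of the transport by the mode `κ` of the kernel. -/
def transportCoeff (K : UnitAddTorus (Fin d) → UnitAddTorus (Fin d) → EuclideanSpace ℝ (Fin d))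
    (ξ : Fin d → ℤ) (κ : Fin 2 → Fin d → ℤ) : ℂ :=
  ∑ a, -(2 * Real.pi * Complex.I * ξ a) * kernelCoefficient K κ a

theorem transportCoeff_add
    (K : UnitAddTorus (Fin d) → UnitAddTorus (Fin d) → EuclideanSpace ℝ (Fin d))
    (ξ ξ' : Fin d → ℤ) (κ : Fin 2 → Fin d → ℤ) :
    transportCoeff K (ξ + ξ') κ = transportCoeff K ξ κ + transportCoeff K ξ' κ := by
  simp only [transportCoeff, ← Finset.sum_add_distrib, Pi.add_apply]
  refine Finset.sum_congr rfl fun a _ => ?_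
  push_cast; ring

/-- The integer ξ_a satisfies |ξ_a| ≤ ξ_a², including when it is zero. Thus a first-order multiplier
is bounded by |ξ|², the symbol of the Laplacian, and can be absorbed by the diffusion at every
frequency, with no mode left over at zero. -/
theorem norm_transportCoeff_le
    (K : UnitAddTorus (Fin d) → UnitAddTorus (Fin d) → EuclideanSpace ℝ (Fin d))
    (ξ : Fin d → ℤ) (κ : Fin 2 → Fin d → ℤ) :
    ‖transportCoeff K ξ κ‖ ≤ 2 * Real.pi * freqSq ξ * ‖kernelCoefficient K κ‖ := by
  unfold transportCoeff freqSq
  refine (norm_sum_le _ _).trans ?_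
  rw [Finset.mul_sum, Finset.sum_mul]
  refine Finset.sum_le_sum fun a _ => ?_
  rw [norm_mul, norm_neg]
  refine mul_le_mul ?_ (PiLp.norm_apply_le _ a) (norm_nonneg _) (by positivity)
  simp only [norm_mul, Complex.norm_ofNat, Complex.norm_real, Complex.norm_I, mul_one,
    Real.norm_of_nonneg Real.pi_pos.le, Complex.norm_intCast]
  refine mul_le_mul_of_nonneg_left ?_ (by positivity)
  rw [← sq_abs]
  have h : (|ξ a| : ℤ) ≤ |ξ a| ^ 2 := by
    rcases (abs_nonneg (ξ a)).eq_or_lt with h | h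
    · rw [← h]; norm_num
    · nlinarith
  exact_mod_cast h

/-- Exchange of sum and integral, legitimate because the integrals of the norms are at most ‖c i‖
∫‖h‖. It inserts the Fourier series of the kernel into any flux. -/
theorem hasSum_integral_mul {Y ι : Type*} [MeasureSpace Y] [Countable ι] {h : Y → ℂ}
    (hh : Integrable h) {c : ι → ℂ} (hc : Summable fun i => ‖c i‖) {g : ι → Y → ℂ} {G : Y → ℂ}
    (hg : ∀ i, AEStronglyMeasurable (g i)) (hg1 : ∀ i y, ‖g i y‖ ≤ 1)
    (hG : ∀ y, HasSum (fun i => c i * g i y) (G y)) :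
    HasSum (fun i => c i * ∫ y, h y * g i y) (∫ y, h y * G y) := by
  have hint : ∀ i, Integrable fun y => h y * (c i * g i y) := fun i =>
    hh.mul_bdd (c := ‖c i‖) ((hg i).const_mul (c i)) (Filter.Eventually.of_forall fun y => by
      rw [norm_mul]; exact mul_le_of_le_one_right (norm_nonneg _) (hg1 i y))
  have hb : ∀ i, ∫ y, ‖h y * (c i * g i y)‖ ≤ ‖c i‖ * ∫ y, ‖h y‖ := by
    intro i
    rw [← integral_const_mul]
    refine integral_mono (hint i).norm (hh.norm.const_mul _) fun y => ?_
    simp only [norm_mul]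
    calc ‖h y‖ * (‖c i‖ * ‖g i y‖) ≤ ‖h y‖ * (‖c i‖ * 1) := by gcongr; exact hg1 i y
      _ = ‖c i‖ * ‖h y‖ := by ring
  have key := hasSum_integral_of_summable_integral_norm hint
    (Summable.of_nonneg_of_le (fun i => integral_nonneg fun y => norm_nonneg _) hb
      (hc.mul_right _))
  have e1 : ∀ i, ∫ y, h y * (c i * g i y) = c i * ∫ y, h y * g i y := by
    intro i
    rw [← integral_const_mul]
    exact integral_congr_ae (Filter.Eventually.of_forall fun y => by simp only; ring)
  have e2 : ∀ y, ∑' i, h y * (c i * g i y) = h y * G y := fun y => ((hG y).mul_left (h y)).tsum_eq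
  simpa only [e1, e2] using key

theorem integrable_mul_character {u : Config m d → ℝ} (hu : Integrable u) (ζ : Fin m → Fin d → ℤ) :
    Integrable fun x => character ζ x * (u x : ℂ) :=
  hu.ofReal.bdd_mul (character ζ).continuous.aestronglyMeasurable
    (Filter.Eventually.of_forall fun x => (norm_character_apply ζ x).le)

theorem norm_fourierCoefficient_le {u : Config m d → ℝ} (ζ : Fin m → Fin d → ℤ) :
    ‖fourierCoefficient u ζ‖ ≤ ∫ x, |u x| := by
  rw [fourierCoefficient_eq]
  refine (norm_integral_le_integral_norm _).trans (le_of_eq ?_)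
  refine integral_congr_ae (Filter.Eventually.of_forall fun x => ?_)
  simp [norm_character_apply]

theorem weakRHS_character {σ : ℝ} {u : Config m d → ℝ}
    {J : Fin m → Config m d → EuclideanSpace ℝ (Fin d)} (hu : Integrable u)
    (hJ : ∀ k a, Integrable fun x => J k x a) (ζ : Fin m → Fin d → ℤ) :
    weakRHS σ u J (character ζ)
      = -((4 * Real.pi ^ 2 * σ * ∑ k, freqSq (ζ k) : ℝ) : ℂ) * fourierCoefficient u ζ
        + ∑ k, ∑ a, -(2 * Real.pi * Complex.I * ζ k a) *
          fourierCoefficient (fun x => J k x a) ζ := by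
  have e : ∀ x, ((σ * u x : ℝ) : ℂ) * laplacian (character ζ) x
        + ∑ k, ∑ a, (J k x a : ℂ) * partialDeriv k a (character ζ) x
      = -((4 * Real.pi ^ 2 * σ * ∑ k, freqSq (ζ k) : ℝ) : ℂ) * (character ζ x * (u x : ℂ))
        + ∑ k, ∑ a, -(2 * Real.pi * Complex.I * ζ k a) * (character ζ x * (J k x a : ℂ)) := by
    intro x
    simp only [laplacian_character, partialDeriv_character]
    congr 1
    · push_cast; ring
    · exact Finset.sum_congr rfl fun k _ => Finset.sum_congr rfl fun a _ => by ring
  have hi : ∀ k a, Integrable fun x =>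
      -(2 * Real.pi * Complex.I * ζ k a) * (character ζ x * (J k x a : ℂ)) := fun k a =>
    (integrable_mul_character (hJ k a) ζ).const_mul _
  simp only [weakRHS, e]
  rw [integral_add ((integrable_mul_character hu ζ).const_mul _)
    (integrable_finsetSum _ fun k _ => integrable_finsetSum _ fun a _ => hi k a),
    integral_const_mul, integral_finsetSum _ fun k _ => integrable_finsetSum _ fun a _ => hi k a]
  congr 1
  refine Finset.sum_congr rfl fun k _ => ?_
  rw [integral_finsetSum _ fun a _ => hi k a]
  simp only [integral_const_mul, fourierCoefficient_eq]

theorem continuousOn_fourierCoefficient {σ : ℝ} {u₀ : Config m d → ℝ} {u : ℝ → Config m d → ℝ}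
    {J : ℝ → Fin m → Config m d → EuclideanSpace ℝ (Fin d)} (hw : IsWeakSolution σ u₀ u J)
    (ζ : Fin m → Fin d → ℤ) :
    ContinuousOn (fun t => fourierCoefficient (u t) ζ) (Set.Ici 0) := by
  refine continuousOn_of_eq_integral (fun t ht => (hw _ (isTestFunction_character ζ) t ht).1)
    (c := fourierCoefficient u₀ ζ) fun t ht => ?_
  simpa only [fourierCoefficient_eq, mul_comm] using (hw _ (isTestFunction_character ζ) t ht).2

theorem fourierCoefficient_zero_time {σ : ℝ} {u₀ : Config m d → ℝ} {u : ℝ → Config m d → ℝ}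
    {J : ℝ → Fin m → Config m d → EuclideanSpace ℝ (Fin d)} (hw : IsWeakSolution σ u₀ u J)
    (ζ : Fin m → Fin d → ℤ) : fourierCoefficient (u 0) ζ = fourierCoefficient u₀ ζ := by
  have := (hw _ (isTestFunction_character ζ) 0 le_rfl).2
  simpa only [fourierCoefficient_eq, mul_comm, intervalIntegral.integral_same, add_zero] using this

/-- Weierstrass' test on each compact interval of time. -/
theorem continuousOn_tsum_of_locally_bounded {ι : Type*} {c : ι → ℂ} (hc : Summable fun i => ‖c i‖)
    {X : ι → ℝ → ℂ} (hX : ∀ i, ContinuousOn (X i) (Set.Ici 0))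
    (hb : ∀ T, ∃ M, ∀ i t, 0 ≤ t → t ≤ T → ‖X i t‖ ≤ M) :
    ContinuousOn (fun t => ∑' i, c i * X i t) (Set.Ici 0) := by
  intro t ht
  obtain ⟨M, hM⟩ := hb (t + 1)
  have h1 : ContinuousOn (fun t => ∑' i, c i * X i t) (Set.Icc 0 (t + 1)) := by
    refine continuousOn_tsum (u := fun i => ‖c i‖ * M)
      (fun i => continuousOn_const.mul ((hX i).mono Set.Icc_subset_Ici_self))
      (hc.mul_right M) fun i s hs => ?_
    rw [norm_mul]
    exact mul_le_mul_of_nonneg_left (hM i s hs.1 hs.2) (norm_nonneg _)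
  refine (h1 t ⟨ht, by linarith⟩).mono_of_mem_nhdsWithin ?_
  rw [mem_nhdsWithin]
  exact ⟨Set.Iio (t + 1), isOpen_Iio, by simp, fun s hs => ⟨hs.2, le_of_lt hs.1⟩⟩

theorem summable_transportCoeff
    {K : UnitAddTorus (Fin d) → UnitAddTorus (Fin d) → EuclideanSpace ℝ (Fin d)}
    (hs : Summable (fun ξ : Fin 2 → Fin d → ℤ => ‖kernelCoefficient K ξ‖)) (ξ : Fin d → ℤ) :
    Summable fun κ => ‖transportCoeff K ξ κ‖ :=
  Summable.of_nonneg_of_le (fun _ => norm_nonneg _) (norm_transportCoeff_le K ξ) (hs.mul_left _)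

/-- Common source of the three mode equations (McKean–Vlasov, Liouville, Bogolyubov). `X k κ` is
what remains of the flux in the k-th variable once the mode κ of the kernel is factored out. Testing
with a character gives an integral identity, and continuity and local boundedness of X make its
integrand continuous. -/
theorem evolves_of_isWeakSolution
    {K : UnitAddTorus (Fin d) → UnitAddTorus (Fin d) → EuclideanSpace ℝ (Fin d)}
    (hs : Summable (fun ξ : Fin 2 → Fin d → ℤ => ‖kernelCoefficient K ξ‖))
    {σ : ℝ} {u₀ : Config m d → ℝ} {u : ℝ → Config m d → ℝ}
    {J : ℝ → Fin m → Config m d → EuclideanSpace ℝ (Fin d)} (hw : IsWeakSolution σ u₀ u J)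
    (hu : ∀ t, 0 ≤ t → Integrable (u t))
    (hJ : ∀ t, 0 ≤ t → ∀ k a, Integrable fun x => J t k x a) (ζ : Fin m → Fin d → ℤ)
    (X : Fin m → (Fin 2 → Fin d → ℤ) → ℝ → ℂ)
    (hX : ∀ t, 0 ≤ t → ∀ k a, HasSum (fun κ => kernelCoefficient K κ a * X k κ t)
      (fourierCoefficient (fun x => J t k x a) ζ))
    (hXc : ∀ k κ, ContinuousOn (X k κ) (Set.Ici 0))
    (hXb : ∀ T, ∃ M, ∀ k κ t, 0 ≤ t → t ≤ T → ‖X k κ t‖ ≤ M) :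
    Evolves (fun t => fourierCoefficient (u t) ζ) fun t =>
      -((4 * Real.pi ^ 2 * σ * ∑ k, freqSq (ζ k) : ℝ) : ℂ) * fourierCoefficient (u t) ζ
        + ∑ k, ∑' κ, transportCoeff K (ζ k) κ * X k κ t := by
  have hv : ∀ t, 0 ≤ t → weakRHS σ (u t) (J t) (character ζ)
      = -((4 * Real.pi ^ 2 * σ * ∑ k, freqSq (ζ k) : ℝ) : ℂ) * fourierCoefficient (u t) ζ
        + ∑ k, ∑' κ, transportCoeff K (ζ k) κ * X k κ t := by
    intro t ht
    rw [weakRHS_character (hu t ht) (hJ t ht)]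
    congr 1
    refine Finset.sum_congr rfl fun k _ => ?_
    have h := hasSum_sum (s := Finset.univ) fun a _ =>
      (hX t ht k a).mul_left (-(2 * Real.pi * Complex.I * ζ k a))
    rw [← h.tsum_eq]
    refine tsum_congr fun κ => ?_
    simp only [transportCoeff, Finset.sum_mul, mul_assoc]
  refine evolves_of_eq_integral (c := fourierCoefficient u₀ ζ) (fun t ht => ?_) ?_
  · have h := (hw _ (isTestFunction_character ζ) t ht).2
    rw [intervalIntegral.integral_congr (g := fun s => -((4 * Real.pi ^ 2 * σ * ∑ k, freqSq (ζ k) :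
      ℝ) : ℂ) * fourierCoefficient (u s) ζ + ∑ k, ∑' κ, transportCoeff K (ζ k) κ * X k κ s)
      (fun s hs => by
        rw [Set.uIcc_of_le ht] at hs
        exact hv s hs.1)] at h
    simpa only [fourierCoefficient_eq, mul_comm] using h
  · refine (continuousOn_const.mul (continuousOn_fourierCoefficient hw ζ)).add ?_
    refine continuousOn_finsetSum _ fun k _ => ?_
    refine continuousOn_tsum_of_locally_bounded (summable_transportCoeff hs _) (hXc k) fun T => ?_
    obtain ⟨M, hM⟩ := hXb T
    exact ⟨M, hM k⟩

end

/-! ### Mode equations of the McKean–Vlasov and Liouville equations -/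

section

variable {m d : ℕ}

/-- The Fourier coefficients of a function of one particle. -/
def modes (ρ : UnitAddTorus (Fin d) → ℝ) (ξ : Fin d → ℤ) : ℂ :=
  ∫ x, UnitAddTorus.mFourier (-ξ) x * (ρ x : ℂ)

theorem fourierCoefficient_one (ρ : UnitAddTorus (Fin d) → ℝ) (ζ : Fin 1 → Fin d → ℤ) :
    fourierCoefficient (fun x : Config 1 d => ρ (x 0)) ζ = modes ρ (ζ 0) := by
  have h := (volume_preserving_funUnique (Fin 1) (UnitAddTorus (Fin d))).integral_comp'
    (fun x => UnitAddTorus.mFourier (-(ζ 0)) x * (ρ x : ℂ))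
  rw [modes, ← h, fourierCoefficient_eq]
  refine integral_congr_ae (Filter.Eventually.of_forall fun x => ?_)
  simp [character_apply]

theorem norm_modes_le {ρ : UnitAddTorus (Fin d) → ℝ} (h : IsProbDensity ρ) (ξ : Fin d → ℤ) :
    ‖modes ρ ξ‖ ≤ 1 := by
  refine (norm_integral_le_integral_norm _).trans (le_of_eq ?_)
  refine Eq.trans (integral_congr_ae ?_) h.integral_eq_one
  filter_upwards [h.nonneg] with x hx
  simp [norm_mFourier_apply, abs_of_nonneg hx]

theorem integrable_eval {ρ : UnitAddTorus (Fin d) → ℝ} (h : Integrable ρ) (k : Fin m) :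
    Integrable fun x : Config m d => ρ (x k) :=
  (measurePreserving_eval (fun _ : Fin m => (volume : Measure (UnitAddTorus (Fin d)))) k
    ).integrable_comp_of_integrable h

section Kernel

variable {K : UnitAddTorus (Fin d) → UnitAddTorus (Fin d) → EuclideanSpace ℝ (Fin d)}

theorem summable_norm_kernelCoefficient_apply
    (hs : Summable (fun ξ : Fin 2 → Fin d → ℤ => ‖kernelCoefficient K ξ‖)) (a : Fin d) :
    Summable fun κ => ‖kernelCoefficient K κ a‖ :=
  Summable.of_nonneg_of_le (fun _ => norm_nonneg _) (fun _ => PiLp.norm_apply_le _ a) hs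

theorem exists_kernel_bound (hK : Continuous (Function.uncurry K)) :
    ∃ C, ∀ x y, ‖K x y‖ ≤ C := by
  obtain ⟨C, hC⟩ := (isCompact_range hK).isBounded.exists_norm_le
  exact ⟨C, fun x y => hC _ ⟨(x, y), rfl⟩⟩

theorem integrable_smul_kernel (hK : Continuous (Function.uncurry K)) {Y : Type*} [MeasureSpace Y]
    {h : Y → ℝ} (hh : Integrable h) {p q : Y → UnitAddTorus (Fin d)} (hp : Measurable p)
    (hq : Measurable q) : Integrable fun y => h y • K (p y) (q y) := by
  obtain ⟨C, hC⟩ := exists_kernel_bound hK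
  refine hh.smul_bdd C ?_ ?_
  · exact (hK.measurable.comp (hp.prodMk hq)).aestronglyMeasurable
  · exact Filter.Eventually.of_forall fun y => hC _ _

theorem integrable_mul_kernel (hK : Continuous (Function.uncurry K)) {Y : Type*} [MeasureSpace Y]
    {h : Y → ℝ} (hh : Integrable h) {p q : Y → UnitAddTorus (Fin d)} (hp : Measurable p)
    (hq : Measurable q) (a : Fin d) : Integrable fun y => h y * K (p y) (q y) a :=
  (EuclideanSpace.proj a : EuclideanSpace ℝ (Fin d) →L[ℝ] ℝ).integrable_comp
    (integrable_smul_kernel hK hh hp hq)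

/-- Taking a component commutes with the integral only where the section of H is integrable, hence
almost everywhere by Fubini. -/
theorem ae_integral_smul_kernel_apply (hK : Continuous (Function.uncurry K))
    {H : Config m d → UnitAddTorus (Fin d) → ℝ} (hH : Integrable (Function.uncurry H)) (k : Fin m)
    (a : Fin d) :
    (fun x => (∫ z, H x z • K (x k) z) a) =ᵐ[volume] fun x => ∫ z, H x z * K (x k) z a := by
  filter_upwards [hH.prod_right_ae] with x hx
  have := (EuclideanSpace.proj a : EuclideanSpace ℝ (Fin d) →L[ℝ] ℝ).integral_comp_comm
    (integrable_smul_kernel hK hx (p := fun _ => x k) measurable_const measurable_id)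
  exact this.symm

theorem integrable_integral_smul_kernel (hK : Continuous (Function.uncurry K))
    {H : Config m d → UnitAddTorus (Fin d) → ℝ} (hH : Integrable (Function.uncurry H)) (k : Fin m)
    (a : Fin d) : Integrable fun x => (∫ z, H x z • K (x k) z) a := by
  refine Integrable.congr ?_ (ae_integral_smul_kernel_apply hK hH k a).symm
  exact (integrable_mul_kernel hK hH (p := fun y => y.1 k) (q := Prod.snd)
    (by fun_prop) (by fun_prop) a).integral_prod_left

/-- The convolution variable z is treated as one more coordinate: the kernel is expanded on the
product space, and Fubini recovers the iterated integral. -/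
theorem hasSum_fourierCoefficient_integral_smul_kernel (hK : Continuous (Function.uncurry K))
    (hs : Summable (fun ξ : Fin 2 → Fin d → ℤ => ‖kernelCoefficient K ξ‖))
    {H : Config m d → UnitAddTorus (Fin d) → ℝ} (hH : Integrable (Function.uncurry H)) (k : Fin m)
    (a : Fin d) (ζ : Fin m → Fin d → ℤ) :
    HasSum (fun κ => kernelCoefficient K κ a * ∫ y : Config m d × UnitAddTorus (Fin d),
        character ζ y.1 * (H y.1 y.2 : ℂ) *
          (UnitAddTorus.mFourier (κ 0) (y.1 k) * UnitAddTorus.mFourier (κ 1) y.2))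
      (fourierCoefficient (fun x => (∫ z, H x z • K (x k) z) a) ζ) := by
  have hH' : Integrable fun y : Config m d × UnitAddTorus (Fin d) =>
      character ζ y.1 * (H y.1 y.2 : ℂ) :=
    hH.ofReal.bdd_mul (c := 1) (by fun_prop)
      (Filter.Eventually.of_forall fun x => (norm_character_apply ζ _).le)
  have h := hasSum_integral_mul hH' (summable_norm_kernelCoefficient_apply hs a)
    (g := fun κ y => UnitAddTorus.mFourier (κ 0) (y.1 k) * UnitAddTorus.mFourier (κ 1) y.2)
    (G := fun y => (K (y.1 k) y.2 a : ℂ)) (fun κ => by fun_prop)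
    (fun κ y => by simp [norm_mFourier_apply]) (fun y => hasSum_kernel hK hs a _ _)
  convert h using 1
  rw [fourierCoefficient_eq]
  have hi : Integrable fun y : Config m d × UnitAddTorus (Fin d) =>
      character ζ y.1 * (H y.1 y.2 : ℂ) * (K (y.1 k) y.2 a : ℂ) := by
    have h1 := (integrable_mul_kernel hK hH (p := fun y => y.1 k) (q := Prod.snd)
      (by fun_prop) (by fun_prop) a).ofReal (𝕜 := ℂ)
    refine (h1.bdd_mul (c := 1) (f := fun y => character ζ y.1) (by fun_prop)
      (Filter.Eventually.of_forall fun x => (norm_character_apply ζ _).le)).congr ?_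
    refine Filter.Eventually.of_forall fun y => ?_
    simp [Function.uncurry, mul_assoc]
  have h2 : ∫ y : Config m d × UnitAddTorus (Fin d),
      character ζ y.1 * (H y.1 y.2 : ℂ) * (K (y.1 k) y.2 a : ℂ)
      = ∫ x, ∫ z, character ζ x * (H x z : ℂ) * (K (x k) z a : ℂ) := integral_prod _ hi
  rw [h2]
  refine integral_congr_ae ?_
  filter_upwards [ae_integral_smul_kernel_apply hK hH k a] with x hx
  simp only [hx, mul_assoc]
  rw [integral_const_mul, ← integral_complex_ofReal]
  simp

theorem character_single (k : Fin m) (n : Fin d → ℤ) (x : Config m d) :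
    character (Pi.single k n) x = UnitAddTorus.mFourier (-n) (x k) := by
  rw [character_apply, Finset.prod_eq_single k]
  · simp
  · intro j _ hj
    simp [Pi.single_eq_of_ne hj, UnitAddTorus.mFourier_zero]
  · simp

theorem character_sub_single (ζ : Fin m → Fin d → ℤ) (k : Fin m) (n : Fin d → ℤ)
    (x : Config m d) :
    character (ζ - Pi.single k n) x = character ζ x * UnitAddTorus.mFourier n (x k) := by
  rw [sub_eq_add_neg, character_add, ContinuousMap.mul_apply, ← Pi.single_neg, character_single,
    neg_neg]

theorem character_two (ζ : Fin 2 → Fin d → ℤ) (k : Fin 2) (x : Config 2 d) :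
    character ζ x = UnitAddTorus.mFourier (-(ζ k)) (x k) *
      UnitAddTorus.mFourier (-(ζ k.rev)) (x k.rev) := by
  rw [character_apply, Fin.prod_univ_two]
  fin_cases k
  · rfl
  · exact mul_comm _ _

theorem mFourier_sub_mul (n n' : Fin d → ℤ) (x : UnitAddTorus (Fin d)) :
    UnitAddTorus.mFourier (-(n - n')) x
      = UnitAddTorus.mFourier (-n) x * UnitAddTorus.mFourier n' x := by
  rw [neg_sub, sub_eq_neg_add, UnitAddTorus.mFourier_add]

theorem modes_neg_eq (ρ : UnitAddTorus (Fin d) → ℝ) (n : Fin d → ℤ) :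
    modes ρ (-n) = ∫ x, (ρ x : ℂ) * UnitAddTorus.mFourier n x := by
  rw [modes]
  refine integral_congr_ae (Filter.Eventually.of_forall fun x => ?_)
  simp only [neg_neg]; ring

theorem fourierCoefficient_sub_single (u : Config m d → ℝ) (ζ : Fin m → Fin d → ℤ) (k : Fin m)
    (n : Fin d → ℤ) :
    fourierCoefficient u (ζ - Pi.single k n)
      = ∫ x, character ζ x * (u x : ℂ) * UnitAddTorus.mFourier n (x k) := by
  rw [fourierCoefficient_eq]
  refine integral_congr_ae (Filter.Eventually.of_forall fun x => ?_)
  simp only [character_sub_single]; ring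

theorem evolves_modes (hK : Continuous (Function.uncurry K))
    (hs : Summable (fun ξ : Fin 2 → Fin d → ℤ => ‖kernelCoefficient K ξ‖)) {σ : ℝ}
    {ρ₀ : UnitAddTorus (Fin d) → ℝ} {ρ : ℝ → UnitAddTorus (Fin d) → ℝ}
    (h : IsMcKeanVlasovSolution K σ ρ₀ ρ) (ξ : Fin d → ℤ) :
    Evolves (fun t => modes (ρ t) ξ) fun t =>
      -((4 * Real.pi ^ 2 * σ * freqSq ξ : ℝ) : ℂ) * modes (ρ t) ξ
        + ∑' κ, transportCoeff K ξ κ * (modes (ρ t) (ξ - κ 0) * modes (ρ t) (-(κ 1))) := by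
  have hcont : ∀ ξ, ContinuousOn (fun t => modes (ρ t) ξ) (Set.Ici 0) := fun ξ => by
    simpa only [fourierCoefficient_one] using continuousOn_fourierCoefficient h.equation fun _ => ξ
  have hH : ∀ t, 0 ≤ t → Integrable (Function.uncurry fun (x : Config 1 d) z =>
      ρ t (x 0) * ρ t z) := fun t ht =>
    (integrable_eval (h.density t ht).integrable 0).mul_prod (h.density t ht).integrable
  have hJ : ∀ t, ∀ k : Fin 1, mckeanVlasovFlux K (ρ t) k
      = fun x => ∫ z, (ρ t (x 0) * ρ t z) • K (x 0) z := by
    intro t k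
    funext x
    rw [Subsingleton.elim k 0]
    simp only [mckeanVlasovFlux, mul_smul, integral_smul]
  have key := evolves_of_isWeakSolution hs h.equation
    (fun t ht => integrable_eval (h.density t ht).integrable 0)
    (fun t ht k a => by
      rw [hJ]; exact integrable_integral_smul_kernel hK (hH t ht) 0 a) (fun _ => ξ)
    (fun _ κ t => modes (ρ t) (ξ - κ 0) * modes (ρ t) (-(κ 1)))
    (fun t ht k a => by
      rw [hJ]
      convert hasSum_fourierCoefficient_integral_smul_kernel hK hs (hH t ht) 0 a (fun _ => ξ)
        using 3 with κ
      rw [modes_neg_eq, ← fourierCoefficient_one (ρ t) (fun _ => ξ - κ 0), fourierCoefficient_eq]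
      have := integral_prod_mul (μ := (volume : Measure (Config 1 d)))
        (ν := (volume : Measure (UnitAddTorus (Fin d))))
        (fun x : Config 1 d => character (fun _ => ξ - κ 0) x * (ρ t (x 0) : ℂ))
        (fun z => (ρ t z : ℂ) * UnitAddTorus.mFourier (κ 1) z)
      rw [← this]
      refine integral_congr_ae (Filter.Eventually.of_forall fun y => ?_)
      simp only [character_apply, Finset.univ_unique, Finset.prod_singleton, Fin.default_eq_zero,
        mFourier_sub_mul]
      push_cast; ring)
    (fun k κ => (hcont _).mul (hcont _))
    (fun T => ⟨1, fun k κ t ht _ => by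
      rw [norm_mul]
      exact mul_le_one₀ (norm_modes_le (h.density t ht) _) (norm_nonneg _)
        (norm_modes_le (h.density t ht) _)⟩)
  simpa only [fourierCoefficient_one, Finset.univ_unique, Finset.sum_singleton] using key

theorem modes_zero_time {σ : ℝ}
    {ρ₀ : UnitAddTorus (Fin d) → ℝ} {ρ : ℝ → UnitAddTorus (Fin d) → ℝ}
    (h : IsMcKeanVlasovSolution K σ ρ₀ ρ) (ξ : Fin d → ℤ) : modes (ρ 0) ξ = modes ρ₀ ξ := by
  simpa only [fourierCoefficient_one] using fourierCoefficient_zero_time h.equation fun _ => ξ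

theorem norm_fourierCoefficient_le_one {u : Config m d → ℝ} (h : IsProbDensity u)
    (ζ : Fin m → Fin d → ℤ) : ‖fourierCoefficient u ζ‖ ≤ 1 := by
  refine (norm_fourierCoefficient_le ζ).trans (le_of_eq ?_)
  refine Eq.trans (integral_congr_ae ?_) h.integral_eq_one
  filter_upwards [h.nonneg] with x hx using abs_of_nonneg hx

theorem liouvilleFlux_apply {N : ℕ} (f : Config N d → ℝ) (k : Fin N) (a : Fin d) (x : Config N d) :
    liouvilleFlux K f k x a = (N : ℝ)⁻¹ * ∑ l, f x * K (x k) (x l) a := by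
  simp only [liouvilleFlux, PiLp.smul_apply, smul_eq_mul, WithLp.ofLp_sum, Finset.sum_apply,
    Finset.mul_sum]
  exact Finset.sum_congr rfl fun l _ => by ring

theorem integrable_liouville_term {N : ℕ} (hK : Continuous (Function.uncurry K))
    {f : Config N d → ℝ} (hf : Integrable f) (k l : Fin N) (a : Fin d) :
    Integrable fun x => f x * K (x k) (x l) a :=
  integrable_mul_kernel hK hf (p := fun x => x k) (q := fun x => x l) (measurable_pi_apply k)
    (measurable_pi_apply l) a

theorem integrable_liouvilleFlux {N : ℕ} (hK : Continuous (Function.uncurry K))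
    {f : Config N d → ℝ} (hf : Integrable f) (k : Fin N) (a : Fin d) :
    Integrable fun x => liouvilleFlux K f k x a := by
  simp only [liouvilleFlux_apply]
  exact (integrable_finsetSum _ fun l _ => integrable_liouville_term hK hf k l a).const_mul _

/-- The mode κ of K(x_k, x_l) shifts the frequency of particle k by κ 0 and that of particle l by κ
1. Writing this as two successive subtractions also covers the self-interaction k = l. -/
theorem hasSum_liouville_term {N : ℕ} (hK : Continuous (Function.uncurry K))
    (hs : Summable (fun ξ : Fin 2 → Fin d → ℤ => ‖kernelCoefficient K ξ‖))
    {f : Config N d → ℝ} (hf : Integrable f) (k l : Fin N) (a : Fin d) (ζ : Fin N → Fin d → ℤ) :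
    HasSum (fun κ => kernelCoefficient K κ a *
        fourierCoefficient f (ζ - Pi.single k (κ 0) - Pi.single l (κ 1)))
      (∫ x, character ζ x * (f x : ℂ) * (K (x k) (x l) a : ℂ)) := by
  have h := hasSum_integral_mul (integrable_mul_character hf ζ)
    (summable_norm_kernelCoefficient_apply hs a)
    (g := fun κ x => UnitAddTorus.mFourier (κ 0) (x k) * UnitAddTorus.mFourier (κ 1) (x l))
    (G := fun x => (K (x k) (x l) a : ℂ)) (fun κ => by fun_prop)
    (fun κ y => by simp [norm_mFourier_apply]) (fun y => hasSum_kernel hK hs a _ _)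
  refine h.congr_fun fun κ => ?_
  rw [fourierCoefficient_sub_single]
  congr 1
  refine integral_congr_ae (Filter.Eventually.of_forall fun x => ?_)
  simp only [character_sub_single]; ring

theorem hasSum_liouvilleFlux {N : ℕ} (hK : Continuous (Function.uncurry K))
    (hs : Summable (fun ξ : Fin 2 → Fin d → ℤ => ‖kernelCoefficient K ξ‖))
    {f : Config N d → ℝ} (hf : Integrable f) (k : Fin N) (a : Fin d) (ζ : Fin N → Fin d → ℤ) :
    HasSum (fun κ => kernelCoefficient K κ a * ((N : ℂ)⁻¹ *
        ∑ l, fourierCoefficient f (ζ - Pi.single k (κ 0) - Pi.single l (κ 1))))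
      (fourierCoefficient (fun x => liouvilleFlux K f k x a) ζ) := by
  have h := (hasSum_sum (s := Finset.univ) fun l _ =>
    hasSum_liouville_term hK hs hf k l a ζ).mul_left ((N : ℂ)⁻¹)
  have e : fourierCoefficient (fun x => liouvilleFlux K f k x a) ζ
      = (N : ℂ)⁻¹ * ∑ l, ∫ x, character ζ x * (f x : ℂ) * (K (x k) (x l) a : ℂ) := by
    rw [fourierCoefficient_eq, ← integral_finsetSum, ← integral_const_mul]
    · refine integral_congr_ae (Filter.Eventually.of_forall fun x => ?_)
      simp only [liouvilleFlux_apply, Complex.ofReal_mul, Complex.ofReal_sum, Complex.ofReal_inv,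
        Complex.ofReal_natCast, Finset.mul_sum]
      exact Finset.sum_congr rfl fun l _ => by ring
    · intro l _
      refine (integrable_mul_character (integrable_liouville_term hK hf k l a) ζ).congr ?_
      refine Filter.Eventually.of_forall fun x => ?_
      simp only [Complex.ofReal_mul]; ring
  rw [e]
  refine h.congr_fun fun κ => ?_
  simp only [Finset.mul_sum]
  exact Finset.sum_congr rfl fun l _ => by ring

theorem norm_average_le_one {N : ℕ} {c : Fin N → ℂ} (h : ∀ l, ‖c l‖ ≤ 1) :
    ‖(N : ℂ)⁻¹ * ∑ l, c l‖ ≤ 1 := by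
  rw [norm_mul, norm_inv, Complex.norm_natCast]
  refine (mul_le_mul_of_nonneg_left ((norm_sum_le _ _).trans
    (Finset.sum_le_card_nsmul _ _ 1 fun l _ => h l)) (by positivity)).trans ?_
  simp only [Finset.card_univ, Fintype.card_fin, nsmul_eq_mul, mul_one]
  exact inv_mul_le_one

theorem evolves_liouville {N : ℕ} (hK : Continuous (Function.uncurry K))
    (hs : Summable (fun ξ : Fin 2 → Fin d → ℤ => ‖kernelCoefficient K ξ‖)) {σ : ℝ}
    {ρ₀ : UnitAddTorus (Fin d) → ℝ} {f : ℝ → Config N d → ℝ}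
    (h : IsLiouvilleSolution K σ ρ₀ f) (ζ : Fin N → Fin d → ℤ) :
    Evolves (fun t => fourierCoefficient (f t) ζ) fun t =>
      -((4 * Real.pi ^ 2 * σ * ∑ k, freqSq (ζ k) : ℝ) : ℂ) * fourierCoefficient (f t) ζ
        + ∑ k, ∑' κ, transportCoeff K (ζ k) κ * ((N : ℂ)⁻¹ *
          ∑ l, fourierCoefficient (f t) (ζ - Pi.single k (κ 0) - Pi.single l (κ 1))) := by
  have hX : ∀ t, 0 ≤ t → ∀ k a, HasSum (fun κ => kernelCoefficient K κ a *
      (fun (k : Fin N) (κ : Fin 2 → Fin d → ℤ) (t : ℝ) => (N : ℂ)⁻¹ * ∑ l, fourierCoefficient (f t)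
        (ζ - Pi.single k (κ 0) - Pi.single l (κ 1))) k κ t)
      (fourierCoefficient (fun x => (fun t => liouvilleFlux K (f t)) t k x a) ζ) :=
    fun t ht k a => hasSum_liouvilleFlux hK hs (h.density t ht).integrable k a ζ
  refine evolves_of_isWeakSolution hs h.equation (fun t ht => (h.density t ht).integrable)
    (fun t ht k a => integrable_liouvilleFlux hK (h.density t ht).integrable k a) ζ _ hX ?_ ?_
  · intro k κ
    exact continuousOn_const.mul (continuousOn_finsetSum _ fun _ _ =>
      continuousOn_fourierCoefficient h.equation _)
  · exact fun T => ⟨1, fun k κ t ht _ => norm_average_le_one fun l =>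
      norm_fourierCoefficient_le_one (h.density t ht) _⟩

end Kernel

end

/-! ### Mode equation of the Bogolyubov correction -/

section

variable {d : ℕ} {K : UnitAddTorus (Fin d) → UnitAddTorus (Fin d) → EuclideanSpace ℝ (Fin d)}

theorem measurePreserving_pair (k : Fin 2) : MeasurePreserving
    (fun x : Config 2 d => (x k, x k.rev)) := by
  have h := volume_preserving_finTwoArrow (UnitAddTorus (Fin d))
  fin_cases k
  · exact h
  · exact Measure.measurePreserving_swap.comp h

/-- In the term ρ(x_k) b(x_{k'}, z) the arguments of b include the integration variable. Regrouping
the three variables as x_k and (x_{k'}, z) makes the integral factorise. -/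
theorem measurePreserving_rotate (k : Fin 2) : MeasurePreserving
    (fun p : Config 2 d × UnitAddTorus (Fin d) =>
      ((p.1 k, ![p.1 k.rev, p.2]) : UnitAddTorus (Fin d) × Config 2 d)) := by
  have h1 := (measurePreserving_pair (d := d) k).prod
    (MeasurePreserving.id (volume : Measure (UnitAddTorus (Fin d))))
  have h2 := volume_preserving_prodAssoc (α₁ := UnitAddTorus (Fin d))
    (β₁ := UnitAddTorus (Fin d)) (γ₁ := UnitAddTorus (Fin d))
  have h3 := (MeasurePreserving.id (volume : Measure (UnitAddTorus (Fin d)))).prod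
    (volume_preserving_finTwoArrow (UnitAddTorus (Fin d))).symm
  exact h3.comp (h2.comp h1)

theorem integral_pair_mul {F G : UnitAddTorus (Fin d) → ℂ} (hF : Integrable F) (hG : Integrable G)
    (k : Fin 2) : ∫ x : Config 2 d, F (x k) * G (x k.rev) = (∫ x, F x) * ∫ x, G x := by
  have h := measurePreserving_pair (d := d) k
  rw [← integral_prod_mul, ← Measure.volume_eq_prod, ← h.map_eq, integral_map h.aemeasurable]
  rw [h.map_eq]
  exact (hF.mul_prod hG).aestronglyMeasurable

theorem integral_rotate_mul {F : UnitAddTorus (Fin d) → ℂ} {G : Config 2 d → ℂ}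
    (hF : Integrable F) (hG : Integrable G) (k : Fin 2) :
    ∫ p : Config 2 d × UnitAddTorus (Fin d), F (p.1 k) * G ![p.1 k.rev, p.2]
      = (∫ x, F x) * ∫ x, G x := by
  have h := measurePreserving_rotate (d := d) k
  rw [← integral_prod_mul, ← Measure.volume_eq_prod, ← h.map_eq, integral_map h.aemeasurable]
  rw [h.map_eq]
  exact (hF.mul_prod hG).aestronglyMeasurable

theorem integrable_pair_mul {F G : UnitAddTorus (Fin d) → ℝ} (hF : Integrable F)
    (hG : Integrable G) (k : Fin 2) : Integrable fun x : Config 2 d => F (x k) * G (x k.rev) :=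
  (measurePreserving_pair k).integrable_comp_of_integrable (hF.mul_prod hG)

theorem integrable_rotate_mul {F : UnitAddTorus (Fin d) → ℝ} {G : Config 2 d → ℝ}
    (hF : Integrable F) (hG : Integrable G) (k : Fin 2) :
    Integrable fun p : Config 2 d × UnitAddTorus (Fin d) => F (p.1 k) * G ![p.1 k.rev, p.2] :=
  (measurePreserving_rotate k).integrable_comp_of_integrable (hF.mul_prod hG)

theorem integrable_mFourier_mul {ρ : UnitAddTorus (Fin d) → ℝ} (h : Integrable ρ)
    (n : Fin d → ℤ) : Integrable fun x => UnitAddTorus.mFourier n x * (ρ x : ℂ) :=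
  h.ofReal.bdd_mul (UnitAddTorus.mFourier n).continuous.aestronglyMeasurable
    (Filter.Eventually.of_forall fun x => (norm_mFourier_apply n x).le)

theorem fourierCoefficient_pair {ρ ρ' : UnitAddTorus (Fin d) → ℝ} (h : Integrable ρ)
    (h' : Integrable ρ') (k : Fin 2) (ζ : Fin 2 → Fin d → ℤ) :
    fourierCoefficient (fun x => ρ (x k) * ρ' (x k.rev)) ζ
      = modes ρ (ζ k) * modes ρ' (ζ k.rev) := by
  rw [modes, modes, ← integral_pair_mul (integrable_mFourier_mul h _)
    (integrable_mFourier_mul h' _) k, fourierCoefficient_eq]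
  refine integral_congr_ae (Filter.Eventually.of_forall fun x => ?_)
  simp only [character_two ζ k]
  push_cast; ring

/-- The integrand in the convolution part of the flux of the Bogolyubov correction. -/
def bogolyubovIntegrand (ρ : UnitAddTorus (Fin d) → ℝ) (b : Config 2 d → ℝ) (k : Fin 2)
    (x : Config 2 d) (z : UnitAddTorus (Fin d)) : ℝ :=
  ρ (x k) * b ![x k.rev, z] + ρ z * b x - ρ (x k) * ρ (x k.rev) * ρ z

theorem integrable_bogolyubovIntegrand {ρ : UnitAddTorus (Fin d) → ℝ} {b : Config 2 d → ℝ}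
    (hρ : Integrable ρ) (hb : Integrable b) (k : Fin 2) :
    Integrable (Function.uncurry (bogolyubovIntegrand ρ b k)) := by
  have h1 := integrable_rotate_mul hρ hb k
  have h2 := (hb.mul_prod hρ)
  have h3 := (integrable_pair_mul hρ hρ k).mul_prod hρ
  refine ((h1.add h2).sub h3).congr (Filter.Eventually.of_forall fun p => ?_)
  simp [Function.uncurry, bogolyubovIntegrand, mul_comm]

theorem integral_bogolyubovIntegrand {ρ : UnitAddTorus (Fin d) → ℝ} {b : Config 2 d → ℝ}
    (hρ : Integrable ρ) (hb : Integrable b) (k : Fin 2) (ζ κ : Fin 2 → Fin d → ℤ) :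
    ∫ y : Config 2 d × UnitAddTorus (Fin d),
        character ζ y.1 * (bogolyubovIntegrand ρ b k y.1 y.2 : ℂ) *
          (UnitAddTorus.mFourier (κ 0) (y.1 k) * UnitAddTorus.mFourier (κ 1) y.2)
      = modes ρ (ζ k - κ 0) * fourierCoefficient b ![ζ k.rev, -(κ 1)]
        + fourierCoefficient b (ζ - Pi.single k (κ 0)) * modes ρ (-(κ 1))
        - modes ρ (ζ k - κ 0) * modes ρ (ζ k.rev) * modes ρ (-(κ 1)) := by
  have i1 := integrable_mFourier_mul hρ (-(ζ k - κ 0))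
  have i2 := integrable_mul_character hb ![ζ k.rev, -(κ 1)]
  have i3 := integrable_mul_character hb (ζ - Pi.single k (κ 0))
  have i4 := integrable_mFourier_mul hρ (-(-(κ 1)))
  have i5 := integrable_mul_character (integrable_pair_mul hρ hρ k) (ζ - Pi.single k (κ 0))
  have e5 : modes ρ (ζ k - κ 0) * modes ρ (ζ k.rev)
      = fourierCoefficient (fun x => ρ (x k) * ρ (x k.rev)) (ζ - Pi.single k (κ 0)) := by
    rw [fourierCoefficient_pair hρ hρ]
    simp [Pi.single_eq_of_ne (show k.rev ≠ k by fin_cases k <;> decide)]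
  have p1 := integral_rotate_mul i1 i2 k
  have p2 := integral_prod_mul (μ := (volume : Measure (Config 2 d)))
    (ν := (volume : Measure (UnitAddTorus (Fin d))))
    (fun x => character (ζ - Pi.single k (κ 0)) x * (b x : ℂ))
    (fun x => UnitAddTorus.mFourier (-(-(κ 1))) x * (ρ x : ℂ))
  have p3 := integral_prod_mul (μ := (volume : Measure (Config 2 d)))
    (ν := (volume : Measure (UnitAddTorus (Fin d))))
    (fun x => character (ζ - Pi.single k (κ 0)) x * ((ρ (x k) * ρ (x k.rev) : ℝ) : ℂ))
    (fun x => UnitAddTorus.mFourier (-(-(κ 1))) x * (ρ x : ℂ))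
  have j1 : Integrable fun p : Config 2 d × UnitAddTorus (Fin d) =>
      UnitAddTorus.mFourier (-(ζ k - κ 0)) (p.1 k) * (ρ (p.1 k) : ℂ) *
        (character ![ζ k.rev, -(κ 1)] ![p.1 k.rev, p.2] * (b ![p.1 k.rev, p.2] : ℂ)) :=
    (measurePreserving_rotate k).integrable_comp_of_integrable (i1.mul_prod i2)
  have j2 := i3.mul_prod i4
  have j3 := i5.mul_prod i4
  rw [e5]
  simp only [fourierCoefficient_eq, modes]
  rw [← p1, ← p2, ← p3]
  refine Eq.trans ?_ ((integral_sub (j1.add j2) j3).trans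
    (congrArg (· - _) (integral_add j1 j2)))
  refine integral_congr_ae (Filter.Eventually.of_forall fun y => ?_)
  have c1 : character ![ζ k.rev, -(κ 1)] ![y.1 k.rev, y.2]
      = UnitAddTorus.mFourier (-(ζ k.rev)) (y.1 k.rev) * UnitAddTorus.mFourier (κ 1) y.2 := by
    simp [character_apply, Fin.prod_univ_two]
  simp only [Pi.add_apply, character_sub_single, mFourier_sub_mul, bogolyubovIntegrand,
    character_two ζ k, c1, neg_neg]
  push_cast
  ring

/-- The Fourier modes of the flux of the Bogolyubov correction. -/
def bogolyubovModes (ρ : UnitAddTorus (Fin d) → ℝ) (b : Config 2 d → ℝ) (ζ : Fin 2 → Fin d → ℤ)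
    (k : Fin 2) (κ : Fin 2 → Fin d → ℤ) : ℂ :=
  modes ρ (ζ k - κ 0) * fourierCoefficient b ![ζ k.rev, -(κ 1)]
    + fourierCoefficient b (ζ - Pi.single k (κ 0)) * modes ρ (-(κ 1))
    - modes ρ (ζ k - κ 0) * modes ρ (ζ k.rev) * modes ρ (-(κ 1))
    + modes ρ (ζ k - κ 0) * modes ρ (ζ k.rev - κ 1)

theorem hasSum_pair_kernel (hK : Continuous (Function.uncurry K))
    (hs : Summable (fun ξ : Fin 2 → Fin d → ℤ => ‖kernelCoefficient K ξ‖))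
    {ρ : UnitAddTorus (Fin d) → ℝ} (hρ : Integrable ρ) (k : Fin 2) (a : Fin d)
    (ζ : Fin 2 → Fin d → ℤ) :
    HasSum (fun κ => kernelCoefficient K κ a * (modes ρ (ζ k - κ 0) * modes ρ (ζ k.rev - κ 1)))
      (fourierCoefficient (fun x => ρ (x k) * ρ (x k.rev) * K (x k) (x k.rev) a) ζ) := by
  have hi := integrable_pair_mul hρ hρ k
  have h := hasSum_integral_mul (integrable_mul_character hi ζ)
    (summable_norm_kernelCoefficient_apply hs a)
    (g := fun κ x => UnitAddTorus.mFourier (κ 0) (x k) * UnitAddTorus.mFourier (κ 1) (x k.rev))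
    (G := fun x => (K (x k) (x k.rev) a : ℂ)) (fun κ => by fun_prop)
    (fun κ y => by simp [norm_mFourier_apply]) (fun y => hasSum_kernel hK hs a _ _)
  have e : fourierCoefficient (fun x => ρ (x k) * ρ (x k.rev) * K (x k) (x k.rev) a) ζ
      = ∫ x, character ζ x * ((ρ (x k) * ρ (x k.rev) : ℝ) : ℂ) * (K (x k) (x k.rev) a : ℂ) := by
    rw [fourierCoefficient_eq]
    refine integral_congr_ae (Filter.Eventually.of_forall fun x => ?_)
    push_cast; ring
  rw [e]
  refine h.congr_fun fun κ => ?_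
  have hne : k.rev ≠ k := by fin_cases k <;> decide
  have e2 : modes ρ (ζ k - κ 0) * modes ρ (ζ k.rev - κ 1)
      = fourierCoefficient (fun x => ρ (x k) * ρ (x k.rev))
        (ζ - Pi.single k (κ 0) - Pi.single k.rev (κ 1)) := by
    rw [fourierCoefficient_pair hρ hρ]
    simp [Pi.single_eq_of_ne hne, Pi.single_eq_of_ne hne.symm]
  rw [e2, fourierCoefficient_sub_single]
  congr 1
  refine integral_congr_ae (Filter.Eventually.of_forall fun x => ?_)
  simp only [character_sub_single]
  ring

theorem bogolyubovFlux_apply (ρ : UnitAddTorus (Fin d) → ℝ) (b : Config 2 d → ℝ) (k : Fin 2)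
    (a : Fin d) : (fun x => bogolyubovFlux K ρ b k x a)
      = fun x => (∫ z, bogolyubovIntegrand ρ b k x z • K (x k) z) a
        + ρ (x k) * ρ (x k.rev) * K (x k) (x k.rev) a := by
  funext x
  simp only [bogolyubovFlux, bogolyubovIntegrand, PiLp.add_apply, PiLp.smul_apply, smul_eq_mul]

theorem integrable_bogolyubovFlux (hK : Continuous (Function.uncurry K))
    {ρ : UnitAddTorus (Fin d) → ℝ} {b : Config 2 d → ℝ} (hρ : Integrable ρ) (hb : Integrable b)
    (k : Fin 2) (a : Fin d) : Integrable fun x => bogolyubovFlux K ρ b k x a := by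
  rw [bogolyubovFlux_apply]
  exact (integrable_integral_smul_kernel hK (integrable_bogolyubovIntegrand hρ hb k) k a).add
    (integrable_mul_kernel hK (integrable_pair_mul hρ hρ k) (p := fun x => x k)
      (q := fun x => x k.rev) (measurable_pi_apply _) (measurable_pi_apply _) a)

theorem hasSum_bogolyubovFlux (hK : Continuous (Function.uncurry K))
    (hs : Summable (fun ξ : Fin 2 → Fin d → ℤ => ‖kernelCoefficient K ξ‖))
    {ρ : UnitAddTorus (Fin d) → ℝ} {b : Config 2 d → ℝ} (hρ : Integrable ρ) (hb : Integrable b)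
    (k : Fin 2) (a : Fin d) (ζ : Fin 2 → Fin d → ℤ) :
    HasSum (fun κ => kernelCoefficient K κ a * bogolyubovModes ρ b ζ k κ)
      (fourierCoefficient (fun x => bogolyubovFlux K ρ b k x a) ζ) := by
  have hH := integrable_bogolyubovIntegrand hρ hb k
  have h := (hasSum_fourierCoefficient_integral_smul_kernel hK hs hH k a ζ).add
    (hasSum_pair_kernel hK hs hρ k a ζ)
  have e : fourierCoefficient (fun x => bogolyubovFlux K ρ b k x a) ζ
      = fourierCoefficient (fun x => (∫ z, bogolyubovIntegrand ρ b k x z • K (x k) z) a) ζ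
        + fourierCoefficient (fun x => ρ (x k) * ρ (x k.rev) * K (x k) (x k.rev) a) ζ := by
    rw [bogolyubovFlux_apply]
    simp only [fourierCoefficient_eq]
    rw [← integral_add (integrable_mul_character (integrable_integral_smul_kernel hK hH k a) ζ)
      (integrable_mul_character (integrable_mul_kernel hK (integrable_pair_mul hρ hρ k)
        (p := fun x => x k) (q := fun x => x k.rev) (measurable_pi_apply _)
        (measurable_pi_apply _) a) ζ)]
    refine integral_congr_ae (Filter.Eventually.of_forall fun x => ?_)
    push_cast; ring
  rw [e]
  refine h.congr_fun fun κ => ?_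
  rw [integral_bogolyubovIntegrand hρ hb, bogolyubovModes]
  ring

/-- The local L¹ bound on b enters here: it bounds the flux modes uniformly in κ on bounded time
intervals, which makes their sum continuous in time. -/
theorem evolves_bogolyubov (hK : Continuous (Function.uncurry K))
    (hs : Summable (fun ξ : Fin 2 → Fin d → ℤ => ‖kernelCoefficient K ξ‖)) {σ : ℝ}
    {ρ₀ : UnitAddTorus (Fin d) → ℝ} {ρ : ℝ → UnitAddTorus (Fin d) → ℝ} {b : ℝ → Config 2 d → ℝ}
    (h : IsMcKeanVlasovSolution K σ ρ₀ ρ) (hb : IsBogolyubovCorrection K σ ρ b)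
    (ζ : Fin 2 → Fin d → ℤ) :
    Evolves (fun t => fourierCoefficient (b t) ζ) fun t =>
      -((4 * Real.pi ^ 2 * σ * ∑ k, freqSq (ζ k) : ℝ) : ℂ) * fourierCoefficient (b t) ζ
        + ∑ k, ∑' κ, transportCoeff K (ζ k) κ * bogolyubovModes (ρ t) (b t) ζ k κ := by
  have hX : ∀ t, 0 ≤ t → ∀ k a, HasSum (fun κ => kernelCoefficient K κ a *
      (fun k κ t => bogolyubovModes (ρ t) (b t) ζ k κ) k κ t)
      (fourierCoefficient (fun x => (fun t => bogolyubovFlux K (ρ t) (b t)) t k x a) ζ) :=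
    fun t ht k a => hasSum_bogolyubovFlux hK hs (h.density t ht).integrable (hb.integrable t ht)
      k a ζ
  refine evolves_of_isWeakSolution hs hb.equation hb.integrable
    (fun t ht k a => integrable_bogolyubovFlux hK (h.density t ht).integrable
      (hb.integrable t ht) k a) ζ _ hX ?_ ?_
  · intro k κ
    have c1 := fun ξ => (evolves_modes hK hs h ξ).continuousOn
    have c2 := fun ζ => continuousOn_fourierCoefficient hb.equation ζ
    exact ((((c1 _).mul (c2 _)).add ((c2 _).mul (c1 _))).sub (((c1 _).mul (c1 _)).mul (c1 _))).add
      ((c1 _).mul (c1 _))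
  · intro T
    obtain ⟨M, hM⟩ := hb.locally_bounded T
    refine ⟨1 * M + M * 1 + 1 * 1 * 1 + 1 * 1, fun k κ t ht hT => ?_⟩
    have n1 := fun ξ => norm_modes_le (h.density t ht) ξ
    have n2 : ∀ ζ, ‖fourierCoefficient (b t) ζ‖ ≤ M :=
      fun ζ => (norm_fourierCoefficient_le ζ).trans (hM t ht hT)
    have hM0 : 0 ≤ M := (norm_nonneg _).trans (n2 0)
    refine (norm_add_le _ _).trans (add_le_add ((norm_sub_le _ _).trans (add_le_add
      ((norm_add_le _ _).trans (add_le_add ?_ ?_)) ?_)) ?_)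
    all_goals simp only [norm_mul]
    · exact mul_le_mul (n1 _) (n2 _) (norm_nonneg _) zero_le_one
    · exact mul_le_mul (n2 _) (n1 _) (norm_nonneg _) hM0
    · exact mul_le_mul (mul_le_mul (n1 _) (n1 _) (norm_nonneg _) zero_le_one) (n1 _)
        (norm_nonneg _) (by norm_num)
    · exact mul_le_mul (n1 _) (n1 _) (norm_nonneg _) zero_le_one

end

/-! ### Expectations of observables and the Itô product rule -/

section

variable {N d : ℕ}

open Classical in
/-- Integration of continuous observables against a density (zero if the density is not
integrable). -/
def expect (h : Config N d → ℝ) : C(Config N d, ℂ) →L[ℂ] ℂ :=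
  if hh : Integrable h then
    LinearMap.mkContinuous
      { toFun := fun Φ => ∫ x, Φ x * (h x : ℂ)
        map_add' := fun Φ Ψ => by
          simp only [ContinuousMap.add_apply, add_mul]
          exact integral_add
            (hh.ofReal.bdd_mul (c := ‖Φ‖) Φ.continuous.aestronglyMeasurable
              (Filter.Eventually.of_forall fun x => Φ.norm_coe_le_norm x))
            (hh.ofReal.bdd_mul (c := ‖Ψ‖) Ψ.continuous.aestronglyMeasurable
              (Filter.Eventually.of_forall fun x => Ψ.norm_coe_le_norm x))
        map_smul' := fun c Φ => by
          simp only [ContinuousMap.smul_apply, smul_eq_mul, mul_assoc, RingHom.id_apply]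
          exact integral_const_mul _ _ }
      (∫ x, |h x|) (fun Φ => by
        rw [mul_comm, ← integral_const_mul]
        refine norm_integral_le_of_norm_le (hh.abs.const_mul _)
          (Filter.Eventually.of_forall fun x => ?_)
        simp only [norm_mul, Complex.norm_real, Real.norm_eq_abs]
        exact mul_le_mul_of_nonneg_right (Φ.norm_coe_le_norm x) (abs_nonneg _))
  else 0

theorem expect_apply {h : Config N d → ℝ} (hh : Integrable h) (Φ : C(Config N d, ℂ)) :
    expect h Φ = ∫ x, Φ x * (h x : ℂ) := by
  rw [expect, dif_pos hh]; rfl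

theorem expect_character {h : Config N d → ℝ} (hh : Integrable h) (ζ : Fin N → Fin d → ℤ) :
    expect h (character ζ) = fourierCoefficient h ζ := expect_apply hh _

theorem expect_one {h : Config N d → ℝ} (hh : IsProbDensity h) : expect h 1 = 1 := by
  rw [expect_apply hh.integrable]
  simp only [ContinuousMap.one_apply, one_mul]
  rw [integral_complex_ofReal, hh.integral_eq_one, Complex.ofReal_one]

/-- Positivity of the density. Pointwise Young inequalities thereby become inequalities between
moments; the real part is taken because the moments are complex-valued observables. -/
theorem norm_expect_le_re {h : Config N d → ℝ} (hh : IsProbDensity h) {Φ Ψ : C(Config N d, ℂ)}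
    (hle : ∀ x, ‖Φ x‖ ≤ (Ψ x).re) : ‖expect h Φ‖ ≤ (expect h Ψ).re := by
  have hi : Integrable fun x => Ψ x * (h x : ℂ) :=
    hh.integrable.ofReal.bdd_mul (c := ‖Ψ‖) Ψ.continuous.aestronglyMeasurable
      (Filter.Eventually.of_forall fun x => Ψ.norm_coe_le_norm x)
  rw [expect_apply hh.integrable, expect_apply hh.integrable]
  have e : (∫ x, Ψ x * (h x : ℂ)).re = ∫ x, (Ψ x).re * h x := by
    have := integral_re hi
    simp only [RCLike.re_eq_complex_re, Complex.re_mul_ofReal] at this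
    exact this.symm
  rw [e]
  refine norm_integral_le_of_norm_le ?_ ?_
  · simpa only [RCLike.re_eq_complex_re, Complex.re_mul_ofReal] using hi.re
  · filter_upwards [hh.nonneg] with x hx
    rw [norm_mul, Complex.norm_real, Real.norm_of_nonneg hx]
    exact mul_le_mul_of_nonneg_right (hle x) hx

/-- The `a`-th component of the mean field force on the `k`-th particle. -/
def drift (N : ℕ) (K : UnitAddTorus (Fin d) → UnitAddTorus (Fin d) → EuclideanSpace ℝ (Fin d))
    (k : Fin N) (a : Fin d) : C(Config N d, ℂ) :=
  ∑' κ : Fin 2 → Fin d → ℤ, kernelCoefficient K κ a •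
    ((N : ℂ)⁻¹ • ∑ l, character (-Pi.single k (κ 0) - Pi.single l (κ 1)))

variable {K : UnitAddTorus (Fin d) → UnitAddTorus (Fin d) → EuclideanSpace ℝ (Fin d)} {σ : ℝ}

theorem norm_average_le {E : Type*} [NormedAddCommGroup E] [NormedSpace ℂ E] {c : Fin N → E}
    (h : ∀ l, ‖c l‖ ≤ 1) : ‖(N : ℂ)⁻¹ • ∑ l, c l‖ ≤ 1 := by
  rw [norm_smul, norm_inv, Complex.norm_natCast]
  refine (mul_le_mul_of_nonneg_left ((norm_sum_le _ _).trans
    (Finset.sum_le_card_nsmul _ _ 1 fun l _ => h l)) (by positivity)).trans ?_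
  simp only [Finset.card_univ, Fintype.card_fin, nsmul_eq_mul, mul_one]
  exact inv_mul_le_one

/-- The series converges in the sup norm, so that the continuous functional `expect` and
multiplication by observables act on it term by term. -/
theorem hasSum_drift (hs : Summable (fun ξ : Fin 2 → Fin d → ℤ => ‖kernelCoefficient K ξ‖))
    (k : Fin N) (a : Fin d) :
    HasSum (fun κ : Fin 2 → Fin d → ℤ => kernelCoefficient K κ a •
      ((N : ℂ)⁻¹ • ∑ l, character (-Pi.single k (κ 0) - Pi.single l (κ 1)))) (drift N K k a) := by
  refine Summable.hasSum (Summable.of_norm_bounded (summable_norm_kernelCoefficient_apply hs a)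
    fun κ => ?_)
  rw [norm_smul]
  exact mul_le_of_le_one_right (norm_nonneg _) (norm_average_le fun l => norm_character_le _)

theorem hasSum_drift_mul_character
    (hs : Summable (fun ξ : Fin 2 → Fin d → ℤ => ‖kernelCoefficient K ξ‖))
    (k : Fin N) (ξ : Fin d → ℤ) (ζ : Fin N → Fin d → ℤ) :
    HasSum (fun κ : Fin 2 → Fin d → ℤ => transportCoeff K ξ κ •
      ((N : ℂ)⁻¹ • ∑ l, character (ζ - Pi.single k (κ 0) - Pi.single l (κ 1))))
      (∑ a, -(2 * Real.pi * Complex.I * ξ a) • (drift N K k a * character ζ)) := by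
  have h := hasSum_sum (s := Finset.univ) fun a _ =>
    (((hasSum_drift hs k a).mul_right (character ζ)).const_smul (-(2 * Real.pi * Complex.I * ξ a)))
  refine h.congr_fun fun κ => ?_
  ext x
  have e : ∀ l, character (ζ - Pi.single k (κ 0) - Pi.single l (κ 1)) x
      = character (-Pi.single k (κ 0) - Pi.single l (κ 1)) x * character ζ x := fun l => by
    rw [← ContinuousMap.mul_apply, ← character_add]
    congr 2
    abel
  simp only [transportCoeff, ContinuousMap.mul_apply, ContinuousMap.smul_apply,
    ContinuousMap.sum_apply, smul_eq_mul, e, ← Finset.sum_mul]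
  rw [Finset.sum_mul]
  exact Finset.sum_congr rfl fun a _ => by ring

/-- The generator of the particle system applied to a character. -/
def generator (K : UnitAddTorus (Fin d) → UnitAddTorus (Fin d) → EuclideanSpace ℝ (Fin d)) (σ : ℝ)
    (ζ : Fin N → Fin d → ℤ) : C(Config N d, ℂ) :=
  -((4 * Real.pi ^ 2 * σ * ∑ k, freqSq (ζ k) : ℝ) : ℂ) • character ζ
    + ∑ k, ∑ a, -(2 * Real.pi * Complex.I * ζ k a) • (drift N K k a * character ζ)

theorem evolves_expect_character (hK : Continuous (Function.uncurry K))
    (hs : Summable (fun ξ : Fin 2 → Fin d → ℤ => ‖kernelCoefficient K ξ‖))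
    {ρ₀ : UnitAddTorus (Fin d) → ℝ} {f : ℝ → Config N d → ℝ}
    (h : IsLiouvilleSolution K σ ρ₀ f) (ζ : Fin N → Fin d → ℤ) :
    Evolves (fun t => expect (f t) (character ζ)) fun t => expect (f t) (generator K σ ζ) := by
  refine (evolves_liouville hK hs h ζ).congr
    (fun t ht => expect_character (h.density t ht).integrable ζ) fun t ht => ?_
  have hi := (h.density t ht).integrable
  rw [generator, map_add, map_smul, expect_character hi, smul_eq_mul, map_sum]
  congr 1
  refine Finset.sum_congr rfl fun k _ => ?_
  have := (hasSum_drift_mul_character hs k (ζ k) ζ).mapL (expect (f t))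
  rw [← this.tsum_eq]
  refine tsum_congr fun κ => ?_
  simp only [map_smul, map_sum, expect_character hi, smul_eq_mul]

/-- `IsObservable K σ Ψ D G`: `Ψ` is a time dependent trigonometric polynomial with differentiable
coefficients, `D` is its gradient, and `G` is the sum of its time derivative and of the generator of
the particle system applied to it. -/
inductive IsObservable (K : UnitAddTorus (Fin d) → UnitAddTorus (Fin d) → EuclideanSpace ℝ (Fin d))
    (σ : ℝ) : (ℝ → C(Config N d, ℂ)) → (Fin N → Fin d → ℝ → C(Config N d, ℂ)) →
      (ℝ → C(Config N d, ℂ)) → Prop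
  | char (ζ : Fin N → Fin d → ℤ) : IsObservable K σ (fun _ => character ζ)
      (fun k a _ => -(2 * Real.pi * Complex.I * ζ k a) • character ζ) (fun _ => generator K σ ζ)
  | add {Ψ D G Ψ' D' G'} : IsObservable K σ Ψ D G → IsObservable K σ Ψ' D' G' →
      IsObservable K σ (fun t => Ψ t + Ψ' t) (fun k a t => D k a t + D' k a t)
        (fun t => G t + G' t)
  | smul {Ψ D G c c'} : Evolves c c' → IsObservable K σ Ψ D G →
      IsObservable K σ (fun t => c t • Ψ t) (fun k a t => c t • D k a t)
        (fun t => c t • G t + c' t • Ψ t)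

theorem IsObservable.evolves (hK : Continuous (Function.uncurry K))
    (hs : Summable (fun ξ : Fin 2 → Fin d → ℤ => ‖kernelCoefficient K ξ‖))
    {ρ₀ : UnitAddTorus (Fin d) → ℝ} {f : ℝ → Config N d → ℝ}
    (h : IsLiouvilleSolution K σ ρ₀ f) {Ψ : ℝ → C(Config N d, ℂ)}
    {D : Fin N → Fin d → ℝ → C(Config N d, ℂ)} {G : ℝ → C(Config N d, ℂ)}
    (ho : IsObservable K σ Ψ D G) :
    Evolves (fun t => expect (f t) (Ψ t)) fun t => expect (f t) (G t) := by
  induction ho with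
  | char ζ => exact evolves_expect_character hK hs h ζ
  | add _ _ ih ih' => simpa only [map_add] using ih.add ih'
  | smul hc _ ih =>
    simp only [map_add, map_smul, smul_eq_mul]
    exact (hc.mul ih).congr (fun _ _ => rfl) fun _ _ => add_comm _ _

theorem IsObservable.of_eq {Ψ Ψ' : ℝ → C(Config N d, ℂ)}
    {D D' : Fin N → Fin d → ℝ → C(Config N d, ℂ)} {G G' : ℝ → C(Config N d, ℂ)}
    (ho : IsObservable K σ Ψ D G) (hΨ : ∀ t, Ψ' t = Ψ t) (hD : ∀ k a t, D' k a t = D k a t)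
    (hG : ∀ t, G' t = G t) : IsObservable K σ Ψ' D' G' := by
  obtain rfl : Ψ' = Ψ := funext hΨ
  obtain rfl : D' = D := funext fun k => funext fun a => funext fun t => hD k a t
  obtain rfl : G' = G := funext hG
  exact ho

/-- The drift part is a derivation. In the second-order part, |ζ + ζ'|² = |ζ|² + |ζ'|² + 2 ζ·ζ', and
the cross term is 2σ times the product of the gradients, as each gradient carries a factor i. -/
theorem generator_add (ζ ζ' : Fin N → Fin d → ℤ) :
    character ζ * generator K σ ζ' + character ζ' * generator K σ ζ
      + (2 * σ : ℂ) • ∑ k, ∑ a, (-(2 * Real.pi * Complex.I * ζ k a) • character ζ) *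
        (-(2 * Real.pi * Complex.I * ζ' k a) • character ζ')
      = generator K σ (ζ + ζ') := by
  ext x
  simp only [generator, character_add, ContinuousMap.add_apply, ContinuousMap.mul_apply,
    ContinuousMap.smul_apply, ContinuousMap.sum_apply, smul_eq_mul, freqSq, Pi.add_apply]
  push_cast
  simp only [Finset.mul_sum, Finset.sum_mul, ← Finset.sum_neg_distrib, mul_add,
    ← Finset.sum_add_distrib]
  refine Finset.sum_congr rfl fun k _ => ?_
  refine Finset.sum_congr rfl fun a _ => ?_
  ring_nf
  simp only [Complex.I_sq]
  ring

/-- Itô's product rule. The asserted formula is bilinear and compatible with time-dependent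
coefficients, so a double induction reduces it to two characters, where it is `generator_add`. -/
theorem IsObservable.mul {Ψ Ψ' : ℝ → C(Config N d, ℂ)}
    {D D' : Fin N → Fin d → ℝ → C(Config N d, ℂ)} {G G' : ℝ → C(Config N d, ℂ)}
    (ho : IsObservable K σ Ψ D G) (ho' : IsObservable K σ Ψ' D' G') :
    IsObservable K σ (fun t => Ψ t * Ψ' t) (fun k a t => Ψ t * D' k a t + Ψ' t * D k a t)
      (fun t => Ψ t * G' t + Ψ' t * G t + (2 * σ : ℂ) • ∑ k, ∑ a, D k a t * D' k a t) := by
  induction ho with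
  | char ζ =>
    induction ho' with
    | char ζ' =>
      refine (IsObservable.char (ζ + ζ')).of_eq (fun t => (character_add _ _).symm)
        (fun k a t => ?_) fun t => generator_add ζ ζ'
      rw [character_add]
      ext x
      simp only [ContinuousMap.add_apply, ContinuousMap.mul_apply, ContinuousMap.smul_apply,
        smul_eq_mul, Pi.add_apply]
      push_cast
      ring
    | add _ _ ih ih' =>
      refine (ih.add ih').of_eq (fun t => mul_add _ _ _) (fun k a t => ?_) fun t => ?_ <;>
      · ext x
        simp only [ContinuousMap.add_apply, ContinuousMap.mul_apply, ContinuousMap.smul_apply,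
          ContinuousMap.sum_apply, smul_eq_mul, add_mul, mul_add, Finset.sum_add_distrib]
        ring
    | @smul Ψ D G c c' hc _ ih =>
      refine (ih.smul hc).of_eq (fun t => ?_) (fun k a t => ?_) fun t => ?_ <;> ext x <;>
        simp only [ContinuousMap.add_apply, ContinuousMap.mul_apply, ContinuousMap.smul_apply,
          ContinuousMap.sum_apply, smul_eq_mul]
      · ring
      · ring
      · have e : ∀ k a, -(2 * Real.pi * Complex.I * ζ k a) * character ζ x * (c t * D k a t x)
            = c t * (-(2 * Real.pi * Complex.I * ζ k a) * character ζ x * D k a t x) :=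
          fun k a => by ring
        simp only [e, ← Finset.mul_sum]
        ring
  | add _ _ ih ih' =>
    refine (ih.add ih').of_eq (fun t => add_mul _ _ _) (fun k a t => ?_) fun t => ?_ <;>
    · ext x
      simp only [ContinuousMap.add_apply, ContinuousMap.mul_apply, ContinuousMap.smul_apply,
        ContinuousMap.sum_apply, smul_eq_mul, add_mul, mul_add, Finset.sum_add_distrib]
      ring
  | @smul Ψ D G c c' hc _ ih =>
    refine (ih.smul hc).of_eq (fun t => ?_) (fun k a t => ?_) fun t => ?_ <;> ext x <;>
      simp only [ContinuousMap.add_apply, ContinuousMap.mul_apply, ContinuousMap.smul_apply,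
        ContinuousMap.sum_apply, smul_eq_mul]
    · ring
    · ring
    · simp only [mul_assoc, ← Finset.mul_sum]
      ring

theorem IsObservable.sum {ι : Type*} (s : Finset ι) {Ψ : ι → ℝ → C(Config N d, ℂ)}
    {D : ι → Fin N → Fin d → ℝ → C(Config N d, ℂ)} {G : ι → ℝ → C(Config N d, ℂ)}
    (h : ∀ i, IsObservable K σ (Ψ i) (D i) (G i)) :
    IsObservable K σ (fun t => ∑ i ∈ s, Ψ i t) (fun k a t => ∑ i ∈ s, D i k a t)
      (fun t => ∑ i ∈ s, G i t) := by
  classical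
  induction s using Finset.induction_on with
  | empty =>
    -- The zero observable is realised as zero times the trivial character.
    refine ((IsObservable.char 0).smul (evolves_const 0)).of_eq ?_ ?_ ?_ <;> intros <;> ext x <;>
      simp only [Finset.sum_empty, ContinuousMap.zero_apply, ContinuousMap.add_apply,
        ContinuousMap.smul_apply, smul_eq_mul, zero_mul, add_zero]
  | insert i s hi ih =>
    refine ((h i).add ih).of_eq ?_ ?_ ?_ <;> intros <;> rw [Finset.sum_insert hi]

end

/-! ### Fluctuations of the empirical measure -/

section

variable {N d : ℕ} {K : UnitAddTorus (Fin d) → UnitAddTorus (Fin d) → EuclideanSpace ℝ (Fin d)}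
  {σ : ℝ}

/-- The Fourier mode of the empirical measure. -/
def empiricalMode (N : ℕ) (ξ : Fin d → ℤ) : C(Config N d, ℂ) :=
  (N : ℂ)⁻¹ • ∑ k, character (Pi.single k ξ)

/-- The Fourier mode of the difference of the empirical measure and of `ρ`. -/
def fluctuation (N : ℕ) (ρ : UnitAddTorus (Fin d) → ℝ) (ξ : Fin d → ℤ) : C(Config N d, ℂ) :=
  empiricalMode N ξ - modes ρ ξ • 1

/-- The gradient of `fluctuation`. -/
def fluctuationGrad (N : ℕ) (ξ : Fin d → ℤ) (k : Fin N) (a : Fin d) : C(Config N d, ℂ) :=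
  ((N : ℂ)⁻¹ * -(2 * Real.pi * Complex.I * ξ a)) • character (Pi.single k ξ)

/-- The contribution of the mode `κ` of the kernel to `transportRemainder`. -/
def remainderTerm (N : ℕ) (ρ : UnitAddTorus (Fin d) → ℝ) (ξ : Fin d → ℤ)
    (κ : Fin 2 → Fin d → ℤ) : C(Config N d, ℂ) :=
  fluctuation N ρ (ξ - κ 0) * fluctuation N ρ (-(κ 1))
    + modes ρ (-(κ 1)) • fluctuation N ρ (ξ - κ 0) + modes ρ (ξ - κ 0) • fluctuation N ρ (-(κ 1))

/-- The difference of the transport terms for the empirical measure and for `ρ`. -/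
def transportRemainder (N : ℕ)
    (K : UnitAddTorus (Fin d) → UnitAddTorus (Fin d) → EuclideanSpace ℝ (Fin d))
    (ρ : UnitAddTorus (Fin d) → ℝ) (ξ : Fin d → ℤ) : C(Config N d, ℂ) :=
  ∑' κ, transportCoeff K ξ κ • remainderTerm N ρ ξ κ

theorem norm_empiricalMode_le (ξ : Fin d → ℤ) : ‖empiricalMode N ξ‖ ≤ 1 :=
  norm_average_le fun _ => norm_character_le _

theorem norm_empiricalMode_apply_le (ξ : Fin d → ℤ) (x : Config N d) :
    ‖empiricalMode N ξ x‖ ≤ 1 :=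
  ((empiricalMode N ξ).norm_coe_le_norm x).trans (norm_empiricalMode_le ξ)

theorem norm_modes_le_integral (ρ : UnitAddTorus (Fin d) → ℝ) (ξ : Fin d → ℤ) :
    ‖modes ρ ξ‖ ≤ ∫ x, |ρ x| := by
  refine (norm_integral_le_integral_norm _).trans (le_of_eq ?_)
  refine integral_congr_ae (Filter.Eventually.of_forall fun x => ?_)
  simp [norm_mFourier_apply]

theorem fluctuation_apply (ρ : UnitAddTorus (Fin d) → ℝ) (ξ : Fin d → ℤ) (x : Config N d) :
    fluctuation N ρ ξ x = empiricalMode N ξ x - modes ρ ξ := by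
  simp [fluctuation, ContinuousMap.sub_apply, ContinuousMap.smul_apply]

theorem norm_fluctuation_apply_le {ρ : UnitAddTorus (Fin d) → ℝ} (h : IsProbDensity ρ)
    (ξ : Fin d → ℤ) (x : Config N d) : ‖fluctuation N ρ ξ x‖ ≤ 2 := by
  rw [fluctuation_apply]
  refine (norm_sub_le _ _).trans ?_
  linarith [norm_empiricalMode_apply_le ξ x, norm_modes_le h ξ]

theorem modes_neg (ρ : UnitAddTorus (Fin d) → ℝ) (ξ : Fin d → ℤ) :
    modes ρ (-ξ) = (starRingEnd ℂ) (modes ρ ξ) := by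
  rw [modes, modes, ← integral_conj]
  refine integral_congr_ae (Filter.Eventually.of_forall fun x => ?_)
  simp only [map_mul, Complex.conj_ofReal, UnitAddTorus.mFourier_neg]

theorem empiricalMode_apply (ξ : Fin d → ℤ) (x : Config N d) :
    empiricalMode N ξ x = (N : ℂ)⁻¹ * ∑ k, UnitAddTorus.mFourier (-ξ) (x k) := by
  simp only [empiricalMode, ContinuousMap.smul_apply, ContinuousMap.sum_apply, smul_eq_mul,
    character_single]

theorem fluctuation_neg_apply (ρ : UnitAddTorus (Fin d) → ℝ) (ξ : Fin d → ℤ) (x : Config N d) :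
    fluctuation N ρ (-ξ) x = (starRingEnd ℂ) (fluctuation N ρ ξ x) := by
  simp only [fluctuation_apply, empiricalMode_apply, modes_neg, map_sub, map_mul, map_inv₀,
    map_sum, Complex.conj_natCast, UnitAddTorus.mFourier_neg]

/-- Expansion of a product about its limit: with empirical mode = F + ρ̂, what is left after
removing the constant part has at least one factor F in each term. -/
theorem remainderTerm_eq (ρ : UnitAddTorus (Fin d) → ℝ) (ξ : Fin d → ℤ)
    (κ : Fin 2 → Fin d → ℤ) :
    remainderTerm N ρ ξ κ = empiricalMode N (ξ - κ 0) * empiricalMode N (-(κ 1))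
      - (modes ρ (ξ - κ 0) * modes ρ (-(κ 1))) • 1 := by
  ext x
  simp only [remainderTerm, ContinuousMap.add_apply, ContinuousMap.sub_apply,
    ContinuousMap.mul_apply, ContinuousMap.smul_apply, fluctuation_apply, smul_eq_mul,
    ContinuousMap.one_apply]
  ring

/-- The averaged drift is an exact quadratic expression in the empirical modes, with no diagonal
correction, because the sum over l includes l = k. -/
theorem hasSum_empiricalMode_transport
    (hs : Summable (fun ξ : Fin 2 → Fin d → ℤ => ‖kernelCoefficient K ξ‖)) (ξ : Fin d → ℤ) :
    HasSum (fun κ => transportCoeff K ξ κ •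
      (empiricalMode N (ξ - κ 0) * empiricalMode N (-(κ 1))))
      ((N : ℂ)⁻¹ • ∑ k, ∑ a, -(2 * Real.pi * Complex.I * ξ a) •
        (drift N K k a * character (Pi.single k ξ))) := by
  have h := (hasSum_sum (s := Finset.univ) fun k _ =>
    hasSum_drift_mul_character hs k ξ (Pi.single k ξ : Fin N → Fin d → ℤ)).const_smul ((N : ℂ)⁻¹)
  refine h.congr_fun fun κ => ?_
  ext x
  simp only [ContinuousMap.mul_apply, ContinuousMap.smul_apply, ContinuousMap.sum_apply,
    smul_eq_mul, empiricalMode_apply, character_sub_single, character_single, neg_neg,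
    mFourier_sub_mul, ← Finset.mul_sum]
  rw [← Finset.sum_mul]
  ring

theorem summable_transportCoeff_mul_modes
    (hs : Summable (fun ξ : Fin 2 → Fin d → ℤ => ‖kernelCoefficient K ξ‖))
    (ρ : UnitAddTorus (Fin d) → ℝ) (ξ : Fin d → ℤ) :
    Summable fun κ => transportCoeff K ξ κ * (modes ρ (ξ - κ 0) * modes ρ (-(κ 1))) := by
  refine Summable.of_norm_bounded ((summable_transportCoeff hs ξ).mul_right
    ((∫ x, |ρ x|) * ∫ x, |ρ x|)) fun κ => ?_
  rw [norm_mul, norm_mul]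
  gcongr <;> exact norm_modes_le_integral _ _

theorem hasSum_transportRemainder
    (hs : Summable (fun ξ : Fin 2 → Fin d → ℤ => ‖kernelCoefficient K ξ‖))
    (ρ : UnitAddTorus (Fin d) → ℝ) (ξ : Fin d → ℤ) :
    HasSum (fun κ => transportCoeff K ξ κ • remainderTerm N ρ ξ κ) (transportRemainder N K ρ ξ) ∧
    transportRemainder N K ρ ξ = (N : ℂ)⁻¹ • ∑ k, ∑ a, -(2 * Real.pi * Complex.I * ξ a) •
        (drift N K k a * character (Pi.single k ξ))
      - (∑' κ, transportCoeff K ξ κ * (modes ρ (ξ - κ 0) * modes ρ (-(κ 1)))) • 1 := by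
  have h1 := hasSum_empiricalMode_transport (N := N) hs ξ
  have h2 := (summable_transportCoeff_mul_modes hs ρ ξ).hasSum.smul_const (1 : C(Config N d, ℂ))
  have h3 : HasSum (fun κ => transportCoeff K ξ κ • remainderTerm N ρ ξ κ) _ :=
    (h1.sub h2).congr_fun fun κ => by
      rw [remainderTerm_eq]
      ext x
      simp only [ContinuousMap.sub_apply, ContinuousMap.smul_apply, smul_eq_mul,
        ContinuousMap.one_apply]
      ring
  exact ⟨h3.summable.hasSum, h3.tsum_eq⟩

/-- F is linear in the empirical measure, so no noise correction appears. Subtracting the equation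
of ρ̂ leaves the common damping and the difference of the two transport terms. -/
theorem isObservable_fluctuation (hK : Continuous (Function.uncurry K))
    (hs : Summable (fun ξ : Fin 2 → Fin d → ℤ => ‖kernelCoefficient K ξ‖))
    {ρ₀ : UnitAddTorus (Fin d) → ℝ} {ρ : ℝ → UnitAddTorus (Fin d) → ℝ}
    (h : IsMcKeanVlasovSolution K σ ρ₀ ρ) (ξ : Fin d → ℤ) :
    IsObservable K σ (fun t => fluctuation N (ρ t) ξ) (fun k a _ => fluctuationGrad N ξ k a)
      (fun t => -((4 * Real.pi ^ 2 * σ * freqSq ξ : ℝ) : ℂ) • fluctuation N (ρ t) ξ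
        + transportRemainder N K (ρ t) ξ) := by
  have h1 := (IsObservable.sum (K := K) (σ := σ) Finset.univ fun k : Fin N =>
    IsObservable.char (Pi.single k ξ : Fin N → Fin d → ℤ)).smul (evolves_const (N : ℂ)⁻¹)
  have h2 := (IsObservable.char (K := K) (σ := σ) (0 : Fin N → Fin d → ℤ)).smul
    (evolves_modes hK hs h ξ).neg
  have hsq : ∀ k : Fin N, ∑ k', freqSq ((Pi.single k ξ : Fin N → Fin d → ℤ) k') = freqSq ξ := by
    intro k
    rw [Finset.sum_eq_single k]
    · simp
    · intro j _ hj
      simp [Pi.single_eq_of_ne hj, freqSq]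
    · simp
  have hdr : ∀ k : Fin N, ∀ x, ∑ k', ∑ a, -(2 * Real.pi * Complex.I *
      ((Pi.single k ξ : Fin N → Fin d → ℤ) k' a : ℤ)) *
      (drift N K k' a x * character (Pi.single k ξ : Fin N → Fin d → ℤ) x)
      = ∑ a, -(2 * Real.pi * Complex.I * ξ a) *
        (drift N K k a x * character (Pi.single k ξ : Fin N → Fin d → ℤ) x) := by
    intro k x
    rw [Finset.sum_eq_single k]
    · simp
    · intro j _ hj
      simp [Pi.single_eq_of_ne hj]
    · simp
  refine (h1.add h2).of_eq (fun t => ?_) (fun k a t => ?_) fun t => ?_ <;> ext x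
  · simp only [ContinuousMap.add_apply, ContinuousMap.smul_apply, ContinuousMap.sum_apply,
      smul_eq_mul, fluctuation_apply, empiricalMode_apply, character_zero, ContinuousMap.one_apply,
      character_single]
    ring
  · simp only [fluctuationGrad, ContinuousMap.add_apply, ContinuousMap.smul_apply,
      ContinuousMap.sum_apply, smul_eq_mul]
    rw [Finset.sum_eq_single k]
    · simp
      ring
    · intro j _ hj
      simp [Pi.single_eq_of_ne hj.symm]
    · simp
  · rw [(hasSum_transportRemainder hs (ρ t) ξ).2]
    simp only [generator, hsq, ContinuousMap.add_apply, ContinuousMap.sub_apply,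
      ContinuousMap.smul_apply, ContinuousMap.mul_apply,
      ContinuousMap.sum_apply, smul_eq_mul, fluctuation_apply, hdr, character_zero,
      ContinuousMap.one_apply]
    simp only [empiricalMode_apply, character_single, Finset.sum_add_distrib, ← Finset.mul_sum]
    simp [freqSq]
    ring

/-- The Euclidean inner product of two frequencies. -/
def freqInner (ξ ξ' : Fin d → ℤ) : ℝ := ∑ a, (ξ a : ℝ) * ξ' a

/-- Each of the N particles contributes N⁻² times a character of frequency ξ + ξ'. One factor N⁻¹
survives as the strength of the noise, the other makes an empirical mode. -/
theorem sum_fluctuationGrad_mul (ξ ξ' : Fin d → ℤ) :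
    ∑ k, ∑ a, fluctuationGrad N ξ k a * fluctuationGrad N ξ' k a
      = ((-(4 * Real.pi ^ 2 * (N : ℝ)⁻¹ * freqInner ξ ξ') : ℝ) : ℂ) • empiricalMode N (ξ + ξ') := by
  ext x
  simp only [fluctuationGrad, ContinuousMap.smul_apply, ContinuousMap.mul_apply,
    ContinuousMap.sum_apply, smul_eq_mul, empiricalMode_apply, character_single, freqInner,
    neg_add, UnitAddTorus.mFourier_add]
  have key : ∀ A B : ℂ, ∑ a, (N : ℂ)⁻¹ * -(2 * Real.pi * Complex.I * ξ a) * A *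
      ((N : ℂ)⁻¹ * -(2 * Real.pi * Complex.I * ξ' a) * B)
      = -(4 * Real.pi ^ 2 * (N : ℂ)⁻¹ * ∑ a, (ξ a : ℂ) * ξ' a) * (N : ℂ)⁻¹ * (A * B) := by
    intro A B
    simp only [Finset.mul_sum, Finset.sum_mul, ← Finset.sum_neg_distrib]
    refine Finset.sum_congr rfl fun a _ => ?_
    ring_nf
    simp only [Complex.I_sq]
    ring
  simp only [key, ← Finset.mul_sum]
  push_cast
  ring

theorem two_mul_abs_freqInner_le (ξ ξ' : Fin d → ℤ) :
    2 * |freqInner ξ ξ'| ≤ freqSq ξ + freqSq ξ' := by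
  unfold freqInner freqSq
  rw [← Finset.sum_add_distrib]
  refine (mul_le_mul_of_nonneg_left (Finset.abs_sum_le_sum_abs _ _) zero_le_two).trans ?_
  rw [Finset.mul_sum]
  refine Finset.sum_le_sum fun a _ => ?_
  rw [abs_mul, ← sq_abs (ξ a : ℝ), ← sq_abs (ξ' a : ℝ)]
  nlinarith [sq_nonneg (|(ξ a : ℝ)| - |(ξ' a : ℝ)|)]

theorem freqSq_neg (ξ : Fin d → ℤ) : freqSq (-ξ) = freqSq ξ := by simp [freqSq]

end

/-! ### Moment inequalities at fixed time and evolution of products of fluctuations -/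

section

variable {N d : ℕ} {K : UnitAddTorus (Fin d) → UnitAddTorus (Fin d) → EuclideanSpace ℝ (Fin d)}
  {σ : ℝ}

theorem norm_expect_le {h : Config N d → ℝ} (hh : IsProbDensity h) {Φ : C(Config N d, ℂ)} {c : ℝ}
    (hΦ : ∀ x, ‖Φ x‖ ≤ c) : ‖expect h Φ‖ ≤ c := by
  have := norm_expect_le_re hh (Ψ := (c : ℂ) • 1) (Φ := Φ) fun x => by
    simpa [ContinuousMap.smul_apply] using hΦ x
  rwa [map_smul, expect_one hh, smul_eq_mul, mul_one, Complex.ofReal_re] at this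

theorem norm_expect_le_sum {h : Config N d → ℝ} (hh : IsProbDensity h) {n : ℕ} {c : Fin n → ℝ}
    (hc : ∀ i, 0 ≤ c i) {Φ : C(Config N d, ℂ)} {Ψ : Fin n → C(Config N d, ℂ)} {M : ℝ}
    (hle : ∀ x, ‖Φ x‖ ≤ ∑ i, c i * (Ψ i x).re) (hM : ∀ i, ‖expect h (Ψ i)‖ ≤ M) :
    ‖expect h Φ‖ ≤ (∑ i, c i) * M := by
  have := norm_expect_le_re hh (Ψ := ∑ i, (c i : ℂ) • Ψ i) (Φ := Φ) fun x => by
    refine (hle x).trans (le_of_eq ?_)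
    simp only [ContinuousMap.sum_apply, ContinuousMap.smul_apply, smul_eq_mul, Complex.re_sum,
      Complex.re_ofReal_mul]
  refine this.trans ?_
  simp only [map_sum, map_smul, smul_eq_mul, Complex.re_sum, Complex.re_ofReal_mul]
  rw [Finset.sum_mul]
  exact Finset.sum_le_sum fun i _ => mul_le_mul_of_nonneg_left
    ((Complex.re_le_norm _).trans (hM i)) (hc i)

section Static

variable {h : Config N d → ℝ} {ρ : UnitAddTorus (Fin d) → ℝ}

/-- The squared modulus of a mode of the fluctuations. -/
def fluctuationSq (N : ℕ) (ρ : UnitAddTorus (Fin d) → ℝ) (ξ : Fin d → ℤ) : C(Config N d, ℂ) :=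
  fluctuation N ρ ξ * fluctuation N ρ (-ξ)

theorem fluctuationSq_apply_re (ξ : Fin d → ℤ) (x : Config N d) :
    (fluctuationSq N ρ ξ x).re = ‖fluctuation N ρ ξ x‖ ^ 2 := by
  rw [fluctuationSq, ContinuousMap.mul_apply, fluctuation_neg_apply, Complex.mul_conj,
    Complex.ofReal_re, Complex.normSq_eq_norm_sq]

theorem fluctuationSq_mul_self_apply_re (ξ : Fin d → ℤ) (x : Config N d) :
    ((fluctuationSq N ρ ξ * fluctuationSq N ρ ξ) x).re = ‖fluctuation N ρ ξ x‖ ^ 4 := by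
  rw [fluctuationSq, ContinuousMap.mul_apply, ContinuousMap.mul_apply, fluctuation_neg_apply,
    Complex.mul_conj, ← Complex.ofReal_mul, Complex.ofReal_re, Complex.normSq_eq_norm_sq]
  ring

/-- One factor of the quadratic term is bounded by 2. This makes the transport linear in the
fluctuations at the price of a constant that the damping absorbs, so that even moments close without
involving higher ones. -/
theorem norm_remainderTerm_apply_le (hρ : IsProbDensity ρ) (ξ : Fin d → ℤ)
    (κ : Fin 2 → Fin d → ℤ) (x : Config N d) :
    ‖remainderTerm N ρ ξ κ x‖
      ≤ 3 * ‖fluctuation N ρ (ξ - κ 0) x‖ + ‖fluctuation N ρ (-(κ 1)) x‖ := by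
  simp only [remainderTerm, ContinuousMap.add_apply, ContinuousMap.mul_apply,
    ContinuousMap.smul_apply, smul_eq_mul]
  refine (norm_add₃_le).trans ?_
  simp only [norm_mul]
  have h1 := norm_fluctuation_apply_le hρ (-(κ 1)) x
  have h2 := norm_modes_le hρ (-(κ 1))
  have h3 := norm_modes_le hρ (ξ - κ 0)
  have n1 := norm_nonneg (fluctuation N ρ (ξ - κ 0) x)
  have n2 := norm_nonneg (fluctuation N ρ (-(κ 1)) x)
  nlinarith

theorem norm_expect_mul_le (hh : IsProbDensity h) {M : ℝ}
    (hM : ∀ ξ, ‖expect h (fluctuationSq N ρ ξ)‖ ≤ M) {ξ ξ' : Fin d → ℤ} {Φ : C(Config N d, ℂ)}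
    (hΦ : ∀ x, ‖Φ x‖ ≤ ‖fluctuation N ρ ξ x‖ * ‖fluctuation N ρ ξ' x‖) :
    ‖expect h Φ‖ ≤ M := by
  have := norm_expect_le_sum hh (c := ![1 / 2, 1 / 2]) (Φ := Φ)
    (Ψ := ![fluctuationSq N ρ ξ, fluctuationSq N ρ ξ']) (M := M)
    (by intro i; fin_cases i <;> norm_num)
    (fun x => by
      simp only [Fin.sum_univ_two, Matrix.cons_val_zero, Matrix.cons_val_one,
        fluctuationSq_apply_re]
      nlinarith [hΦ x, sq_nonneg (‖fluctuation N ρ ξ x‖ - ‖fluctuation N ρ ξ' x‖)])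
    (by intro i; fin_cases i <;> exact hM _)
  simpa only [Fin.sum_univ_two, Matrix.cons_val_zero, Matrix.cons_val_one, add_halves,
    one_mul] using this

theorem mul_four_le (a b c d : ℝ) : a * b * c * d ≤ (a ^ 4 + b ^ 4 + c ^ 4 + d ^ 4) / 4 := by
  nlinarith [sq_nonneg (a * b - c * d), sq_nonneg (a ^ 2 - b ^ 2), sq_nonneg (c ^ 2 - d ^ 2)]

theorem norm_expect_mul_four_le (hh : IsProbDensity h) {M : ℝ}
    (hM : ∀ ξ, ‖expect h (fluctuationSq N ρ ξ * fluctuationSq N ρ ξ)‖ ≤ M)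
    (ξ : Fin 4 → Fin d → ℤ) {Φ : C(Config N d, ℂ)}
    (hΦ : ∀ x, ‖Φ x‖ ≤ ‖fluctuation N ρ (ξ 0) x‖ * ‖fluctuation N ρ (ξ 1) x‖ *
      ‖fluctuation N ρ (ξ 2) x‖ * ‖fluctuation N ρ (ξ 3) x‖) :
    ‖expect h Φ‖ ≤ M := by
  have := norm_expect_le_sum hh (c := fun _ : Fin 4 => (1 / 4 : ℝ)) (Φ := Φ)
    (Ψ := fun i => fluctuationSq N ρ (ξ i) * fluctuationSq N ρ (ξ i)) (M := M)
    (by intro i; norm_num)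
    (fun x => by
      simp only [Fin.sum_univ_four, fluctuationSq_mul_self_apply_re]
      refine (hΦ x).trans ((mul_four_le _ _ _ _).trans (le_of_eq ?_))
      ring)
    (fun i => hM _)
  simpa using this

theorem norm_expect_mul_remainderTerm_le (hh : IsProbDensity h) (hρ : IsProbDensity ρ) {M : ℝ}
    (hM : ∀ ξ, ‖expect h (fluctuationSq N ρ ξ)‖ ≤ M) (ξ' ξ : Fin d → ℤ)
    (κ : Fin 2 → Fin d → ℤ) :
    ‖expect h (fluctuation N ρ ξ' * remainderTerm N ρ ξ κ)‖ ≤ 4 * M := by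
  -- Weights from a(3b + c) ≤ 3(a² + b²)/2 + (a² + c²)/2; their sum is 4.
  have := norm_expect_le_sum hh (c := ![2, 3 / 2, 1 / 2])
    (Φ := fluctuation N ρ ξ' * remainderTerm N ρ ξ κ)
    (Ψ := ![fluctuationSq N ρ ξ', fluctuationSq N ρ (ξ - κ 0), fluctuationSq N ρ (-(κ 1))])
    (M := M) (by intro i; fin_cases i <;> norm_num)
    (fun x => by
      simp only [Fin.sum_univ_three, Matrix.cons_val_zero, Matrix.cons_val_one, Matrix.cons_val,
        fluctuationSq_apply_re, ContinuousMap.mul_apply, norm_mul]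
      have h1 := mul_le_mul_of_nonneg_left (norm_remainderTerm_apply_le hρ ξ κ x)
        (norm_nonneg (fluctuation N ρ ξ' x))
      nlinarith [sq_nonneg (‖fluctuation N ρ ξ' x‖ - ‖fluctuation N ρ (ξ - κ 0) x‖),
        sq_nonneg (‖fluctuation N ρ ξ' x‖ - ‖fluctuation N ρ (-(κ 1)) x‖)])
    (by intro i; fin_cases i <;> exact hM _)
  refine this.trans (le_of_eq ?_)
  simp [Fin.sum_univ_three]
  norm_num

theorem norm_expect_mul_three_remainderTerm_le (hh : IsProbDensity h) (hρ : IsProbDensity ρ)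
    {M : ℝ} (hM : ∀ ξ, ‖expect h (fluctuationSq N ρ ξ * fluctuationSq N ρ ξ)‖ ≤ M)
    (ξ₁ ξ₂ ξ₃ ξ : Fin d → ℤ) (κ : Fin 2 → Fin d → ℤ) :
    ‖expect h (fluctuation N ρ ξ₁ * fluctuation N ρ ξ₂ * fluctuation N ρ ξ₃ *
      remainderTerm N ρ ξ κ)‖ ≤ 4 * M := by
  let η : Fin 5 → Fin d → ℤ := ![ξ₁, ξ₂, ξ₃, ξ - κ 0, -(κ 1)]
  -- Weights from applying `mul_four_le` to the two products in abc(3d + e); their sum is again 4.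
  have := norm_expect_le_sum hh (c := ![1, 1, 1, 3 / 4, 1 / 4])
    (Φ := fluctuation N ρ ξ₁ * fluctuation N ρ ξ₂ * fluctuation N ρ ξ₃ * remainderTerm N ρ ξ κ)
    (Ψ := fun i => fluctuationSq N ρ (η i) * fluctuationSq N ρ (η i))
    (M := M) (by intro i; fin_cases i <;> norm_num)
    (fun x => by
      simp only [Fin.sum_univ_five, fluctuationSq_mul_self_apply_re]
      simp only [Matrix.cons_val_zero, Matrix.cons_val_one, Matrix.cons_val,
        ContinuousMap.mul_apply, norm_mul, η]
      have h1 := mul_le_mul_of_nonneg_left (norm_remainderTerm_apply_le hρ ξ κ x)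
        (mul_nonneg (mul_nonneg (norm_nonneg (fluctuation N ρ ξ₁ x))
          (norm_nonneg (fluctuation N ρ ξ₂ x))) (norm_nonneg (fluctuation N ρ ξ₃ x)))
      have h2 := mul_four_le ‖fluctuation N ρ ξ₁ x‖ ‖fluctuation N ρ ξ₂ x‖
        ‖fluctuation N ρ ξ₃ x‖ ‖fluctuation N ρ (ξ - κ 0) x‖
      have h3 := mul_four_le ‖fluctuation N ρ ξ₁ x‖ ‖fluctuation N ρ ξ₂ x‖
        ‖fluctuation N ρ ξ₃ x‖ ‖fluctuation N ρ (-(κ 1)) x‖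
      linarith)
    (fun i => hM _)
  refine this.trans (le_of_eq ?_)
  simp [Fin.sum_univ_five]
  norm_num

end Static

/-- The coefficient of the correlation of two modes created by the noise. -/
def noiseCoeff (N : ℕ) (σ : ℝ) (ξ ξ' : Fin d → ℤ) : ℂ :=
  ((-(2 * (4 * Real.pi ^ 2 * σ) * (N : ℝ)⁻¹ * freqInner ξ ξ') : ℝ) : ℂ)

theorem norm_noiseCoeff_le (hσ : 0 ≤ σ) (ξ ξ' : Fin d → ℤ) :
    ‖noiseCoeff N σ ξ ξ'‖ ≤ 4 * Real.pi ^ 2 * σ * (freqSq ξ + freqSq ξ') / N := by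
  rw [noiseCoeff, Complex.norm_real, norm_neg, Real.norm_eq_abs, abs_mul,
    abs_of_nonneg (by positivity)]
  calc _ = 4 * Real.pi ^ 2 * σ * (N : ℝ)⁻¹ * (2 * |freqInner ξ ξ'|) := by ring
    _ ≤ 4 * Real.pi ^ 2 * σ * (N : ℝ)⁻¹ * (freqSq ξ + freqSq ξ') :=
        mul_le_mul_of_nonneg_left (two_mul_abs_freqInner_le ξ ξ') (by positivity)
    _ = _ := by ring

theorem sum_fluctuationGrad_mul_apply (ξ ξ' : Fin d → ℤ) (x : Config N d) :
    (2 * σ : ℂ) * ∑ k, ∑ a, fluctuationGrad N ξ k a x * fluctuationGrad N ξ' k a x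
      = noiseCoeff N σ ξ ξ' * empiricalMode N (ξ + ξ') x := by
  have := congrArg (fun Φ : C(Config N d, ℂ) => Φ x) (sum_fluctuationGrad_mul (N := N) ξ ξ')
  simp only [ContinuousMap.smul_apply, ContinuousMap.mul_apply, ContinuousMap.sum_apply,
    smul_eq_mul] at this
  rw [this, noiseCoeff]
  push_cast
  ring

/-- The standing assumptions: `f` solves the Liouville equation, `ρ` the McKean-Vlasov equation, and
the diffusivity is large. -/
structure IsDiffusive (K : UnitAddTorus (Fin d) → UnitAddTorus (Fin d) → EuclideanSpace ℝ (Fin d))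
    (σ : ℝ) (ρ₀ : UnitAddTorus (Fin d) → ℝ) (ρ : ℝ → UnitAddTorus (Fin d) → ℝ)
    (f : ℝ → Config N d → ℝ) : Prop where
  continuous : Continuous (Function.uncurry K)
  summable : Summable fun ξ : Fin 2 → Fin d → ℤ => ‖kernelCoefficient K ξ‖
  limit : IsMcKeanVlasovSolution K σ ρ₀ ρ
  particles : IsLiouvilleSolution K σ ρ₀ f
  initial : IsProbDensity ρ₀
  pos : N ≠ 0
  large : 100 * (2 * Real.pi * ∑' ξ : Fin 2 → Fin d → ℤ, ‖kernelCoefficient K ξ‖)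
    ≤ 4 * Real.pi ^ 2 * σ

section Dynamic

variable {ρ₀ : UnitAddTorus (Fin d) → ℝ} {ρ : ℝ → UnitAddTorus (Fin d) → ℝ}
  {f : ℝ → Config N d → ℝ}

theorem IsDiffusive.nonneg (S : IsDiffusive K σ ρ₀ ρ f) : 0 ≤ σ := by
  have h1 : 0 ≤ ∑' ξ : Fin 2 → Fin d → ℤ, ‖kernelCoefficient K ξ‖ :=
    tsum_nonneg fun _ => norm_nonneg _
  have h2 := S.large
  have h3 : 0 ≤ 4 * Real.pi ^ 2 * σ := le_trans (by positivity) h2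
  exact nonneg_of_mul_nonneg_right h3 (by positivity)

/-- Here the diffusivity wins: relative to the damping rate of the mode ξ, transport costs one
hundredth of a uniform bound on the quantities transported. -/
theorem IsDiffusive.tsum_transport_le (S : IsDiffusive K σ ρ₀ ρ f) (ξ : Fin d → ℤ)
    {X : (Fin 2 → Fin d → ℤ) → ℂ} {B : ℝ} (hX : ∀ κ, ‖X κ‖ ≤ B) :
    ‖∑' κ, transportCoeff K ξ κ * X κ‖ ≤ 4 * Real.pi ^ 2 * σ * freqSq ξ * (B / 100) := by
  have hB : 0 ≤ B := (norm_nonneg _).trans (hX 0)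
  have h1 : HasSum (fun κ => 2 * Real.pi * freqSq ξ * ‖kernelCoefficient K κ‖ * B) _ :=
    (S.summable.hasSum.mul_left (2 * Real.pi * freqSq ξ)).mul_right B
  refine (tsum_of_norm_bounded h1 fun κ => ?_).trans ?_
  · rw [norm_mul]
    exact mul_le_mul (norm_transportCoeff_le K ξ κ) (hX κ) (norm_nonneg _)
      (mul_nonneg (mul_nonneg (by positivity) (freqSq_nonneg ξ)) (norm_nonneg _))
  · have := mul_le_mul_of_nonneg_right S.large (mul_nonneg (freqSq_nonneg ξ) hB)
    linarith

theorem IsDiffusive.expect_mul_transportRemainder (S : IsDiffusive K σ ρ₀ ρ f) (h : Config N d → ℝ)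
    (r : UnitAddTorus (Fin d) → ℝ) (Θ : C(Config N d, ℂ)) (ξ : Fin d → ℤ) :
    expect h (Θ * transportRemainder N K r ξ)
      = ∑' κ, transportCoeff K ξ κ * expect h (Θ * remainderTerm N r ξ κ) := by
  have h1 := (((hasSum_transportRemainder (N := N) S.summable r ξ).1).mul_left Θ).mapL (expect h)
  rw [← h1.tsum_eq]
  refine tsum_congr fun κ => ?_
  have e : Θ * transportCoeff K ξ κ • remainderTerm N r ξ κ
      = transportCoeff K ξ κ • (Θ * remainderTerm N r ξ κ) := by
    ext x
    simp only [ContinuousMap.mul_apply, ContinuousMap.smul_apply, smul_eq_mul]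
    ring
  rw [e, map_smul, smul_eq_mul]

theorem IsDiffusive.norm_expect_mul_transportRemainder_le (S : IsDiffusive K σ ρ₀ ρ f)
    {h : Config N d → ℝ} (r : UnitAddTorus (Fin d) → ℝ) (Θ : C(Config N d, ℂ)) (ξ : Fin d → ℤ)
    {B : ℝ} (hB : ∀ κ, ‖expect h (Θ * remainderTerm N r ξ κ)‖ ≤ B) :
    ‖expect h (Θ * transportRemainder N K r ξ)‖ ≤ 4 * Real.pi ^ 2 * σ * freqSq ξ * (B / 100) := by
  rw [S.expect_mul_transportRemainder]
  exact S.tsum_transport_le ξ hB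

theorem IsDiffusive.isObservable_pair (S : IsDiffusive K σ ρ₀ ρ f) (ξ₁ ξ₂ : Fin d → ℤ) :
    IsObservable K σ (fun t => fluctuation N (ρ t) ξ₁ * fluctuation N (ρ t) ξ₂)
      (fun k a t => fluctuation N (ρ t) ξ₁ * fluctuationGrad N ξ₂ k a
        + fluctuation N (ρ t) ξ₂ * fluctuationGrad N ξ₁ k a)
      (fun t => -((4 * Real.pi ^ 2 * σ * (freqSq ξ₁ + freqSq ξ₂) : ℝ) : ℂ) •
          (fluctuation N (ρ t) ξ₁ * fluctuation N (ρ t) ξ₂)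
        + (fluctuation N (ρ t) ξ₁ * transportRemainder N K (ρ t) ξ₂
          + fluctuation N (ρ t) ξ₂ * transportRemainder N K (ρ t) ξ₁)
        + noiseCoeff N σ ξ₁ ξ₂ • empiricalMode N (ξ₁ + ξ₂)) := by
  have h := fun ξ => isObservable_fluctuation (N := N) S.continuous S.summable S.limit ξ
  refine ((h ξ₁).mul (h ξ₂)).of_eq (fun t => rfl) (fun k a t => rfl) fun t => ?_
  ext x
  simp only [ContinuousMap.add_apply, ContinuousMap.mul_apply, ContinuousMap.smul_apply,
    ContinuousMap.sum_apply, smul_eq_mul, sum_fluctuationGrad_mul_apply]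
  push_cast
  ring

/-- The product rule applied to a pair and a single mode. Each pair of factors meets once in the
noise and is replaced by an empirical mode. The gradient is left existential because the moment
bounds do not need it. -/
theorem IsDiffusive.isObservable_triple (S : IsDiffusive K σ ρ₀ ρ f) (ξ₁ ξ₂ ξ₃ : Fin d → ℤ) :
    ∃ D, IsObservable K σ
      (fun t => fluctuation N (ρ t) ξ₁ * fluctuation N (ρ t) ξ₂ * fluctuation N (ρ t) ξ₃) D
      (fun t => -((4 * Real.pi ^ 2 * σ * (freqSq ξ₁ + freqSq ξ₂ + freqSq ξ₃) : ℝ) : ℂ) •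
          (fluctuation N (ρ t) ξ₁ * fluctuation N (ρ t) ξ₂ * fluctuation N (ρ t) ξ₃)
        + (fluctuation N (ρ t) ξ₁ * fluctuation N (ρ t) ξ₂ * transportRemainder N K (ρ t) ξ₃
          + fluctuation N (ρ t) ξ₁ * fluctuation N (ρ t) ξ₃ * transportRemainder N K (ρ t) ξ₂
          + fluctuation N (ρ t) ξ₂ * fluctuation N (ρ t) ξ₃ * transportRemainder N K (ρ t) ξ₁)
        + (noiseCoeff N σ ξ₁ ξ₂ • (fluctuation N (ρ t) ξ₃ * empiricalMode N (ξ₁ + ξ₂))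
          + noiseCoeff N σ ξ₁ ξ₃ • (fluctuation N (ρ t) ξ₂ * empiricalMode N (ξ₁ + ξ₃))
          + noiseCoeff N σ ξ₂ ξ₃ • (fluctuation N (ρ t) ξ₁ * empiricalMode N (ξ₂ + ξ₃)))) := by
  have h := isObservable_fluctuation (N := N) S.continuous S.summable S.limit ξ₃
  refine ⟨_, ((S.isObservable_pair ξ₁ ξ₂).mul h).of_eq (fun t => rfl) (fun k a t => rfl)
    fun t => ?_⟩
  ext x
  have e : (2 * σ : ℂ) * ∑ k, ∑ a, (fluctuation N (ρ t) ξ₁ x * fluctuationGrad N ξ₂ k a x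
      + fluctuation N (ρ t) ξ₂ x * fluctuationGrad N ξ₁ k a x) * fluctuationGrad N ξ₃ k a x
      = fluctuation N (ρ t) ξ₁ x * (noiseCoeff N σ ξ₂ ξ₃ * empiricalMode N (ξ₂ + ξ₃) x)
        + fluctuation N (ρ t) ξ₂ x * (noiseCoeff N σ ξ₁ ξ₃ * empiricalMode N (ξ₁ + ξ₃) x) := by
    simp only [← sum_fluctuationGrad_mul_apply, add_mul, Finset.sum_add_distrib, mul_assoc,
      ← Finset.mul_sum]
    ring
  simp only [ContinuousMap.add_apply, ContinuousMap.mul_apply, ContinuousMap.smul_apply,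
    ContinuousMap.sum_apply, smul_eq_mul, e]
  push_cast
  ring

theorem IsDiffusive.isObservable_four (S : IsDiffusive K σ ρ₀ ρ f) (ξ₁ ξ₂ ξ₃ ξ₄ : Fin d → ℤ) :
    ∃ D, IsObservable K σ
      (fun t => fluctuation N (ρ t) ξ₁ * fluctuation N (ρ t) ξ₂ *
        (fluctuation N (ρ t) ξ₃ * fluctuation N (ρ t) ξ₄)) D
      (fun t => -((4 * Real.pi ^ 2 * σ * (freqSq ξ₁ + freqSq ξ₂ + freqSq ξ₃ + freqSq ξ₄) : ℝ) :
          ℂ) • (fluctuation N (ρ t) ξ₁ * fluctuation N (ρ t) ξ₂ *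
            (fluctuation N (ρ t) ξ₃ * fluctuation N (ρ t) ξ₄))
        + (fluctuation N (ρ t) ξ₁ * fluctuation N (ρ t) ξ₂ * fluctuation N (ρ t) ξ₃ *
            transportRemainder N K (ρ t) ξ₄
          + fluctuation N (ρ t) ξ₁ * fluctuation N (ρ t) ξ₂ * fluctuation N (ρ t) ξ₄ *
            transportRemainder N K (ρ t) ξ₃
          + fluctuation N (ρ t) ξ₁ * fluctuation N (ρ t) ξ₃ * fluctuation N (ρ t) ξ₄ *
            transportRemainder N K (ρ t) ξ₂
          + fluctuation N (ρ t) ξ₂ * fluctuation N (ρ t) ξ₃ * fluctuation N (ρ t) ξ₄ *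
            transportRemainder N K (ρ t) ξ₁)
        + (noiseCoeff N σ ξ₁ ξ₂ •
            (fluctuation N (ρ t) ξ₃ * fluctuation N (ρ t) ξ₄ * empiricalMode N (ξ₁ + ξ₂))
          + noiseCoeff N σ ξ₁ ξ₃ •
            (fluctuation N (ρ t) ξ₂ * fluctuation N (ρ t) ξ₄ * empiricalMode N (ξ₁ + ξ₃))
          + noiseCoeff N σ ξ₁ ξ₄ •
            (fluctuation N (ρ t) ξ₂ * fluctuation N (ρ t) ξ₃ * empiricalMode N (ξ₁ + ξ₄))
          + noiseCoeff N σ ξ₂ ξ₃ •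
            (fluctuation N (ρ t) ξ₁ * fluctuation N (ρ t) ξ₄ * empiricalMode N (ξ₂ + ξ₃))
          + noiseCoeff N σ ξ₂ ξ₄ •
            (fluctuation N (ρ t) ξ₁ * fluctuation N (ρ t) ξ₃ * empiricalMode N (ξ₂ + ξ₄))
          + noiseCoeff N σ ξ₃ ξ₄ •
            (fluctuation N (ρ t) ξ₁ * fluctuation N (ρ t) ξ₂ * empiricalMode N (ξ₃ + ξ₄)))) := by
  refine ⟨_, ((S.isObservable_pair ξ₁ ξ₂).mul (S.isObservable_pair ξ₃ ξ₄)).of_eq (fun t => rfl)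
    (fun k a t => rfl) fun t => ?_⟩
  ext x
  have e : (2 * σ : ℂ) * ∑ k, ∑ a, (fluctuation N (ρ t) ξ₁ x * fluctuationGrad N ξ₂ k a x
      + fluctuation N (ρ t) ξ₂ x * fluctuationGrad N ξ₁ k a x) *
        (fluctuation N (ρ t) ξ₃ x * fluctuationGrad N ξ₄ k a x
      + fluctuation N (ρ t) ξ₄ x * fluctuationGrad N ξ₃ k a x)
      = fluctuation N (ρ t) ξ₁ x * fluctuation N (ρ t) ξ₃ x *
          (noiseCoeff N σ ξ₂ ξ₄ * empiricalMode N (ξ₂ + ξ₄) x)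
        + fluctuation N (ρ t) ξ₁ x * fluctuation N (ρ t) ξ₄ x *
          (noiseCoeff N σ ξ₂ ξ₃ * empiricalMode N (ξ₂ + ξ₃) x)
        + fluctuation N (ρ t) ξ₂ x * fluctuation N (ρ t) ξ₃ x *
          (noiseCoeff N σ ξ₁ ξ₄ * empiricalMode N (ξ₁ + ξ₄) x)
        + fluctuation N (ρ t) ξ₂ x * fluctuation N (ρ t) ξ₄ x *
          (noiseCoeff N σ ξ₁ ξ₃ * empiricalMode N (ξ₁ + ξ₃) x) := by
    have e1 : ∀ (A B C D : ℂ) k a, (A * fluctuationGrad N ξ₂ k a x + B * fluctuationGrad N ξ₁ k a x)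
        * (C * fluctuationGrad N ξ₄ k a x + D * fluctuationGrad N ξ₃ k a x)
        = A * C * (fluctuationGrad N ξ₂ k a x * fluctuationGrad N ξ₄ k a x)
          + A * D * (fluctuationGrad N ξ₂ k a x * fluctuationGrad N ξ₃ k a x)
          + B * C * (fluctuationGrad N ξ₁ k a x * fluctuationGrad N ξ₄ k a x)
          + B * D * (fluctuationGrad N ξ₁ k a x * fluctuationGrad N ξ₃ k a x) :=
      fun A B C D k a => by ring
    simp only [← sum_fluctuationGrad_mul_apply, e1, Finset.sum_add_distrib, ← Finset.mul_sum]
    ring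
  simp only [ContinuousMap.add_apply, ContinuousMap.mul_apply, ContinuousMap.smul_apply,
    ContinuousMap.sum_apply, smul_eq_mul, e]
  push_cast
  ring

end Dynamic

end

/-! ### Moments of the fluctuations at time zero -/

section

variable {N d : ℕ} {K : UnitAddTorus (Fin d) → UnitAddTorus (Fin d) → EuclideanSpace ℝ (Fin d)}
  {σ : ℝ} {ρ₀ : UnitAddTorus (Fin d) → ℝ}

theorem isProbDensity_prod (h : IsProbDensity ρ₀) :
    IsProbDensity fun x : Config N d => ∏ i, ρ₀ (x i) where
  integrable := Integrable.fintype_prod fun _ => h.integrable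
  nonneg := by
    have : ∀ i : Fin N, ∀ᵐ x : Config N d, 0 ≤ ρ₀ (x i) := fun i =>
      (measurePreserving_eval (fun _ : Fin N => (volume : Measure (UnitAddTorus (Fin d)))) i
        ).quasiMeasurePreserving.ae h.nonneg
    filter_upwards [ae_all_iff.2 this] with x hx
    exact Finset.prod_nonneg fun i _ => hx i
  integral_eq_one := by
    rw [integral_fintype_prod_volume_eq_prod fun _ => ρ₀]
    simp [h.integral_eq_one]

/-- A weak solution attains its datum only through test functions. This already fixes all
characters, hence all observables. -/
theorem IsObservable.expect_initial {f : ℝ → Config N d → ℝ} (h : IsLiouvilleSolution K σ ρ₀ f)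
    (h₀ : IsProbDensity ρ₀) {Ψ : ℝ → C(Config N d, ℂ)} {D : Fin N → Fin d → ℝ → C(Config N d, ℂ)}
    {G : ℝ → C(Config N d, ℂ)} (ho : IsObservable K σ Ψ D G) :
    expect (f 0) (Ψ 0) = expect (fun x : Config N d => ∏ i, ρ₀ (x i)) (Ψ 0) := by
  induction ho with
  | char ζ =>
    rw [expect_character (h.density 0 le_rfl).integrable,
      expect_character (isProbDensity_prod h₀).integrable]
    exact fourierCoefficient_zero_time h.equation ζ
  | add _ _ ih ih' => rw [map_add, map_add, ih, ih']
  | smul _ _ ih => rw [map_smul, map_smul, ih]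

/-- A centred character of a single particle. -/
def centredCharacter (ρ : UnitAddTorus (Fin d) → ℝ) (ξ : Fin d → ℤ) (y : UnitAddTorus (Fin d)) :
    ℂ := UnitAddTorus.mFourier (-ξ) y - modes ρ ξ

theorem norm_centredCharacter_le (h : IsProbDensity ρ₀) (ξ : Fin d → ℤ)
    (y : UnitAddTorus (Fin d)) : ‖centredCharacter ρ₀ ξ y‖ ≤ 2 := by
  refine (norm_sub_le _ _).trans ?_
  rw [norm_mFourier_apply]
  linarith [norm_modes_le h ξ]

theorem integral_centredCharacter (h : IsProbDensity ρ₀) (ξ : Fin d → ℤ) :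
    ∫ y, centredCharacter ρ₀ ξ y * (ρ₀ y : ℂ) = 0 := by
  have hr : Integrable fun y => modes ρ₀ ξ * (ρ₀ y : ℂ) :=
    (h.integrable.ofReal (𝕜 := ℂ)).const_mul _
  simp only [centredCharacter, sub_mul]
  rw [integral_sub (integrable_mFourier_mul h.integrable _) hr,
    integral_const_mul, integral_complex_ofReal, h.integral_eq_one, modes]
  simp

/-- If one factor has its particle to itself, independence splits off its integral, which is zero.
-/
theorem integral_prod_centredCharacter_eq_zero (h : IsProbDensity ρ₀) {m : ℕ}
    (ξ : Fin m → Fin d → ℤ) (i : Fin m → Fin N) (j₀ : Fin m) (hj : ∀ j, i j = i j₀ → j = j₀) :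
    ∫ x : Config N d, (∏ j, centredCharacter ρ₀ (ξ j) (x (i j))) * ((∏ l, ρ₀ (x l) : ℝ) : ℂ)
      = 0 := by
  have e : ∀ x : Config N d,
      (∏ j, centredCharacter ρ₀ (ξ j) (x (i j))) * ((∏ l, ρ₀ (x l) : ℝ) : ℂ)
      = ∏ l, ((∏ j with i j = l, centredCharacter ρ₀ (ξ j) (x l)) * (ρ₀ (x l) : ℂ)) := by
    intro x
    rw [Finset.prod_mul_distrib, Complex.ofReal_prod,
      ← Finset.prod_fiberwise Finset.univ i fun j => centredCharacter ρ₀ (ξ j) (x (i j))]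
    congr 1
    refine Finset.prod_congr rfl fun l _ => Finset.prod_congr rfl fun j hj => ?_
    rw [(Finset.mem_filter.1 hj).2]
  simp only [e]
  rw [integral_fintype_prod_volume_eq_prod fun (l : Fin N) y =>
    (∏ j with i j = l, centredCharacter ρ₀ (ξ j) y) * (ρ₀ y : ℂ)]
  refine Finset.prod_eq_zero (Finset.mem_univ (i j₀)) ?_
  have hf : (Finset.univ.filter fun j => i j = i j₀) = {j₀} := by
    ext j
    simp only [Finset.mem_filter, Finset.mem_univ, true_and, Finset.mem_singleton]
    exact ⟨hj j, fun hjj => hjj ▸ rfl⟩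
  rw [hf]
  simpa using integral_centredCharacter h (ξ j₀)

theorem fluctuation_apply_eq_sum (hN : N ≠ 0) (ρ : UnitAddTorus (Fin d) → ℝ) (ξ : Fin d → ℤ)
    (x : Config N d) :
    fluctuation N ρ ξ x = (N : ℂ)⁻¹ * ∑ k, centredCharacter ρ ξ (x k) := by
  have : (N : ℂ) ≠ 0 := Nat.cast_ne_zero.2 hN
  simp only [fluctuation_apply, empiricalMode_apply, centredCharacter, Finset.sum_sub_distrib,
    Finset.sum_const, Finset.card_univ, Fintype.card_fin, nsmul_eq_mul, mul_sub]
  field_simp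

/-- Expanding the product gives N⁻ᵐ times a sum over multi-indices. The set s need only contain
those in which every particle is repeated, and each of them contributes at most 2ᵐ. -/
theorem norm_expect_prod_fluctuation_le (hN : N ≠ 0) (h : IsProbDensity ρ₀) {m : ℕ}
    (ξ : Fin m → Fin d → ℤ) (s : Finset (Fin m → Fin N))
    (hs : ∀ i, i ∉ s → ∃ j₀, ∀ j, i j = i j₀ → j = j₀) {Φ : C(Config N d, ℂ)}
    (hΦ : ∀ x, Φ x = ∏ j, fluctuation N ρ₀ (ξ j) x) :
    ‖expect (fun x : Config N d => ∏ i, ρ₀ (x i)) Φ‖ ≤ (N : ℝ)⁻¹ ^ m * (s.card * 2 ^ m) := by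
  have hp := isProbDensity_prod (N := N) h
  have hint : ∀ i : Fin m → Fin N, Integrable fun x : Config N d =>
      (∏ j, centredCharacter ρ₀ (ξ j) (x (i j))) * ((∏ l, ρ₀ (x l) : ℝ) : ℂ) := fun i => by
    refine hp.integrable.ofReal.bdd_mul (c := 2 ^ m) ?_ (Filter.Eventually.of_forall fun x => ?_)
    · refine Continuous.aestronglyMeasurable (continuous_finsetProd _ fun j _ => ?_)
      unfold centredCharacter
      fun_prop
    · rw [norm_prod]
      refine (Finset.prod_le_prod (fun _ _ => norm_nonneg _)
        fun j _ => norm_centredCharacter_le h (ξ j) (x (i j))).trans ?_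
      simp
  have e : expect (fun x : Config N d => ∏ i, ρ₀ (x i)) Φ = (N : ℂ)⁻¹ ^ m *
      ∑ i ∈ s, ∫ x : Config N d,
        (∏ j, centredCharacter ρ₀ (ξ j) (x (i j))) * ((∏ l, ρ₀ (x l) : ℝ) : ℂ) := by
    rw [expect_apply hp.integrable]
    have e1 : ∀ x : Config N d, Φ x * ((∏ l, ρ₀ (x l) : ℝ) : ℂ) = (N : ℂ)⁻¹ ^ m *
        ∑ i : Fin m → Fin N, (∏ j, centredCharacter ρ₀ (ξ j) (x (i j))) *
          ((∏ l, ρ₀ (x l) : ℝ) : ℂ) := by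
      intro x
      rw [hΦ]
      simp only [fluctuation_apply_eq_sum hN, Finset.prod_mul_distrib, Finset.prod_const,
        Finset.card_univ, Fintype.card_fin]
      rw [Finset.prod_univ_sum, Fintype.piFinset_univ, ← Finset.sum_mul, mul_assoc]
    simp only [e1]
    rw [integral_const_mul, integral_finsetSum _ fun i _ => hint i]
    congr 1
    refine (Finset.sum_subset (Finset.subset_univ s) fun i _ hi => ?_).symm
    obtain ⟨j₀, hj⟩ := hs i hi
    exact integral_prod_centredCharacter_eq_zero h ξ i j₀ hj
  rw [e, norm_mul, norm_pow, norm_inv, Complex.norm_natCast]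
  refine mul_le_mul_of_nonneg_left ((norm_sum_le _ _).trans ?_) (by positivity)
  rw [← nsmul_eq_mul]
  refine Finset.sum_le_card_nsmul _ _ _ fun i _ => ?_
  have hb : ∀ x : Config N d, ‖(∏ j, centredCharacter ρ₀ (ξ j) (x (i j)))‖ ≤ 2 ^ m := fun x => by
    rw [norm_prod]
    refine (Finset.prod_le_prod (fun _ _ => norm_nonneg _)
      fun j _ => norm_centredCharacter_le h (ξ j) (x (i j))).trans ?_
    simp
  calc _ ≤ ∫ x : Config N d, 2 ^ m * ∏ l, ρ₀ (x l) := by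
        refine norm_integral_le_of_norm_le (hp.integrable.const_mul _) ?_
        filter_upwards [hp.nonneg] with x hx
        rw [norm_mul, Complex.norm_real, Real.norm_of_nonneg hx]
        exact mul_le_mul_of_nonneg_right (hb x) hx
    _ = 2 ^ m := by rw [integral_const_mul, hp.integral_eq_one, mul_one]

theorem card_pair_le :
    (Finset.univ.filter fun i : Fin 2 → Fin N => i 0 = i 1).card ≤ N := by
  have := Finset.card_le_card_of_injOn (s := Finset.univ.filter fun i : Fin 2 → Fin N => i 0 = i 1)
    (t := (Finset.univ : Finset (Fin N))) (fun i => i 0) (fun _ _ => Finset.mem_coe.2 (Finset.mem_univ _))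
    (fun i hi i' hi' hii => by
      simp only [Finset.coe_filter, Finset.mem_univ, true_and, Set.mem_ofPred_eq] at hi hi' hii
      funext j
      fin_cases j <;> grind)
  simpa using this

theorem card_triple_le :
    (Finset.univ.filter fun i : Fin 3 → Fin N => i 0 = i 1 ∧ i 0 = i 2).card ≤ N := by
  have := Finset.card_le_card_of_injOn
    (s := Finset.univ.filter fun i : Fin 3 → Fin N => i 0 = i 1 ∧ i 0 = i 2)
    (t := (Finset.univ : Finset (Fin N))) (fun i => i 0) (fun _ _ => Finset.mem_coe.2 (Finset.mem_univ _))
    (fun i hi i' hi' hii => by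
      simp only [Finset.coe_filter, Finset.mem_univ, true_and, Set.mem_ofPred_eq] at hi hi' hii
      funext j
      fin_cases j <;> grind)
  simpa using this

theorem card_two_pairs_le (a b c e : Fin 4) (h : ∀ j, j = a ∨ j = b ∨ j = c ∨ j = e) :
    (Finset.univ.filter fun i : Fin 4 → Fin N => i a = i b ∧ i c = i e).card ≤ N ^ 2 := by
  have := Finset.card_le_card_of_injOn
    (s := Finset.univ.filter fun i : Fin 4 → Fin N => i a = i b ∧ i c = i e)
    (t := (Finset.univ : Finset (Fin N × Fin N))) (fun i => (i a, i c))
    (fun _ _ => Finset.mem_coe.2 (Finset.mem_univ _))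
    (fun i hi i' hi' hii => by
      simp only [Finset.coe_filter, Finset.mem_univ, true_and, Set.mem_ofPred_eq,
        Prod.mk.injEq] at hi hi' hii
      funext j
      rcases h j with rfl | rfl | rfl | rfl
      · exact hii.1
      · rw [← hi.1, ← hi'.1, hii.1]
      · exact hii.2
      · rw [← hi.2, ← hi'.2, hii.2])
  refine this.trans (le_of_eq ?_)
  simp [sq]

theorem norm_expect_initial_pair_le (hN : N ≠ 0) (h : IsProbDensity ρ₀) (ξ₁ ξ₂ : Fin d → ℤ) :
    ‖expect (fun x : Config N d => ∏ i, ρ₀ (x i)) (fluctuation N ρ₀ ξ₁ * fluctuation N ρ₀ ξ₂)‖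
      ≤ 4 / N := by
  have h0 : (0 : ℝ) < N := Nat.cast_pos.2 (Nat.pos_of_ne_zero hN)
  refine (norm_expect_prod_fluctuation_le hN h ![ξ₁, ξ₂]
    (Finset.univ.filter fun i : Fin 2 → Fin N => i 0 = i 1) (fun i hi => ?_)
    fun x => by simp [Fin.prod_univ_two, ContinuousMap.mul_apply]).trans ?_
  · refine ⟨0, fun j hj => ?_⟩
    simp only [Finset.mem_filter, Finset.mem_univ, true_and] at hi
    fin_cases j <;> grind
  · have := (Nat.cast_le (α := ℝ)).2 (card_pair_le (N := N))
    calc _ ≤ (N : ℝ)⁻¹ ^ 2 * (N * 2 ^ 2) := by gcongr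
      _ = 4 / N := by field_simp; norm_num

theorem norm_expect_initial_triple_le (hN : N ≠ 0) (h : IsProbDensity ρ₀)
    (ξ₁ ξ₂ ξ₃ : Fin d → ℤ) :
    ‖expect (fun x : Config N d => ∏ i, ρ₀ (x i))
      (fluctuation N ρ₀ ξ₁ * fluctuation N ρ₀ ξ₂ * fluctuation N ρ₀ ξ₃)‖ ≤ 8 / N ^ 2 := by
  have h0 : (0 : ℝ) < N := Nat.cast_pos.2 (Nat.pos_of_ne_zero hN)
  refine (norm_expect_prod_fluctuation_le hN h ![ξ₁, ξ₂, ξ₃]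
    (Finset.univ.filter fun i : Fin 3 → Fin N => i 0 = i 1 ∧ i 0 = i 2) (fun i hi => ?_)
    fun x => by simp [Fin.prod_univ_three, ContinuousMap.mul_apply]).trans ?_
  · simp only [Finset.mem_filter, Finset.mem_univ, true_and] at hi
    -- Otherwise each of the three positions shares its particle with another one. Going through the
    -- possible partners shows that all three coincide.
    by_contra! hc
    obtain ⟨j0, h0, h0'⟩ := hc 0
    obtain ⟨j1, h1, h1'⟩ := hc 1
    obtain ⟨j2, h2, h2'⟩ := hc 2
    fin_cases j0 <;> fin_cases j1 <;> fin_cases j2 <;> simp at h0 h1 h2 h0' h1' h2' <;> grind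
  · have := (Nat.cast_le (α := ℝ)).2 (card_triple_le (N := N))
    calc _ ≤ (N : ℝ)⁻¹ ^ 3 * (N * 2 ^ 3) := by gcongr
      _ = 8 / N ^ 2 := by field_simp; norm_num

theorem norm_expect_initial_four_le (hN : N ≠ 0) (h : IsProbDensity ρ₀)
    (ξ₁ ξ₂ ξ₃ ξ₄ : Fin d → ℤ) :
    ‖expect (fun x : Config N d => ∏ i, ρ₀ (x i))
      (fluctuation N ρ₀ ξ₁ * fluctuation N ρ₀ ξ₂ *
        (fluctuation N ρ₀ ξ₃ * fluctuation N ρ₀ ξ₄))‖ ≤ 48 / N ^ 2 := by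
  have h0 : (0 : ℝ) < N := Nat.cast_pos.2 (Nat.pos_of_ne_zero hN)
  let s : Fin 4 → Fin 4 → Fin 4 → Fin 4 → Finset (Fin 4 → Fin N) := fun a b c e =>
    Finset.univ.filter fun i : Fin 4 → Fin N => i a = i b ∧ i c = i e
  refine (norm_expect_prod_fluctuation_le hN h ![ξ₁, ξ₂, ξ₃, ξ₄]
    (s 0 1 2 3 ∪ s 0 2 1 3 ∪ s 0 3 1 2) (fun i hi => ?_)
    fun x => by simp [Fin.prod_univ_four, ContinuousMap.mul_apply, mul_assoc]).trans ?_
  · simp only [s, Finset.mem_union, Finset.mem_filter, Finset.mem_univ, true_and] at hi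
    -- Otherwise each of the four positions has a partner, and every choice of partners forces one
    -- of the three pairings that make up the union.
    by_contra! hc
    obtain ⟨j0, h0, h0'⟩ := hc 0
    obtain ⟨j1, h1, h1'⟩ := hc 1
    obtain ⟨j2, h2, h2'⟩ := hc 2
    obtain ⟨j3, h3, h3'⟩ := hc 3
    fin_cases j0 <;> fin_cases j1 <;> fin_cases j2 <;> fin_cases j3 <;>
      simp at h0 h1 h2 h3 h0' h1' h2' h3' <;> grind
  · have hc : (s 0 1 2 3 ∪ s 0 2 1 3 ∪ s 0 3 1 2).card ≤ N ^ 2 + N ^ 2 + N ^ 2 :=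
      (Finset.card_union_le _ _).trans (add_le_add ((Finset.card_union_le _ _).trans (add_le_add
        (card_two_pairs_le 0 1 2 3 (by decide)) (card_two_pairs_le 0 2 1 3 (by decide))))
        (card_two_pairs_le 0 3 1 2 (by decide)))
    have := (Nat.cast_le (α := ℝ)).2 hc
    push_cast at this
    calc _ ≤ (N : ℝ)⁻¹ ^ 4 * ((N ^ 2 + N ^ 2 + N ^ 2) * 2 ^ 4) := by gcongr
      _ = 48 / N ^ 2 := by field_simp; norm_num

end

/-! ### Moment bounds uniform in time -/

section

theorem norm_le_of_damped_source {ι : Type*} {u w : ι → ℝ → ℂ} {a : ι → ℝ} {B : ℝ} (hB : 0 ≤ B)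
    (he : ∀ i, Evolves (u i) fun t => -((a i : ℝ) : ℂ) * u i t + w i t)
    (hb : ∀ T, ∃ M, ∀ i t, 0 ≤ t → t ≤ T → ‖u i t‖ ≤ M) (h0 : ∀ i, ‖u i 0‖ ≤ B)
    (hw : ∀ M t, 0 ≤ M → 0 ≤ t → (∀ i, ‖u i t‖ ≤ M) → ∀ i, ‖w i t‖ ≤ a i * (M / 2 + B))
    (i : ι) {t : ℝ} (ht : 0 ≤ t) : ‖u i t‖ ≤ 2 * B :=
  norm_le_of_damped hB he hb h0 (fun M t hM ht hu i => by
    have e : -((a i : ℝ) : ℂ) * u i t + w i t + a i * u i t = w i t := by ring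
    rw [e]
    exact hw M t hM ht hu i) i ht

variable {N d : ℕ} {K : UnitAddTorus (Fin d) → UnitAddTorus (Fin d) → EuclideanSpace ℝ (Fin d)}
  {σ : ℝ} {ρ₀ : UnitAddTorus (Fin d) → ℝ} {ρ : ℝ → UnitAddTorus (Fin d) → ℝ}
  {f : ℝ → Config N d → ℝ}

theorem norm_expect_noise_le (hσ : 0 ≤ σ) {h : Config N d → ℝ} {Φ : C(Config N d, ℂ)} {B : ℝ}
    (hΦ : ‖expect h Φ‖ ≤ B) (ξ ξ' : Fin d → ℤ) :
    ‖expect h (noiseCoeff N σ ξ ξ' • Φ)‖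
      ≤ 4 * Real.pi ^ 2 * σ * (freqSq ξ + freqSq ξ') / N * B := by
  have := norm_noiseCoeff_le (N := N) hσ ξ ξ'
  rw [map_smul, smul_eq_mul, norm_mul]
  exact mul_le_mul this hΦ (norm_nonneg _) ((norm_nonneg _).trans this)

namespace IsDiffusive

theorem cast_pos (S : IsDiffusive K σ ρ₀ ρ f) : (0 : ℝ) < N :=
  Nat.cast_pos.2 (Nat.pos_of_ne_zero S.pos)

theorem rate_nonneg (S : IsDiffusive K σ ρ₀ ρ f) (ξ : Fin d → ℤ) :
    0 ≤ 4 * Real.pi ^ 2 * σ * freqSq ξ :=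
  mul_nonneg (mul_nonneg (by positivity) S.nonneg) (freqSq_nonneg ξ)

theorem fluctuation_zero (S : IsDiffusive K σ ρ₀ ρ f) (ξ : Fin d → ℤ) :
    fluctuation N (ρ 0) ξ = fluctuation N ρ₀ ξ := by
  rw [fluctuation, modes_zero_time S.limit, fluctuation]

/-- The damping principle for expectations of a family of observables. The pointwise bound c
supplies the a priori bound and does not enter the conclusion. -/
theorem norm_expect_le_of_damped (S : IsDiffusive K σ ρ₀ ρ f) {ι : Type*} {B c : ℝ} (hB : 0 ≤ B)
    {Ψ G R : ι → ℝ → C(Config N d, ℂ)} {a : ι → ℝ} (hc : ∀ i t x, 0 ≤ t → ‖Ψ i t x‖ ≤ c)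
    (ho : ∀ i, ∃ D, IsObservable K σ (Ψ i) D (G i))
    (hG : ∀ i t, G i t = -((a i : ℝ) : ℂ) • Ψ i t + R i t)
    (h0 : ∀ i, ‖expect (fun x : Config N d => ∏ l, ρ₀ (x l)) (Ψ i 0)‖ ≤ B)
    (hR : ∀ M t, 0 ≤ M → 0 ≤ t → (∀ i, ‖expect (f t) (Ψ i t)‖ ≤ M) →
      ∀ i, ‖expect (f t) (R i t)‖ ≤ a i * (M / 2 + B)) (i : ι) {t : ℝ} (ht : 0 ≤ t) :
    ‖expect (f t) (Ψ i t)‖ ≤ 2 * B := by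
  refine norm_le_of_damped_source (u := fun i t => expect (f t) (Ψ i t)) hB (fun i => ?_)
    (fun T => ⟨c, fun i t ht _ =>
      norm_expect_le (S.particles.density t ht) fun x => hc i t x ht⟩) (fun i => ?_) hR i ht
  · obtain ⟨D, h⟩ := ho i
    refine (h.evolves S.continuous S.summable S.particles).congr (fun _ _ => rfl) fun t _ => ?_
    rw [hG, map_add, map_smul, smul_eq_mul]
  · obtain ⟨D, h⟩ := ho i
    rw [h.expect_initial S.particles S.initial]
    exact h0 i

theorem norm_expect_fluctuationSq_le (S : IsDiffusive K σ ρ₀ ρ f) {t : ℝ} (ht : 0 ≤ t)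
    (ξ : Fin d → ℤ) : ‖expect (f t) (fluctuationSq N (ρ t) ξ)‖ ≤ 8 / N := by
  have hN := S.cast_pos
  -- With r the rate of ξ, the damping is 2r, the transport at most 2r · 4M/100, and the noise at
  -- most 2r/N. The value 4/N is set by the initial datum.
  have key := S.norm_expect_le_of_damped (B := 4 / N) (c := 2 * 2) (by positivity)
    (Ψ := fun ξ t => fluctuationSq N (ρ t) ξ) (fun ξ t x ht => by
      rw [fluctuationSq, ContinuousMap.mul_apply, norm_mul]
      exact mul_le_mul (norm_fluctuation_apply_le (S.limit.density t ht) _ _)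
        (norm_fluctuation_apply_le (S.limit.density t ht) _ _) (norm_nonneg _) zero_le_two)
    (fun ξ => ⟨_, S.isObservable_pair ξ (-ξ)⟩) (fun ξ t => add_assoc _ _ _)
    (fun ξ => by
      rw [fluctuationSq, S.fluctuation_zero, S.fluctuation_zero]
      exact norm_expect_initial_pair_le S.pos S.initial _ _)
    (fun M t hM ht hu ξ => by
      have hh := S.particles.density t ht
      have hr := S.limit.density t ht
      have r1 := S.norm_expect_mul_transportRemainder_le (ρ t) (fluctuation N (ρ t) ξ) (-ξ)
        fun κ => norm_expect_mul_remainderTerm_le hh hr hu ξ (-ξ) κ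
      have r2 := S.norm_expect_mul_transportRemainder_le (ρ t) (fluctuation N (ρ t) (-ξ)) ξ
        fun κ => norm_expect_mul_remainderTerm_le hh hr hu (-ξ) ξ κ
      have r3 := norm_expect_noise_le S.nonneg (norm_expect_le hh fun x =>
        norm_empiricalMode_apply_le (ξ + -ξ) x) ξ (-ξ)
      rw [map_add, map_add]
      refine (norm_add₃_le).trans ((add_le_add (add_le_add r1 r2) r3).trans ?_)
      have p1 := mul_nonneg (S.rate_nonneg ξ) hM
      have p2 := mul_nonneg (S.rate_nonneg ξ) (inv_nonneg.2 hN.le)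
      simp only [freqSq_neg, div_eq_mul_inv] at *
      linarith) ξ ht
  refine key.trans (le_of_eq ?_)
  ring

theorem norm_expect_pair_le (S : IsDiffusive K σ ρ₀ ρ f) {t : ℝ} (ht : 0 ≤ t)
    (ξ₁ ξ₂ : Fin d → ℤ) :
    ‖expect (f t) (fluctuation N (ρ t) ξ₁ * fluctuation N (ρ t) ξ₂)‖ ≤ 8 / N :=
  norm_expect_mul_le (S.particles.density t ht) (S.norm_expect_fluctuationSq_le ht)
    fun x => by rw [ContinuousMap.mul_apply, norm_mul]

theorem norm_expect_pair_mul_empiricalMode_le (S : IsDiffusive K σ ρ₀ ρ f) {t : ℝ} (ht : 0 ≤ t)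
    (ξ₁ ξ₂ ξ : Fin d → ℤ) :
    ‖expect (f t) (fluctuation N (ρ t) ξ₁ * fluctuation N (ρ t) ξ₂ * empiricalMode N ξ)‖
      ≤ 8 / N :=
  norm_expect_mul_le (S.particles.density t ht) (S.norm_expect_fluctuationSq_le ht)
    fun x => by
      rw [ContinuousMap.mul_apply, ContinuousMap.mul_apply, norm_mul, norm_mul]
      exact mul_le_of_le_one_right (by positivity) (norm_empiricalMode_apply_le _ _)

theorem norm_expect_fluctuationSq_mul_self_le (S : IsDiffusive K σ ρ₀ ρ f) {t : ℝ} (ht : 0 ≤ t)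
    (ξ : Fin d → ℤ) :
    ‖expect (f t) (fluctuationSq N (ρ t) ξ * fluctuationSq N (ρ t) ξ)‖ ≤ 96 / N ^ 2 := by
  have hN := S.cast_pos
  -- The damping is 4r and the six noise terms are at most (2r/N)(8/N) each, in total 4r · 24/N².
  -- Again the initial datum decides the constant.
  have key := S.norm_expect_le_of_damped (B := 48 / N ^ 2) (c := 2 * 2 * (2 * 2)) (by positivity)
    (Ψ := fun ξ t => fluctuationSq N (ρ t) ξ * fluctuationSq N (ρ t) ξ) (fun ξ t x ht => by
      have h := norm_fluctuation_apply_le (N := N) (S.limit.density t ht)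
      simp only [fluctuationSq, ContinuousMap.mul_apply, norm_mul]
      gcongr <;> exact h _ _)
    (fun ξ => S.isObservable_four ξ (-ξ) ξ (-ξ)) (fun ξ t => add_assoc _ _ _)
    (fun ξ => by
      rw [fluctuationSq, S.fluctuation_zero, S.fluctuation_zero]
      exact norm_expect_initial_four_le S.pos S.initial _ _ _ _)
    (fun M t hM ht hu ξ => by
      have hh := S.particles.density t ht
      have hr := S.limit.density t ht
      have r := fun ξ₁ ξ₂ ξ₃ ξ₄ : Fin d → ℤ => S.norm_expect_mul_transportRemainder_le (ρ t)
        (fluctuation N (ρ t) ξ₁ * fluctuation N (ρ t) ξ₂ * fluctuation N (ρ t) ξ₃) ξ₄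
        fun κ => norm_expect_mul_three_remainderTerm_le hh hr hu ξ₁ ξ₂ ξ₃ ξ₄ κ
      have n := fun ξ₁ ξ₂ ξ₃ ξ₄ : Fin d → ℤ => norm_expect_noise_le (N := N) S.nonneg
        (S.norm_expect_pair_mul_empiricalMode_le ht ξ₃ ξ₄ (ξ₁ + ξ₂)) ξ₁ ξ₂
      simp only [map_add]
      refine (norm_add_le _ _).trans ((add_le_add
        (norm_add₄_le.trans (add_le_add (add_le_add (add_le_add (r _ _ _ _) (r _ _ _ _))
          (r _ _ _ _)) (r _ _ _ _)))
        ((norm_add_le _ _).trans (add_le_add ((norm_add_le _ _).trans (add_le_add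
          (norm_add₄_le.trans (add_le_add (add_le_add (add_le_add (n _ _ _ _) (n _ _ _ _))
            (n _ _ _ _)) (n _ _ _ _))) (n _ _ _ _))) (n _ _ _ _)))).trans ?_)
      have p1 := mul_nonneg (S.rate_nonneg ξ) hM
      have p2 := mul_nonneg (S.rate_nonneg ξ) (sq_nonneg (N : ℝ)⁻¹)
      clear r n
      simp only [freqSq_neg, div_eq_mul_inv, ← inv_pow] at *
      linarith) ξ ht
  refine key.trans (le_of_eq ?_)
  ring

theorem norm_expect_four_le (S : IsDiffusive K σ ρ₀ ρ f) {t : ℝ} (ht : 0 ≤ t)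
    (ξ₁ ξ₂ ξ₃ ξ₄ : Fin d → ℤ) :
    ‖expect (f t) (fluctuation N (ρ t) ξ₁ * fluctuation N (ρ t) ξ₂ *
      (fluctuation N (ρ t) ξ₃ * fluctuation N (ρ t) ξ₄))‖ ≤ 96 / N ^ 2 :=
  norm_expect_mul_four_le (S.particles.density t ht) (S.norm_expect_fluctuationSq_mul_self_le ht)
    ![ξ₁, ξ₂, ξ₃, ξ₄] fun x => by
      simp [ContinuousMap.mul_apply, mul_assoc]

/-- For odd moments absolute values would lose a factor √N. The quadratic part is therefore kept and
bounded by an even moment A already known; only the linear part feeds back into the unknown bound M.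
-/
theorem norm_expect_mul_remainderTerm_le' (S : IsDiffusive K σ ρ₀ ρ f) {t : ℝ} (ht : 0 ≤ t)
    {Θ : C(Config N d, ℂ)} {A M : ℝ}
    (hA : ∀ ξ ξ', ‖expect (f t) (Θ * (fluctuation N (ρ t) ξ * fluctuation N (ρ t) ξ'))‖ ≤ A)
    (hM : ∀ ξ, ‖expect (f t) (Θ * fluctuation N (ρ t) ξ)‖ ≤ M) (ξ : Fin d → ℤ)
    (κ : Fin 2 → Fin d → ℤ) : ‖expect (f t) (Θ * remainderTerm N (ρ t) ξ κ)‖ ≤ A + 2 * M := by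
  have e : Θ * remainderTerm N (ρ t) ξ κ
      = Θ * (fluctuation N (ρ t) (ξ - κ 0) * fluctuation N (ρ t) (-(κ 1)))
        + modes (ρ t) (-(κ 1)) • (Θ * fluctuation N (ρ t) (ξ - κ 0))
        + modes (ρ t) (ξ - κ 0) • (Θ * fluctuation N (ρ t) (-(κ 1))) := by
    ext x
    simp only [remainderTerm, ContinuousMap.add_apply, ContinuousMap.mul_apply,
      ContinuousMap.smul_apply, smul_eq_mul]
    ring
  have hr := S.limit.density t ht
  have hm : ∀ ξ ξ', ‖modes (ρ t) ξ * expect (f t) (Θ * fluctuation N (ρ t) ξ')‖ ≤ M :=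
    fun ξ ξ' => by
      rw [norm_mul]
      exact (mul_le_of_le_one_left (norm_nonneg _) (norm_modes_le hr _)).trans (hM _)
  rw [e, map_add, map_add, map_smul, map_smul, smul_eq_mul, smul_eq_mul]
  refine norm_add₃_le.trans ((add_le_add (add_le_add (hA _ _) (hm _ _)) (hm _ _)).trans
    (le_of_eq ?_))
  ring

theorem norm_expect_fluctuation_le (S : IsDiffusive K σ ρ₀ ρ f) {t : ℝ} (ht : 0 ≤ t)
    (ξ : Fin d → ℤ) : ‖expect (f t) (fluctuation N (ρ t) ξ)‖ ≤ 1 / N := by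
  have hN := S.cast_pos
  -- The initial moment is zero. The only source is the second moment 8/N, which the factor 1/100
  -- brings below 1/(2N).
  have key := S.norm_expect_le_of_damped (B := 1 / (2 * N)) (c := 2) (by positivity)
    (Ψ := fun ξ t => fluctuation N (ρ t) ξ)
    (fun ξ t x ht => norm_fluctuation_apply_le (S.limit.density t ht) _ _)
    (fun ξ => ⟨_, isObservable_fluctuation S.continuous S.summable S.limit ξ⟩)
    (fun ξ t => rfl)
    (fun ξ => by
      rw [S.fluctuation_zero]
      refine (norm_expect_prod_fluctuation_le S.pos S.initial ![ξ] ∅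
        (fun i _ => ⟨0, fun j _ => Subsingleton.elim _ _⟩) fun x => by simp).trans ?_
      rw [Finset.card_empty, Nat.cast_zero, zero_mul, mul_zero]
      positivity)
    (fun M t hM ht hu ξ => by
      have r := S.norm_expect_mul_transportRemainder_le (ρ t) 1 ξ
        (S.norm_expect_mul_remainderTerm_le' ht (Θ := 1)
          (fun ξ ξ' => by rw [one_mul]; exact S.norm_expect_pair_le ht ξ ξ')
          (fun ξ => by rw [one_mul]; exact hu ξ) ξ)
      rw [one_mul] at r
      refine r.trans ?_
      have p1 := mul_nonneg (S.rate_nonneg ξ) hM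
      have p2 := mul_nonneg (S.rate_nonneg ξ) (inv_nonneg.2 hN.le)
      simp only [div_eq_mul_inv, mul_inv] at *
      linarith) ξ ht
  refine key.trans (le_of_eq ?_)
  field_simp

/-- Splitting the empirical mode as F + ρ̂ leaves a second and a first moment, both O(1/N). This
gives the noise in the third moment its order 1/N². -/
theorem norm_expect_fluctuation_mul_empiricalMode_le (S : IsDiffusive K σ ρ₀ ρ f) {t : ℝ}
    (ht : 0 ≤ t) (ξ ξ' : Fin d → ℤ) :
    ‖expect (f t) (fluctuation N (ρ t) ξ * empiricalMode N ξ')‖ ≤ 9 / N := by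
  have e : fluctuation N (ρ t) ξ * empiricalMode N ξ'
      = fluctuation N (ρ t) ξ * fluctuation N (ρ t) ξ' + modes (ρ t) ξ' • fluctuation N (ρ t) ξ := by
    ext x
    simp only [ContinuousMap.add_apply, ContinuousMap.mul_apply,
      ContinuousMap.smul_apply, smul_eq_mul, fluctuation_apply]
    ring
  rw [e, map_add, map_smul, smul_eq_mul]
  refine (norm_add_le _ _).trans ((add_le_add (S.norm_expect_pair_le ht ξ ξ')
    (?_ : _ ≤ 1 / (N : ℝ))).trans (le_of_eq ?_))
  · rw [norm_mul]
    exact (mul_le_of_le_one_left (norm_nonneg _) (norm_modes_le (S.limit.density t ht) _)).trans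
      (S.norm_expect_fluctuation_le ht ξ)
  · ring

theorem norm_expect_triple_le (S : IsDiffusive K σ ρ₀ ρ f) {t : ℝ} (ht : 0 ≤ t)
    (ξ₁ ξ₂ ξ₃ : Fin d → ℤ) :
    ‖expect (f t) (fluctuation N (ρ t) ξ₁ * fluctuation N (ρ t) ξ₂ * fluctuation N (ρ t) ξ₃)‖
      ≤ 40 / N ^ 2 := by
  have hN := S.cast_pos
  -- Each of the three frequencies lies in two pairs, so the noise is at most 2 · 9/N² times the
  -- total rate. The fourth moment adds 96/(100 N²), and 18.96 ≤ 20.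
  have key := S.norm_expect_le_of_damped (B := 20 / N ^ 2) (c := 2 * 2 * 2) (by positivity)
    (Ψ := fun (ξ : Fin 3 → Fin d → ℤ) t =>
      fluctuation N (ρ t) (ξ 0) * fluctuation N (ρ t) (ξ 1) * fluctuation N (ρ t) (ξ 2))
    (fun ξ t x ht => by
      have h := norm_fluctuation_apply_le (N := N) (S.limit.density t ht)
      simp only [ContinuousMap.mul_apply, norm_mul]
      gcongr <;> exact h _ _)
    (fun ξ => S.isObservable_triple (ξ 0) (ξ 1) (ξ 2)) (fun ξ t => add_assoc _ _ _)
    (fun ξ => by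
      rw [S.fluctuation_zero, S.fluctuation_zero, S.fluctuation_zero]
      refine (norm_expect_initial_triple_le S.pos S.initial _ _ _).trans ?_
      gcongr
      norm_num)
    (fun M t hM ht hu ξ => by
      have r := fun ξ₁ ξ₂ ξ₃ : Fin d → ℤ => S.norm_expect_mul_transportRemainder_le (ρ t)
        (fluctuation N (ρ t) ξ₁ * fluctuation N (ρ t) ξ₂) ξ₃
        (S.norm_expect_mul_remainderTerm_le' ht (S.norm_expect_four_le ht ξ₁ ξ₂)
          (fun ξ => hu ![ξ₁, ξ₂, ξ]) ξ₃)
      have n := fun ξ₁ ξ₂ ξ₃ : Fin d → ℤ => norm_expect_noise_le (N := N) S.nonneg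
        (S.norm_expect_fluctuation_mul_empiricalMode_le ht ξ₃ (ξ₁ + ξ₂)) ξ₁ ξ₂
      simp only [map_add]
      refine (norm_add_le _ _).trans ((add_le_add
        (norm_add₃_le.trans (add_le_add (add_le_add (r _ _ _) (r _ _ _)) (r _ _ _)))
        (norm_add₃_le.trans (add_le_add (add_le_add (n _ _ _) (n _ _ _)) (n _ _ _)))).trans ?_)
      have p := fun i => mul_nonneg (S.rate_nonneg (ξ i)) hM
      have q := fun i => mul_nonneg (S.rate_nonneg (ξ i)) (sq_nonneg (N : ℝ)⁻¹)
      have p0 := p 0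
      have p1 := p 1
      have p2 := p 2
      have q0 := q 0
      have q1 := q 1
      have q2 := q 2
      clear r n p q
      simp only [div_eq_mul_inv, ← inv_pow] at *
      linarith) ![ξ₁, ξ₂, ξ₃] ht
  refine key.trans (le_of_eq ?_)
  ring

end IsDiffusive

end

/-! ### Exchangeability and the empirical covariance -/

section

variable {N d : ℕ} {K : UnitAddTorus (Fin d) → UnitAddTorus (Fin d) → EuclideanSpace ℝ (Fin d)}
  {σ : ℝ} {ρ₀ : UnitAddTorus (Fin d) → ℝ} {ρ : ℝ → UnitAddTorus (Fin d) → ℝ}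
  {f : ℝ → Config N d → ℝ}

theorem summable_transportCoeff_mul
    (hs : Summable (fun ξ : Fin 2 → Fin d → ℤ => ‖kernelCoefficient K ξ‖)) (ξ : Fin d → ℤ)
    {X : (Fin 2 → Fin d → ℤ) → ℂ} {B : ℝ} (hX : ∀ κ, ‖X κ‖ ≤ B) :
    Summable fun κ => transportCoeff K ξ κ * X κ := by
  refine Summable.of_norm_bounded ((summable_transportCoeff hs ξ).mul_right B) fun κ => ?_
  rw [norm_mul]
  exact mul_le_mul_of_nonneg_left (hX κ) (norm_nonneg _)

theorem fourierCoefficient_prod (ρ₀ : UnitAddTorus (Fin d) → ℝ) (ζ : Fin N → Fin d → ℤ) :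
    fourierCoefficient (fun x : Config N d => ∏ i, ρ₀ (x i)) ζ = ∏ k, modes ρ₀ (ζ k) := by
  simp only [fourierCoefficient, modes]
  rw [← integral_fintype_prod_volume_eq_prod fun (k : Fin N) y =>
    UnitAddTorus.mFourier (-(ζ k)) y * (ρ₀ y : ℂ)]
  simp only [Finset.prod_mul_distrib, Complex.ofReal_prod]

/-- The Fourier coefficients are invariant under permutations of the particles. -/
def IsExchangeable (h : Config N d → ℝ) : Prop :=
  ∀ (π : Equiv.Perm (Fin N)) (ζ : Fin N → Fin d → ℤ),
    fourierCoefficient h (ζ ∘ π) = fourierCoefficient h ζ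

theorem isExchangeable_prod (ρ₀ : UnitAddTorus (Fin d) → ℝ) :
    IsExchangeable fun x : Config N d => ∏ i, ρ₀ (x i) := fun π ζ => by
  rw [fourierCoefficient_prod, fourierCoefficient_prod]
  exact Equiv.prod_comp π fun k => modes ρ₀ (ζ k)

theorem single_comp_perm (π : Equiv.Perm (Fin N)) (k : Fin N) (ξ : Fin d → ℤ) :
    (Pi.single (π k) ξ : Fin N → Fin d → ℤ) ∘ π = Pi.single k ξ := by
  funext j
  simp only [Function.comp_apply, Pi.single_apply, π.injective.eq_iff]

/-- A uniqueness argument. The differences of the coefficients at permuted frequencies solve a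
linear damped system with zero datum and no source, so the damping principle with bound 0 makes them
vanish. -/
theorem IsDiffusive.isExchangeable (S : IsDiffusive K σ ρ₀ ρ f) {t : ℝ} (ht : 0 ≤ t) :
    IsExchangeable (f t) := by
  intro π ζ
  have hsum : ∀ t, 0 ≤ t → ∀ (ξ : Fin d → ℤ)
      (ζ : (Fin 2 → Fin d → ℤ) → Fin N → Fin N → Fin d → ℤ), Summable fun κ =>
        transportCoeff K ξ κ * ((N : ℂ)⁻¹ * ∑ l, fourierCoefficient (f t) (ζ κ l)) :=
    fun t ht ξ ζ => summable_transportCoeff_mul S.summable ξ fun κ =>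
      norm_average_le fun l => norm_fourierCoefficient_le_one (S.particles.density t ht) _
  have key := norm_le_of_damped_source (B := 0) le_rfl
    (u := fun ζ t => fourierCoefficient (f t) (ζ ∘ π) - fourierCoefficient (f t) ζ)
    (w := fun ζ t => ∑ k, ∑' κ, transportCoeff K (ζ k) κ * ((N : ℂ)⁻¹ *
      ∑ l, (fourierCoefficient (f t) ((ζ - Pi.single k (κ 0) - Pi.single l (κ 1)) ∘ π)
        - fourierCoefficient (f t) (ζ - Pi.single k (κ 0) - Pi.single l (κ 1)))))
    (a := fun ζ => 4 * Real.pi ^ 2 * σ * ∑ k, freqSq (ζ k))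
    (fun ζ => by
      refine ((evolves_liouville S.continuous S.summable S.particles (ζ ∘ π)).sub
        (evolves_liouville S.continuous S.summable S.particles ζ)).congr
        (fun _ _ => rfl) fun t ht => ?_
      have e1 : ∑ k, freqSq ((ζ ∘ π) k) = ∑ k, freqSq (ζ k) :=
        Equiv.sum_comp π fun k => freqSq (ζ k)
      have e2 : ∑ k, ∑' κ : Fin 2 → Fin d → ℤ, transportCoeff K ((ζ ∘ π) k) κ * ((N : ℂ)⁻¹ *
          ∑ l, fourierCoefficient (f t) (ζ ∘ π - Pi.single k (κ 0) - Pi.single l (κ 1)))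
          = ∑ k, ∑' κ, transportCoeff K (ζ k) κ * ((N : ℂ)⁻¹ *
          ∑ l, fourierCoefficient (f t) ((ζ - Pi.single k (κ 0) - Pi.single l (κ 1)) ∘ π)) := by
        symm
        rw [← Equiv.sum_comp π]
        refine Finset.sum_congr rfl fun k _ => tsum_congr fun κ => ?_
        refine congrArg (fun z => transportCoeff K (ζ (π k)) κ * ((N : ℂ)⁻¹ * z)) ?_
        rw [← Equiv.sum_comp π]
        refine Finset.sum_congr rfl fun l _ => ?_
        rw [← single_comp_perm π k, ← single_comp_perm π l]
        rfl
      have e3 : ∀ k, ∑' κ : Fin 2 → Fin d → ℤ, transportCoeff K (ζ k) κ * ((N : ℂ)⁻¹ *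
          ∑ l, (fourierCoefficient (f t) ((ζ - Pi.single k (κ 0) - Pi.single l (κ 1)) ∘ π)
            - fourierCoefficient (f t) (ζ - Pi.single k (κ 0) - Pi.single l (κ 1))))
          = (∑' κ : Fin 2 → Fin d → ℤ, transportCoeff K (ζ k) κ * ((N : ℂ)⁻¹ *
          ∑ l, fourierCoefficient (f t) ((ζ - Pi.single k (κ 0) - Pi.single l (κ 1)) ∘ π)))
            - ∑' κ : Fin 2 → Fin d → ℤ, transportCoeff K (ζ k) κ * ((N : ℂ)⁻¹ *
          ∑ l, fourierCoefficient (f t) (ζ - Pi.single k (κ 0) - Pi.single l (κ 1))) := by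
        intro k
        rw [← Summable.tsum_sub (hsum t ht (ζ k) _) (hsum t ht (ζ k) _)]
        refine tsum_congr fun κ => ?_
        rw [Finset.sum_sub_distrib]
        ring
      rw [e1, e2, Finset.sum_congr rfl fun k _ => e3 k, Finset.sum_sub_distrib]
      ring)
    (fun T => ⟨1 + 1, fun ζ t ht _ => (norm_sub_le _ _).trans (add_le_add
      (norm_fourierCoefficient_le_one (S.particles.density t ht) _)
      (norm_fourierCoefficient_le_one (S.particles.density t ht) _))⟩)
    (fun ζ => by
      rw [fourierCoefficient_zero_time S.particles.equation,
        fourierCoefficient_zero_time S.particles.equation, isExchangeable_prod ρ₀ π ζ, sub_self,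
        norm_zero])
    (fun M t hM ht hu ζ => by
      refine (norm_sum_le_of_le _ fun k _ => S.tsum_transport_le (ζ k) (B := M) fun κ => ?_).trans ?_
      · rw [norm_mul, norm_inv, Complex.norm_natCast, inv_mul_le_iff₀ S.cast_pos]
        refine (norm_sum_le_of_le _ fun l _ => hu _).trans (le_of_eq ?_)
        simp
      · rw [← Finset.sum_mul, ← Finset.mul_sum]
        refine mul_le_mul_of_nonneg_left (by linarith) (mul_nonneg
          (mul_nonneg (by positivity) S.nonneg) (Finset.sum_nonneg fun k _ => freqSq_nonneg _))) ζ ht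
  rw [mul_zero, norm_le_zero_iff] at key
  exact sub_eq_zero.1 key

theorem IsExchangeable.fourierCoefficient_single {h : Config N d → ℝ} (hh : IsExchangeable h)
    (i k : Fin N) (ξ : Fin d → ℤ) :
    fourierCoefficient h (Pi.single k ξ) = fourierCoefficient h (Pi.single i ξ) := by
  rw [← hh (Equiv.swap k i) (Pi.single i ξ)]
  congr 1
  have := single_comp_perm (Equiv.swap k i) k ξ
  rwa [Equiv.swap_apply_left, eq_comm] at this

theorem IsExchangeable.fourierCoefficient_single_add {h : Config N d → ℝ} (hh : IsExchangeable h)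
    {i j k l : Fin N} (hij : i ≠ j) (hkl : k ≠ l) (ξ ξ' : Fin d → ℤ) :
    fourierCoefficient h (Pi.single k ξ + Pi.single l ξ')
      = fourierCoefficient h (Pi.single i ξ + Pi.single j ξ') := by
  set τ := Equiv.swap k i with hτ
  -- The first transposition takes k to i; the second takes the image of l to j and fixes i, because
  -- i differs both from j and from that image.
  set π := Equiv.swap j (τ l) * τ with hπ
  have h1 : τ k = i := Equiv.swap_apply_left _ _
  have hk : π k = i := by
    rw [hπ, Equiv.Perm.mul_apply, h1]
    exact Equiv.swap_apply_of_ne_of_ne hij (h1 ▸ fun e => hkl (τ.injective e))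
  have hl : π l = j := by
    rw [hπ, Equiv.Perm.mul_apply]
    exact Equiv.swap_apply_right _ _
  refine Eq.trans ?_ (hh π _)
  congr 1
  rw [← single_comp_perm π k, ← single_comp_perm π l, hk, hl]
  rfl

theorem IsExchangeable.expect_empiricalMode {h : Config N d → ℝ} (hh : IsExchangeable h)
    (hi : Integrable h) (i : Fin N) (ξ : Fin d → ℤ) :
    expect h (empiricalMode N ξ) = fourierCoefficient h (Pi.single i ξ) := by
  have hN : (N : ℂ) ≠ 0 := Nat.cast_ne_zero.2 i.pos.ne'
  rw [empiricalMode, map_smul, map_sum]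
  simp only [expect_character hi, hh.fourierCoefficient_single i, Finset.sum_const,
    Finset.card_univ, Fintype.card_fin, nsmul_eq_mul, smul_eq_mul]
  field_simp

/-- Of the N² pairs of particles, the N diagonal ones give the mode ξ + ξ' of a single particle; all
the others give the same two-particle coefficient. -/
theorem IsExchangeable.expect_empiricalMode_mul {h : Config N d → ℝ} (hh : IsExchangeable h)
    (hi : Integrable h) {i j : Fin N} (hij : i ≠ j) (ξ ξ' : Fin d → ℤ) :
    expect h (empiricalMode N ξ * empiricalMode N ξ')
      = (N : ℂ)⁻¹ * fourierCoefficient h (Pi.single i (ξ + ξ'))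
        + (1 - (N : ℂ)⁻¹) * fourierCoefficient h (Pi.single i ξ + Pi.single j ξ') := by
  have hN : (N : ℂ) ≠ 0 := Nat.cast_ne_zero.2 i.pos.ne'
  have e : empiricalMode N ξ * empiricalMode N ξ'
      = ((N : ℂ)⁻¹ * (N : ℂ)⁻¹) • ∑ k, ∑ l, character (Pi.single k ξ + Pi.single l ξ') := by
    ext x
    simp only [empiricalMode, ContinuousMap.mul_apply, ContinuousMap.smul_apply,
      ContinuousMap.sum_apply, smul_eq_mul, character_add, ← Finset.mul_sum, ← Finset.sum_mul]
    ring
  have e1 : ∀ k l : Fin N, fourierCoefficient h (Pi.single k ξ + Pi.single l ξ')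
      = fourierCoefficient h (Pi.single i ξ + Pi.single j ξ') +
        if k = l then fourierCoefficient h (Pi.single i (ξ + ξ'))
          - fourierCoefficient h (Pi.single i ξ + Pi.single j ξ') else 0 := by
    intro k l
    split_ifs with hkl
    · rw [← hkl, ← Pi.single_add, hh.fourierCoefficient_single i]
      ring
    · rw [add_zero, hh.fourierCoefficient_single_add hij hkl]
  rw [e, map_smul, map_sum]
  simp only [map_sum, expect_character hi]
  rw [Finset.sum_congr rfl fun k _ => Finset.sum_congr rfl fun l _ => e1 k l]
  simp only [Finset.sum_add_distrib, Finset.sum_ite_eq, Finset.mem_univ, if_true, Finset.sum_const,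
    Finset.card_univ, Fintype.card_fin, nsmul_eq_mul, smul_eq_mul]
  field_simp
  ring

theorem expect_pair_eq {h : Config N d → ℝ} (hh : IsProbDensity h) (ρ : UnitAddTorus (Fin d) → ℝ)
    (ξ ξ' : Fin d → ℤ) :
    expect h (fluctuation N ρ ξ * fluctuation N ρ ξ')
      = expect h (empiricalMode N ξ * empiricalMode N ξ')
        - modes ρ ξ * expect h (empiricalMode N ξ') - modes ρ ξ' * expect h (empiricalMode N ξ)
        + modes ρ ξ * modes ρ ξ' := by
  have e : fluctuation N ρ ξ * fluctuation N ρ ξ' = empiricalMode N ξ * empiricalMode N ξ'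
      - modes ρ ξ • empiricalMode N ξ' - modes ρ ξ' • empiricalMode N ξ
      + (modes ρ ξ * modes ρ ξ') • 1 := by
    ext x
    simp only [ContinuousMap.add_apply, ContinuousMap.sub_apply, ContinuousMap.mul_apply,
      ContinuousMap.smul_apply, smul_eq_mul, fluctuation_apply, ContinuousMap.one_apply]
    ring
  rw [e, map_add, map_sub, map_sub, map_smul, map_smul, map_smul, expect_one hh]
  simp

theorem expect_initial_pair (h : IsProbDensity ρ₀) {i j : Fin N} (hij : i ≠ j)
    (ξ ξ' : Fin d → ℤ) :
    N * expect (fun x : Config N d => ∏ l, ρ₀ (x l)) (fluctuation N ρ₀ ξ * fluctuation N ρ₀ ξ')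
      = modes ρ₀ (ξ + ξ') - modes ρ₀ ξ * modes ρ₀ ξ' := by
  have hN : (N : ℂ) ≠ 0 := Nat.cast_ne_zero.2 i.pos.ne'
  have hp := isProbDensity_prod (N := N) h
  have he := isExchangeable_prod (N := N) ρ₀
  have m0 : modes ρ₀ 0 = 1 := by
    rw [modes]
    simp [UnitAddTorus.mFourier_zero, integral_complex_ofReal, h.integral_eq_one]
  have h1 : ∀ ξ, fourierCoefficient (fun x : Config N d => ∏ l, ρ₀ (x l)) (Pi.single i ξ)
      = modes ρ₀ ξ := fun ξ => by
    rw [fourierCoefficient_prod, Finset.prod_eq_single i, Pi.single_eq_same]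
    · intro k _ hk
      rw [Pi.single_eq_of_ne hk, m0]
    · simp
  have h2 : fourierCoefficient (fun x : Config N d => ∏ l, ρ₀ (x l))
      (Pi.single i ξ + Pi.single j ξ') = modes ρ₀ ξ * modes ρ₀ ξ' := by
    rw [fourierCoefficient_prod, Finset.prod_eq_mul i j hij]
    · simp [Pi.single_eq_of_ne hij, Pi.single_eq_of_ne hij.symm]
    · intro k _ hk
      simp [Pi.single_eq_of_ne hk.1, Pi.single_eq_of_ne hk.2, m0]
    · simp
    · simp
  rw [expect_pair_eq hp, he.expect_empiricalMode_mul hp.integrable hij,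
    he.expect_empiricalMode hp.integrable i, he.expect_empiricalMode hp.integrable i, h1, h1, h1,
    h2]
  field_simp
  ring

end

/-! ### Convergence of the rescaled covariance -/

section

variable {N d : ℕ} {K : UnitAddTorus (Fin d) → UnitAddTorus (Fin d) → EuclideanSpace ℝ (Fin d)}
  {σ : ℝ} {ρ₀ : UnitAddTorus (Fin d) → ℝ} {ρ : ℝ → UnitAddTorus (Fin d) → ℝ}
  {f : ℝ → Config N d → ℝ} {b : ℝ → Config 2 d → ℝ}

/-- The difference of the covariance of the fluctuations, multiplied by `N`, and of its limit. -/
def covarianceDefect (h : Config N d → ℝ) (r : UnitAddTorus (Fin d) → ℝ) (c : Config 2 d → ℝ)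
    (ζ : Fin 2 → Fin d → ℤ) : ℂ :=
  N * expect h (fluctuation N r (ζ 0) * fluctuation N r (ζ 1))
    - (fourierCoefficient c ζ + modes r (ζ 0 + ζ 1) - modes r (ζ 0) * modes r (ζ 1))

/-- The transport terms in the evolution of `covarianceDefect`. -/
def defectSource (h : Config N d → ℝ) (r : UnitAddTorus (Fin d) → ℝ) (c : Config 2 d → ℝ)
    (ζ : Fin 2 → Fin d → ℤ) (k : Fin 2) (κ : Fin 2 → Fin d → ℤ) : ℂ :=
  N * expect h (fluctuation N r (ζ k.rev) * fluctuation N r (ζ k - κ 0) * fluctuation N r (-(κ 1)))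
    + modes r (-(κ 1)) * covarianceDefect h r c (ζ - Pi.single k (κ 0))
    + modes r (ζ k - κ 0) * covarianceDefect h r c ![ζ k.rev, -(κ 1)]

/-- Replacing each N E[FF] by defect + b̂ + ρ̂(sum) - ρ̂ρ̂ reproduces the Bogolyubov flux. What
remains is the transport of the one-particle terms: the modes shifted by κ belong to the equation of
ρ̂(ζ 0 + ζ 1), and the triple product to that of ρ̂(ζ 0) ρ̂(ζ 1). -/
theorem defectSource_eq (h : Config N d → ℝ) (r : UnitAddTorus (Fin d) → ℝ) (c : Config 2 d → ℝ)
    (ζ : Fin 2 → Fin d → ℤ) (k : Fin 2) (κ : Fin 2 → Fin d → ℤ) :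
    defectSource h r c ζ k κ
      = N * expect h (fluctuation N r (ζ k.rev) * remainderTerm N r (ζ k) κ)
        - bogolyubovModes r c ζ k κ - modes r (ζ 0 + ζ 1 - κ 0) * modes r (-(κ 1))
        + modes r (ζ k.rev) * (modes r (ζ k - κ 0) * modes r (-(κ 1))) := by
  have e : fluctuation N r (ζ k.rev) * remainderTerm N r (ζ k) κ
      = fluctuation N r (ζ k.rev) * fluctuation N r (ζ k - κ 0) * fluctuation N r (-(κ 1))
        + modes r (-(κ 1)) • (fluctuation N r (ζ k.rev) * fluctuation N r (ζ k - κ 0))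
        + modes r (ζ k - κ 0) • (fluctuation N r (ζ k.rev) * fluctuation N r (-(κ 1))) := by
    ext x
    simp only [remainderTerm, ContinuousMap.add_apply, ContinuousMap.mul_apply,
      ContinuousMap.smul_apply, smul_eq_mul]
    ring
  rw [e, map_add, map_add, map_smul, map_smul, smul_eq_mul, smul_eq_mul]
  have h0 : ((Fin.rev 0 : Fin 2)) = 1 := rfl
  have h1 : ((Fin.rev 1 : Fin 2)) = 0 := rfl
  have s0 : ζ 0 - κ 0 + ζ 1 = ζ 0 + ζ 1 - κ 0 := by abel
  have s1 : ζ 0 + (ζ 1 - κ 0) = ζ 0 + ζ 1 - κ 0 := by abel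
  fin_cases k
  · simp only [defectSource, covarianceDefect, bogolyubovModes, Fin.zero_eta, h0, Pi.sub_apply,
      Pi.single_eq_same, Pi.single_eq_of_ne (show (1 : Fin 2) ≠ 0 by decide), sub_zero,
      Matrix.cons_val_zero, Matrix.cons_val_one, s0, mul_comm (fluctuation N r (ζ 1)),
      ← sub_eq_add_neg]
    ring
  · simp only [defectSource, covarianceDefect, bogolyubovModes, Fin.mk_one, h1, Pi.sub_apply,
      Pi.single_eq_same, Pi.single_eq_of_ne (show (0 : Fin 2) ≠ 1 by decide), sub_zero,
      Matrix.cons_val_zero, Matrix.cons_val_one, s1, ← sub_eq_add_neg]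
    ring

theorem norm_bogolyubovModes_le {r : UnitAddTorus (Fin d) → ℝ} (h : IsProbDensity r)
    (c : Config 2 d → ℝ) (ζ : Fin 2 → Fin d → ℤ) (k : Fin 2)
    (κ : Fin 2 → Fin d → ℤ) : ‖bogolyubovModes r c ζ k κ‖ ≤ 2 * (∫ x, |c x|) + 2 := by
  have hm := norm_modes_le h
  have hf := fun ζ => norm_fourierCoefficient_le (u := c) ζ
  have h1 : ∀ ξ ζ, ‖modes r ξ * fourierCoefficient c ζ‖ ≤ ∫ x, |c x| := fun ξ ζ => by
    rw [norm_mul]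
    exact (mul_le_of_le_one_left (norm_nonneg _) (hm ξ)).trans (hf ζ)
  have h1' : ∀ ξ ζ, ‖fourierCoefficient c ζ * modes r ξ‖ ≤ ∫ x, |c x| := fun ξ ζ => by
    rw [mul_comm]
    exact h1 ξ ζ
  have h2 : ∀ ξ ξ', ‖modes r ξ * modes r ξ'‖ ≤ 1 := fun ξ ξ' => by
    rw [norm_mul]
    exact mul_le_one₀ (hm ξ) (norm_nonneg _) (hm ξ')
  have h3 : ∀ ξ ξ' ξ'', ‖modes r ξ * modes r ξ' * modes r ξ''‖ ≤ 1 := fun ξ ξ' ξ'' => by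
    rw [norm_mul]
    exact mul_le_one₀ (h2 ξ ξ') (norm_nonneg _) (hm ξ'')
  unfold bogolyubovModes
  refine (norm_add_le _ _).trans ((add_le_add ((norm_sub_le _ _).trans (add_le_add
    ((norm_add_le _ _).trans (add_le_add (h1 _ _) (h1' _ _))) (h3 _ _ _))) (h2 _ _)).trans
    (le_of_eq ?_))
  ring

namespace IsDiffusive

theorem tsum_defectSource (S : IsDiffusive K σ ρ₀ ρ f) (b : ℝ → Config 2 d → ℝ)
    {t : ℝ} (ht : 0 ≤ t) (ζ : Fin 2 → Fin d → ℤ) (k : Fin 2) :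
    ∑' κ, transportCoeff K (ζ k) κ * defectSource (f t) (ρ t) (b t) ζ k κ
      = N * expect (f t) (fluctuation N (ρ t) (ζ k.rev) * transportRemainder N K (ρ t) (ζ k))
        - (∑' κ, transportCoeff K (ζ k) κ * bogolyubovModes (ρ t) (b t) ζ k κ)
        - (∑' κ, transportCoeff K (ζ k) κ *
            (modes (ρ t) (ζ 0 + ζ 1 - κ 0) * modes (ρ t) (-(κ 1))))
        + modes (ρ t) (ζ k.rev) * ∑' κ, transportCoeff K (ζ k) κ *
            (modes (ρ t) (ζ k - κ 0) * modes (ρ t) (-(κ 1))) := by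
  have hh := S.particles.density t ht
  have hr := S.limit.density t ht
  have h2 : ∀ ξ ξ', ‖modes (ρ t) ξ * modes (ρ t) ξ'‖ ≤ 1 := fun ξ ξ' => by
    rw [norm_mul]
    exact mul_le_one₀ (norm_modes_le hr ξ) (norm_nonneg _) (norm_modes_le hr ξ')
  have s := fun X : (Fin 2 → Fin d → ℤ) → ℂ => fun B (hX : ∀ κ, ‖X κ‖ ≤ B) =>
    (summable_transportCoeff_mul S.summable (ζ k) hX).hasSum
  have key := ((((s _ _ (norm_expect_mul_remainderTerm_le hh hr
    (S.norm_expect_fluctuationSq_le ht) (ζ k.rev) (ζ k))).mul_left (N : ℂ)).sub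
    (s _ _ (norm_bogolyubovModes_le hr (b t) ζ k))).sub
    (s _ _ fun κ => h2 (ζ 0 + ζ 1 - κ 0) (-(κ 1)))).add
    ((s _ _ fun κ => h2 (ζ k - κ 0) (-(κ 1))).mul_left (modes (ρ t) (ζ k.rev)))
  rw [S.expect_mul_transportRemainder, ← key.tsum_eq]
  refine tsum_congr fun κ => ?_
  rw [defectSource_eq]
  ring

theorem freqSq_add (ξ ξ' : Fin d → ℤ) :
    freqSq (ξ + ξ') = freqSq ξ + freqSq ξ' + 2 * freqInner ξ ξ' := by
  simp only [freqSq, freqInner, Pi.add_apply, Finset.mul_sum, ← Finset.sum_add_distrib]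
  refine Finset.sum_congr rfl fun a _ => ?_
  push_cast
  ring

theorem evolves_covarianceDefect (S : IsDiffusive K σ ρ₀ ρ f)
    (hb : IsBogolyubovCorrection K σ ρ b) (ζ : Fin 2 → Fin d → ℤ) :
    Evolves (fun t => covarianceDefect (f t) (ρ t) (b t) ζ) fun t =>
      -((4 * Real.pi ^ 2 * σ * (freqSq (ζ 0) + freqSq (ζ 1)) : ℝ) : ℂ) *
          covarianceDefect (f t) (ρ t) (b t) ζ
        + (∑ k, (∑' κ, transportCoeff K (ζ k) κ * defectSource (f t) (ρ t) (b t) ζ k κ)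
          + N * (noiseCoeff N σ (ζ 0) (ζ 1) * expect (f t) (fluctuation N (ρ t) (ζ 0 + ζ 1)))) := by
  have hN : (N : ℂ) ≠ 0 := Nat.cast_ne_zero.2 S.pos
  have h1 := (evolves_const (N : ℂ)).mul
    ((S.isObservable_pair (ζ 0) (ζ 1)).evolves S.continuous S.summable S.particles)
  have m := fun ξ => evolves_modes S.continuous S.summable S.limit ξ
  have h2 := ((evolves_bogolyubov S.continuous S.summable S.limit hb ζ).add (m (ζ 0 + ζ 1))).sub
    ((m (ζ 0)).mul (m (ζ 1)))
  refine (h1.sub h2).congr (fun _ _ => rfl) fun t ht => ?_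
  have e : ∑' κ : Fin 2 → Fin d → ℤ, transportCoeff K (ζ 0 + ζ 1) κ *
      (modes (ρ t) (ζ 0 + ζ 1 - κ 0) * modes (ρ t) (-(κ 1)))
      = (∑' κ, transportCoeff K (ζ 0) κ *
          (modes (ρ t) (ζ 0 + ζ 1 - κ 0) * modes (ρ t) (-(κ 1))))
        + ∑' κ, transportCoeff K (ζ 1) κ *
          (modes (ρ t) (ζ 0 + ζ 1 - κ 0) * modes (ρ t) (-(κ 1))) := by
    have h2 : ∀ ξ ξ', ‖modes (ρ t) ξ * modes (ρ t) ξ'‖ ≤ 1 := fun ξ ξ' => by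
      rw [norm_mul]
      exact mul_le_one₀ (norm_modes_le (S.limit.density t ht) ξ) (norm_nonneg _)
        (norm_modes_le (S.limit.density t ht) ξ')
    rw [← Summable.tsum_add
      (summable_transportCoeff_mul S.summable (ζ 0) fun κ => h2 (ζ 0 + ζ 1 - κ 0) (-(κ 1)))
      (summable_transportCoeff_mul S.summable (ζ 1) fun κ => h2 (ζ 0 + ζ 1 - κ 0) (-(κ 1)))]
    refine tsum_congr fun κ => ?_
    rw [transportCoeff_add, add_mul]
  have e1 : expect (f t) (fluctuation N (ρ t) (ζ 0 + ζ 1))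
      = expect (f t) (empiricalMode N (ζ 0 + ζ 1)) - modes (ρ t) (ζ 0 + ζ 1) := by
    rw [fluctuation, map_sub, map_smul, expect_one (S.particles.density t ht), smul_eq_mul, mul_one]
  -- The mode ρ̂(ζ 0 + ζ 1) decays at the rate of |ζ 0 + ζ 1|², not of |ζ 0|² + |ζ 1|². The mismatch
  -- equals N times the noise coefficient, so the noise reaches the defect only through empirical
  -- minus limiting mode, a first moment of order 1/N.
  have e2 : (N : ℂ) * noiseCoeff N σ (ζ 0) (ζ 1)
      = ((4 * Real.pi ^ 2 * σ * (freqSq (ζ 0) + freqSq (ζ 1) - freqSq (ζ 0 + ζ 1)) : ℝ) : ℂ) := by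
    rw [noiseCoeff, freqSq_add]
    push_cast
    field_simp
    ring
  rw [← mul_assoc, e2, e1]
  simp only [Fin.sum_univ_two, S.tsum_defectSource b ht, show ((Fin.rev 0 : Fin 2)) = 1 from rfl,
    show ((Fin.rev 1 : Fin 2)) = 0 from rfl, map_add, map_smul, smul_eq_mul, e, covarianceDefect]
  push_cast at e2 ⊢
  linear_combination (-expect (f t) (empiricalMode N (ζ 0 + ζ 1))) * e2

theorem covarianceDefect_zero (S : IsDiffusive K σ ρ₀ ρ f) (hb : IsBogolyubovCorrection K σ ρ b)
    (hN : 2 ≤ N) (ζ : Fin 2 → Fin d → ℤ) : covarianceDefect (f 0) (ρ 0) (b 0) ζ = 0 := by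
  have hij : (⟨0, by omega⟩ : Fin N) ≠ ⟨1, by omega⟩ := by simp
  have h0 : fourierCoefficient (b 0) ζ = 0 := by
    rw [fourierCoefficient_zero_time hb.equation]
    simp [fourierCoefficient]
  have m := fun ξ => modes_zero_time S.limit ξ
  rw [covarianceDefect, (S.isObservable_pair (ζ 0) (ζ 1)).expect_initial S.particles S.initial,
    S.fluctuation_zero, S.fluctuation_zero, expect_initial_pair S.initial hij, h0, m, m, m]
  ring

theorem norm_covarianceDefect_le (S : IsDiffusive K σ ρ₀ ρ f)
    (hb : IsBogolyubovCorrection K σ ρ b) (hN : 2 ≤ N) {t : ℝ} (ht : 0 ≤ t)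
    (ζ : Fin 2 → Fin d → ℤ) : ‖covarianceDefect (f t) (ρ t) (b t) ζ‖ ≤ 4 / N := by
  have hN0 := S.cast_pos
  have hm := fun t ht => norm_modes_le (S.limit.density t ht)
  -- Relative to the total rate the third moments contribute 40/(100 N) and the noise 1/N, together
  -- below 2/N. The defects themselves contribute 2M/100.
  have key := norm_le_of_damped_source (B := 2 / N) (by positivity)
    (S.evolves_covarianceDefect hb) (fun T => by
      obtain ⟨M, hM⟩ := hb.locally_bounded T
      refine ⟨N * (8 / N) + (M + 1 + 1 * 1), fun ζ t ht htT => ?_⟩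
      refine (norm_sub_le _ _).trans (add_le_add ?_ ((norm_sub_le _ _).trans (add_le_add
        ((norm_add_le _ _).trans (add_le_add ((norm_fourierCoefficient_le _).trans (hM t ht htT))
          (hm t ht _))) ?_)))
      · rw [norm_mul, Complex.norm_natCast]
        exact mul_le_mul_of_nonneg_left (S.norm_expect_pair_le ht _ _) hN0.le
      · rw [norm_mul]
        exact mul_le_mul (hm t ht _) (hm t ht _) (norm_nonneg _) zero_le_one)
    (fun ζ => by
      rw [S.covarianceDefect_zero hb hN, norm_zero]
      positivity)
    (fun M t hM ht hu ζ => by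
      have r := fun k => S.tsum_transport_le (ζ k) (B := 40 / N + 2 * M)
        (X := defectSource (f t) (ρ t) (b t) ζ k) fun κ => by
          refine norm_add₃_le.trans ?_
          simp only [norm_mul, Complex.norm_natCast]
          have r1 := mul_le_mul_of_nonneg_left (S.norm_expect_triple_le ht (ζ k.rev) (ζ k - κ 0)
            (-(κ 1))) hN0.le
          have r2 := (mul_le_of_le_one_left (norm_nonneg _) (hm t ht (-(κ 1)))).trans
            (hu (ζ - Pi.single k (κ 0)))
          have r3 := (mul_le_of_le_one_left (norm_nonneg _) (hm t ht (ζ k - κ 0))).trans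
            (hu ![ζ k.rev, -(κ 1)])
          have r4 : (N : ℝ) * (40 / N ^ 2) = 40 / N := by field_simp
          linarith
      have n : ‖(N : ℂ) * (noiseCoeff N σ (ζ 0) (ζ 1) *
          expect (f t) (fluctuation N (ρ t) (ζ 0 + ζ 1)))‖
          ≤ 4 * Real.pi ^ 2 * σ * (freqSq (ζ 0) + freqSq (ζ 1)) * (1 / N) := by
        have := norm_expect_noise_le (N := N) S.nonneg
          (S.norm_expect_fluctuation_le ht (ζ 0 + ζ 1)) (ζ 0) (ζ 1)
        rw [map_smul, smul_eq_mul] at this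
        rw [norm_mul, Complex.norm_natCast]
        refine (mul_le_mul_of_nonneg_left this hN0.le).trans (le_of_eq ?_)
        field_simp
      rw [Fin.sum_univ_two]
      refine (norm_add_le _ _).trans ((add_le_add ((norm_add_le _ _).trans
        (add_le_add (r 0) (r 1))) n).trans ?_)
      have p := fun i => mul_nonneg (S.rate_nonneg (ζ i)) hM
      have q := fun i => mul_nonneg (S.rate_nonneg (ζ i)) (inv_nonneg.2 hN0.le)
      have p0 := p 0
      have p1 := p 1
      have q0 := q 0
      have q1 := q 1
      clear r n p q hu
      simp only [div_eq_mul_inv] at *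
      linarith) ζ ht
  refine key.trans (le_of_eq ?_)
  ring

end IsDiffusive

end

/-! ### Marginals and the two-particle correlation function -/

section

variable {N d : ℕ}

/-- The preimage of a box is a box that leaves the first j auxiliary coordinates free. These have
total mass one, so the measures agree on boxes. -/
theorem measurePreserving_glue {j : ℕ} (hj : j ≤ N) : MeasurePreserving
    (fun p : Config j d × Config N d =>
      ((fun i => if h : i.val < j then p.1 ⟨i.val, h⟩ else p.2 i) : Config N d)) := by
  obtain ⟨m, rfl⟩ := Nat.exists_eq_add_of_le hj
  have hm : Measurable (fun p : Config j d × Config (j + m) d =>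
      ((fun i => if h : i.val < j then p.1 ⟨i.val, h⟩ else p.2 i) : Config (j + m) d)) := by
    refine measurable_pi_lambda _ fun i => ?_
    by_cases h : i.val < j
    · simp only [h, dite_true]
      exact (measurable_pi_apply _).comp measurable_fst
    · simp only [h, dite_false]
      exact (measurable_pi_apply _).comp measurable_snd
  refine ⟨hm, (Measure.pi_eq fun s hs => ?_).symm⟩
  rw [Measure.map_apply hm (MeasurableSet.univ_pi hs)]
  have e : (fun p : Config j d × Config (j + m) d =>
      ((fun i => if h : i.val < j then p.1 ⟨i.val, h⟩ else p.2 i) : Config (j + m) d)) ⁻¹'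
        Set.univ.pi s
      = (Set.univ.pi fun i : Fin j => s (Fin.castAdd m i)) ×ˢ
        Set.univ.pi fun i : Fin (j + m) => if i.val < j then Set.univ else s i := by
    ext p
    simp only [Set.mem_preimage, Set.mem_pi, Set.mem_univ, true_implies, Set.mem_prod]
    constructor
    · refine fun h => ⟨fun i => by simpa using h (Fin.castAdd m i), fun i => ?_⟩
      have := h i
      split_ifs with hi
      · exact Set.mem_univ _
      · rwa [dif_neg hi] at this
    · rintro ⟨h1, h2⟩ i
      split_ifs with hi
      · exact h1 ⟨i, hi⟩
      · have := h2 i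
        rwa [if_neg hi] at this
  rw [e, Measure.volume_eq_prod, Measure.prod_prod,
    volume_pi_pi fun i : Fin j => s (Fin.castAdd m i),
    volume_pi_pi fun i : Fin (j + m) => if i.val < j then Set.univ else s i,
    Fin.prod_univ_add, Fin.prod_univ_add]
  simp

/-- Extension by zero of the frequencies of the first `j` particles. -/
def extendFreq (N : ℕ) {j : ℕ} (ζ : Fin j → Fin d → ℤ) (i : Fin N) : Fin d → ℤ :=
  if h : i.val < j then ζ ⟨i.val, h⟩ else 0

theorem integrable_marginal {f : Config N d → ℝ} (hf : Integrable f) {j : ℕ} (hj : j ≤ N) :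
    Integrable (marginal f j) :=
  ((measurePreserving_glue hj).integrable_comp_of_integrable hf).integral_prod_left

theorem fourierCoefficient_marginal {f : Config N d → ℝ} (hf : Integrable f) {j : ℕ} (hj : j ≤ N)
    (ζ : Fin j → Fin d → ℤ) :
    fourierCoefficient (marginal f j) ζ = fourierCoefficient f (extendFreq N ζ) := by
  have mp := measurePreserving_glue (d := d) hj
  have hi := integrable_mul_character hf (extendFreq N ζ)
  have e : ∀ (x : Config j d) (y : Config N d), character (extendFreq N ζ)
      (fun i => if h : i.val < j then x ⟨i.val, h⟩ else y i) = character ζ x := by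
    intro x y
    obtain ⟨m, rfl⟩ := Nat.exists_eq_add_of_le hj
    rw [character_apply, character_apply, Fin.prod_univ_add]
    simp [extendFreq, UnitAddTorus.mFourier_zero]
  rw [fourierCoefficient_eq, fourierCoefficient_eq, ← mp.map_eq, integral_map mp.aemeasurable
    (by rw [mp.map_eq]; exact hi.aestronglyMeasurable), Measure.volume_eq_prod]
  refine Eq.trans ?_ (integral_prod _ (mp.integrable_comp_of_integrable hi)).symm
  refine integral_congr_ae (Filter.Eventually.of_forall fun x => ?_)
  simp only [Function.comp_apply, e]
  rw [integral_const_mul, integral_complex_ofReal]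
  rfl

theorem extendFreq_one (i : Fin N) (hi : i.val = 0) (ξ : Fin d → ℤ) :
    extendFreq N (fun _ : Fin 1 => ξ) = Pi.single i ξ := by
  funext l
  by_cases h : l = i
  · rw [h, Pi.single_eq_same, extendFreq, dif_pos (by omega)]
  · have := Fin.val_ne_of_ne h
    rw [Pi.single_eq_of_ne h, extendFreq, dif_neg (by omega)]

theorem extendFreq_two (i j : Fin N) (hi : i.val = 0) (hj : j.val = 1) (ζ : Fin 2 → Fin d → ℤ) :
    extendFreq N ζ = Pi.single i (ζ 0) + Pi.single j (ζ 1) := by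
  funext l
  simp only [Pi.add_apply, Pi.single_apply, extendFreq, Fin.ext_iff, hi, hj]
  rcases l with ⟨_ | _ | l, hl⟩ <;> simp

theorem finpartition_fin_two : (Finset.univ : Finset (Finpartition (Finset.univ : Finset (Fin 2))))
    = {⊥, Finpartition.indiscrete (by decide)} := by decide

/-- A set of two elements has only the two trivial partitions, with weights 1 and -1. -/
theorem correlation_two (f : Config N d → ℝ) (x : Config 2 d) :
    correlation f 2 x
      = marginal f 2 x - marginal f 1 (fun _ => x 0) * marginal f 1 (fun _ => x 1) := by
  have h1 : (⊥ : Finpartition (Finset.univ : Finset (Fin 2))).parts = {{0}, {1}} := by decide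
  have h2 : ∀ a : Fin 2, marginal f ({a} : Finset (Fin 2)).card
      (fun i => x (({a} : Finset (Fin 2)).orderEmbOfFin rfl i)) = marginal f 1 fun _ => x a := by
    intro a
    congr 1
    funext i
    exact congrArg x (Finset.orderEmbOfFin_singleton a i)
  have h3 : marginal f (Finset.univ : Finset (Fin 2)).card
      (fun i => x ((Finset.univ : Finset (Fin 2)).orderEmbOfFin rfl i)) = marginal f 2 x := by
    congr 1
    funext i
    have := Finset.orderEmbOfFin_unique (s := (Finset.univ : Finset (Fin 2))) (k := 2) rfl
      (f := id) (fun _ => Finset.mem_univ _) strictMono_id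
    exact congrArg x (congrFun this i).symm
  rw [correlation, finpartition_fin_two, Finset.sum_pair (by decide)]
  rw [h1, Finset.prod_pair (by decide), h2, h2, Finpartition.indiscrete_parts,
    Finset.prod_singleton, h3]
  rw [Finset.card_pair (by decide), Finset.card_singleton]
  norm_num
  ring

theorem integrable_marginal_one {f : Config N d → ℝ} (hf : Integrable f) (hN : 1 ≤ N) :
    Integrable fun y : UnitAddTorus (Fin d) => marginal f 1 fun _ => y :=
  (volume_preserving_funUnique (Fin 1) (UnitAddTorus (Fin d))).symm.integrable_comp_of_integrable
    (integrable_marginal hf hN)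

theorem modes_marginal_one {f : Config N d → ℝ} (hf : Integrable f) (i : Fin N) (hi : i.val = 0)
    (ξ : Fin d → ℤ) :
    modes (fun y : UnitAddTorus (Fin d) => marginal f 1 fun _ => y) ξ
      = fourierCoefficient f (Pi.single i ξ) := by
  rw [← extendFreq_one i hi, ← fourierCoefficient_marginal hf i.pos]
  have := fourierCoefficient_one (fun y : UnitAddTorus (Fin d) => marginal f 1 fun _ => y)
    (fun _ => ξ)
  rw [← this]
  congr 1
  funext x
  congr 1
  funext l
  rw [Subsingleton.elim l 0]

theorem fourierCoefficient_mul_correlation_sub {f : Config N d → ℝ} (hf : Integrable f)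
    {c : Config 2 d → ℝ} (hc : Integrable c) {i j : Fin N} (hi : i.val = 0) (hj : j.val = 1)
    (ζ : Fin 2 → Fin d → ℤ) :
    fourierCoefficient (fun x => (N : ℝ) * correlation f 2 x - c x) ζ
      = N * (fourierCoefficient f (Pi.single i (ζ 0) + Pi.single j (ζ 1))
          - fourierCoefficient f (Pi.single i (ζ 0)) * fourierCoefficient f (Pi.single i (ζ 1)))
        - fourierCoefficient c ζ := by
  have hN : 2 ≤ N := by omega
  have hρ := integrable_marginal_one hf (by omega : 1 ≤ N)
  have i1 := integrable_mul_character (integrable_marginal hf hN) ζ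
  have i2 := integrable_mul_character (integrable_pair_mul hρ hρ 0) ζ
  have i3 := integrable_mul_character hc ζ
  rw [← extendFreq_two i j hi hj, ← fourierCoefficient_marginal hf hN, ← modes_marginal_one hf i hi,
    ← modes_marginal_one hf i hi]
  have e := fourierCoefficient_pair hρ hρ 0 ζ
  rw [show (Fin.rev 0 : Fin 2) = 1 from rfl] at e i2
  rw [← e]
  simp only [fourierCoefficient_eq]
  rw [← integral_sub i1 i2, ← integral_const_mul]
  refine Eq.trans ?_ (integral_sub ((i1.sub i2).const_mul _) i3)
  refine integral_congr_ae (Filter.Eventually.of_forall fun x => ?_)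
  simp only [correlation_two]
  push_cast
  ring

theorem IsDiffusive.norm_fourierCoefficient_mul_correlation_sub_le
    {K : UnitAddTorus (Fin d) → UnitAddTorus (Fin d) → EuclideanSpace ℝ (Fin d)} {σ : ℝ}
    {ρ₀ : UnitAddTorus (Fin d) → ℝ} {ρ : ℝ → UnitAddTorus (Fin d) → ℝ} {f : ℝ → Config N d → ℝ}
    {b : ℝ → Config 2 d → ℝ} (S : IsDiffusive K σ ρ₀ ρ f) (hb : IsBogolyubovCorrection K σ ρ b)
    (hN : 2 ≤ N) {t : ℝ} (ht : 0 ≤ t) (ζ : Fin 2 → Fin d → ℤ) :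
    ‖fourierCoefficient (fun x => (N : ℝ) * correlation (f t) 2 x - b t x) ζ‖ ≤ 18 / N := by
  have hN0 := S.cast_pos
  have hNC : (N : ℂ) ≠ 0 := Nat.cast_ne_zero.2 S.pos
  have hh := S.particles.density t ht
  have hr := S.limit.density t ht
  have he := S.isExchangeable ht
  let i : Fin N := ⟨0, by omega⟩
  let j : Fin N := ⟨1, by omega⟩
  have hij : i ≠ j := by simp [i, j]
  have e1 := fun ξ => he.expect_empiricalMode hh.integrable i ξ
  have e2 := he.expect_empiricalMode_mul hh.integrable hij (ζ 0) (ζ 1)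
  have e3 := expect_pair_eq hh (ρ t) (ζ 0) (ζ 1)
  have e4 : ∀ ξ, expect (f t) (fluctuation N (ρ t) ξ)
      = fourierCoefficient (f t) (Pi.single i ξ) - modes (ρ t) ξ := fun ξ => by
    rw [fluctuation, map_sub, map_smul, expect_one hh, smul_eq_mul, mul_one, e1]
  -- N ĝ₂ differs from N E[FF] by the product of the first moments and by the diagonal terms. The
  -- leading diagonal part ρ̂(ζ 0 + ζ 1) - ρ̂(ζ 0) ρ̂(ζ 1) is exactly what the defect subtracts
  -- besides b̂, so only errors of order 1/N remain.
  have e : fourierCoefficient (fun x => (N : ℝ) * correlation (f t) 2 x - b t x) ζ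
      = covarianceDefect (f t) (ρ t) (b t) ζ - expect (f t) (fluctuation N (ρ t) (ζ 0 + ζ 1))
        + (expect (f t) (fluctuation N (ρ t) (ζ 0) * fluctuation N (ρ t) (ζ 1))
          + modes (ρ t) (ζ 0) * expect (f t) (fluctuation N (ρ t) (ζ 1))
          + modes (ρ t) (ζ 1) * expect (f t) (fluctuation N (ρ t) (ζ 0))
          - (N : ℂ)⁻¹ * (fourierCoefficient (f t) (Pi.single i (ζ 0 + ζ 1))
            - fourierCoefficient (f t) (Pi.single i (ζ 0) + Pi.single j (ζ 1))))
        - N * (expect (f t) (fluctuation N (ρ t) (ζ 0)) *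
          expect (f t) (fluctuation N (ρ t) (ζ 1))) := by
    rw [fourierCoefficient_mul_correlation_sub hh.integrable (hb.integrable t ht)
      (i := i) (j := j) rfl rfl, covarianceDefect, e3, e4, e4, e4, e2, e1, e1]
    field_simp
    ring
  have hE := fun ξ => S.norm_expect_fluctuation_le ht ξ
  have hm : ∀ ξ ξ', ‖modes (ρ t) ξ * expect (f t) (fluctuation N (ρ t) ξ')‖ ≤ 1 / N :=
    fun ξ ξ' => by
      rw [norm_mul]
      exact (mul_le_of_le_one_left (norm_nonneg _) (norm_modes_le hr _)).trans (hE _)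
  have h1 : ‖(N : ℂ)⁻¹ * (fourierCoefficient (f t) (Pi.single i (ζ 0 + ζ 1))
      - fourierCoefficient (f t) (Pi.single i (ζ 0) + Pi.single j (ζ 1)))‖
      ≤ (N : ℝ)⁻¹ * (1 + 1) := by
    rw [norm_mul, norm_inv, Complex.norm_natCast]
    exact mul_le_mul_of_nonneg_left ((norm_sub_le _ _).trans (add_le_add
      (norm_fourierCoefficient_le_one hh _) (norm_fourierCoefficient_le_one hh _)))
      (inv_nonneg.2 hN0.le)
  have h2 : ‖(N : ℂ) * (expect (f t) (fluctuation N (ρ t) (ζ 0)) *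
      expect (f t) (fluctuation N (ρ t) (ζ 1)))‖ ≤ N * (1 / N * (1 / N)) := by
    rw [norm_mul, norm_mul, Complex.norm_natCast]
    exact mul_le_mul_of_nonneg_left (mul_le_mul (hE _) (hE _) (norm_nonneg _) (by positivity))
      hN0.le
  rw [e]
  -- In units of 1/N: 4 from the defect, 1 from the mode ζ 0 + ζ 1, 8 + 1 + 1 + 2 from the bracket,
  -- and 1 from the product of first moments; in total 18.
  refine (norm_sub_le _ _).trans ((add_le_add ((norm_add_le _ _).trans (add_le_add
    ((norm_sub_le _ _).trans (add_le_add (S.norm_covarianceDefect_le hb hN ht ζ) (hE _)))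
    ((norm_sub_le _ _).trans (add_le_add (norm_add₃_le.trans (add_le_add (add_le_add
      (S.norm_expect_pair_le ht _ _) (hm _ _)) (hm _ _))) h1)))) h2).trans (le_of_eq ?_))
  field_simp
  norm_num

end

end ParticleChaos

end

/-! ### Conclusion: choice of the constants -/

theorem mainTheorem5 :
    ∃ C₂ : ℝ, ∀ (d : ℕ)
      (K : UnitAddTorus (Fin d) → UnitAddTorus (Fin d) → EuclideanSpace ℝ (Fin d)),
      Continuous (Function.uncurry K) →
      Summable (fun ξ : Fin 2 → Fin d → ℤ => ‖kernelCoefficient K ξ‖) →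
      ∃ C : ℝ, 0 ≤ C ∧ ∀ σ : ℝ, C < σ →
        ∀ ρ₀ : UnitAddTorus (Fin d) → ℝ, IsProbDensity ρ₀ → MemLp ρ₀ 2 →
        ∀ (ρ : ℝ → UnitAddTorus (Fin d) → ℝ) (b : ℝ → Config 2 d → ℝ),
          IsMcKeanVlasovSolution K σ ρ₀ ρ → IsBogolyubovCorrection K σ ρ b →
        ∀ (N : ℕ), 2 ≤ N → ∀ (f : ℝ → Config N d → ℝ), IsLiouvilleSolution K σ ρ₀ f →
        ∀ t : ℝ, 0 ≤ t →
          hatSupNorm (fun x => (N : ℝ) * correlation (f t) 2 x - b t x)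
            ≤ ENNReal.ofReal (C₂ / N) := by
  refine ⟨18, fun d K hK hs => ?_⟩
  have h0 : 0 ≤ ∑' ξ : Fin 2 → Fin d → ℤ, ‖kernelCoefficient K ξ‖ :=
    tsum_nonneg fun _ => norm_nonneg _
  -- With A the sum of the norms of the kernel coefficients, `IsDiffusive.large` asks for 200π A ≤
  -- 4π²σ. For σ > 50 A the right side is at least 200π² A, and π ≤ π².
  refine ⟨50 * ∑' ξ : Fin 2 → Fin d → ℤ, ‖kernelCoefficient K ξ‖, by positivity,
    fun σ hσ ρ₀ hρ₀ _ ρ b hρ hb N hN f hf t ht => ?_⟩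
  have S : IsDiffusive K σ ρ₀ ρ f := by
    refine ⟨hK, hs, hρ, hf, hρ₀, by omega, ?_⟩
    have h1 := mul_le_mul_of_nonneg_left hσ.le (by positivity : 0 ≤ 4 * Real.pi ^ 2)
    refine le_trans ?_ h1
    have h2 : Real.pi ≤ Real.pi ^ 2 := by nlinarith [Real.pi_gt_three]
    have h3 := mul_le_mul_of_nonneg_right h2 h0
    linarith
  refine iSup_le fun ζ => ?_
  rw [← ofReal_norm]
  exact ENNReal.ofReal_le_ofReal (S.norm_fourierCoefficient_mul_correlation_sub_le hb hN ht ζ)
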